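/- Let $n\ge 1$ and let $(M,h)$ be a smooth Lorentzian manifold of dimension $n+2$ and signature $(-,+,\dots,+)$ which is a Brinkmann wave, i.e. it carries a light-like (null and nowhere vanishing) vector field $X$ that is parallel for the Levi-Civita connection. Put $\Xi=\mathbb{R}X$ and $\Xi^\perp=\{U\in TM : h(U,X)=0\}$, and assume that $(M,h)$ has light-like hypersurface curvature, i.e. its curvature tensor satisfies $R(U,V)W\in\Xi$ for all $U,V,W\in\Xi^\perp$. Then $(M,h)$ is Ricci-isotropic (the image of the Ricci endomorphism is totally isotropic: $h(\mathrm{Ric}\,U,\mathrm{Ric}\,V)=0$ for all $U,V$) if and only if around every point of $M$ there are coordinates $(x,y_1,\dots,y_n,z)$ in which $$h = 2\,dx\,dz + f\,dz^2 + \Big(\sum_{k=1}^n u_k\,dy_k\Big)dz + \sum_{k=1}^n dy_k^2,$$ with smooth functions $u_k$ and $f$ that depend on $(y,z)$ only, such that the $z$-dependent family of one-forms $\phi_z=\sum_{k=1}^n u_k(\cdot,z)\,dy_k$ on (open subsets of) $\mathbb{R}^n$ satisfies $$d^*d\,\phi_z=0\qquad\text{for all } z,$$ at all $(y,z)$ in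 the range of the coordinates. Here $d$ is the exterior derivative on $\mathbb{R}^n$ and $d^*$ is the codifferential with respect to the flat metric $\sum_k dy_k^2$. The same equivalence holds if the coordinates are required, in addition, to satisfy $\partial/\partial x = X$. -/

import Mathlib

open scoped Manifold ContDiff

noncomputable section

namespace BrinkmannWave

/-- Euclidean space `ℝᵐ`. -/
abbrev Euc (m : ℕ) : Type := EuclideanSpace ℝ (Fin m)

/-- The `i`-th vector of the standard basis of `ℝᵐ`. -/
def stdVec {m : ℕ} (i : Fin m) : Euc m := EuclideanSpace.single i (1 : ℝ)

/-! ### Levi-Civita connection and curvature of a metric on an open subset of `ℝᵐ`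

A (pseudo-Riemannian) metric on an open subset of `ℝᵐ` is given by its component function
`g : ℝᵐ → (ℝᵐ →L ℝᵐ →L ℝ)`. All operators below are local in the base point `q`. -/

section LocalGeometry

variable {m : ℕ}

/-- The Christoffel map `Γ_q(u, v)` of the Levi-Civita connection of `g`. It is determined by
`g_q(Γ_q(u, v), w) = ½ (∂_u g(v, w) + ∂_v g(u, w) - ∂_w g(u, v))(q)` for all `w`. -/
def christoffel (g : Euc m → Euc m →L[ℝ] Euc m →L[ℝ] ℝ) (q u v : Euc m) : Euc m :=
  (g q).inverse ((1 / 2 : ℝ) •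
    (fderiv ℝ g q u v + fderiv ℝ g q v u - ((fderiv ℝ g q).flip u).flip v))

/-- The covariant derivative `∇_u Y` at `q` of a vector field `Y`. -/
def covDeriv (g : Euc m → Euc m →L[ℝ] Euc m →L[ℝ] ℝ) (Y : Euc m → Euc m) (q u : Euc m) : Euc m :=
  fderiv ℝ Y q u + christoffel g q u (Y q)

/-- The curvature tensor at `q`, `R(u, v)w = ∇_u ∇_v w - ∇_v ∇_u w` for the vectors `u, v, w`
extended to constant (hence commuting) vector fields. -/
def curvature (g : Euc m → Euc m →L[ℝ] Euc m →L[ℝ] ℝ) (q u v w : Euc m) : Euc m :=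
  covDeriv g (fun q' => christoffel g q' v w) q u - covDeriv g (fun q' => christoffel g q' u w) q v

/-- The Ricci tensor `Ric(u, v) = tr (w ↦ R(w, u)v)` at `q`. -/
def ricci (g : Euc m → Euc m →L[ℝ] Euc m →L[ℝ] ℝ) (q u v : Euc m) : ℝ :=
  ∑ i : Fin m, curvature g q (stdVec i) u v i

/-- The Ricci endomorphism at `q`: the vector `ricciEnd g q u` is the metric dual of the
covector `Ric(u, ·)`. -/
def ricciEnd (g : Euc m → Euc m →L[ℝ] Euc m →L[ℝ] ℝ) (q u : Euc m) : Euc m :=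
  (g q).inverse (∑ i : Fin m, ricci g q u (stdVec i) • EuclideanSpace.proj i)

end LocalGeometry

/-! ### Codifferential with respect to the flat metric of `ℝⁿ` -/

/-- The codifferential of a `(k+1)`-form on `ℝⁿ` with respect to the flat metric,
`(d^*α)(v₁, …, v_k) = - ∑ⱼ (∂ⱼ α)(eⱼ, v₁, …, v_k)`. -/
def codifferential {n k : ℕ} (α : Euc n → Euc n [⋀^Fin (k + 1)]→L[ℝ] ℝ) (y : Euc n) :
    Euc n [⋀^Fin k]→L[ℝ] ℝ :=
  -∑ j : Fin n, (fderiv ℝ α y (stdVec j)).curryLeft (stdVec j)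

/-- The one-form `∑ₖ aₖ dyₖ` on `ℝⁿ`. -/
def oneForm {n : ℕ} (a : Fin n → Euc n → ℝ) (y : Euc n) : Euc n [⋀^Fin 1]→L[ℝ] ℝ :=
  ContinuousAlternatingMap.ofSubsingleton ℝ (Euc n) ℝ (0 : Fin 1)
    (∑ k : Fin n, a k y • (EuclideanSpace.proj k : Euc n →L[ℝ] ℝ))

/-! ### Lorentzian manifolds

`M` is a smooth manifold of dimension `n + 2` (without boundary). -/

section Manifold

variable {n : ℕ} {M : Type*} [TopologicalSpace M] [ChartedSpace (Euc (n + 2)) M]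

/-- A smooth Lorentzian metric on `M`, of signature `(-, +, …, +)`. -/
structure LorentzianMetric (n : ℕ) (M : Type*) [TopologicalSpace M]
    [ChartedSpace (Euc (n + 2)) M] [IsManifold (𝓡 (n + 2)) ∞ M] where
  /-- The scalar product on the tangent spaces. -/
  inner (p : M) : TangentSpace (𝓡 (n + 2)) p →L[ℝ] TangentSpace (𝓡 (n + 2)) p →L[ℝ] ℝ
  symm (p : M) (v w : TangentSpace (𝓡 (n + 2)) p) : inner p v w = inner p w v
  signature (p : M) : ∃ b : Module.Basis (Fin (n + 2)) ℝ (TangentSpace (𝓡 (n + 2)) p),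
    ∀ i j, inner p (b i) (b j) = if i = j then (if i = 0 then -1 else 1) else 0
  contMDiff : ContMDiff (𝓡 (n + 2))
    ((𝓡 (n + 2)).prod 𝓘(ℝ, Euc (n + 2) →L[ℝ] Euc (n + 2) →L[ℝ] ℝ)) ∞
    (fun p => Bundle.TotalSpace.mk' (Euc (n + 2) →L[ℝ] Euc (n + 2) →L[ℝ] ℝ)
      (E := fun p : M => TangentSpace (𝓡 (n + 2)) p →L[ℝ] TangentSpace (𝓡 (n + 2)) p →L[ℝ] ℝ)
      p (inner p))

variable [IsManifold (𝓡 (n + 2)) ∞ M]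

/-- The components of the metric `h` in the chart `e`: the pull-back of `h` along `e⁻¹`. -/
def metricInChart (h : LorentzianMetric n M) (e : OpenPartialHomeomorph M (Euc (n + 2)))
    (q : Euc (n + 2)) : Euc (n + 2) →L[ℝ] Euc (n + 2) →L[ℝ] ℝ :=
  let A : Euc (n + 2) →L[ℝ] Euc (n + 2) := mfderiv (𝓡 (n + 2)) (𝓡 (n + 2)) e.symm q
  let B : Euc (n + 2) →L[ℝ] Euc (n + 2) →L[ℝ] ℝ := h.inner (e.symm q)
  B.bilinearComp A A

/-- The components of the vector field `X` in the chart `e`. -/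
def fieldInChart (X : ∀ p : M, TangentSpace (𝓡 (n + 2)) p)
    (e : OpenPartialHomeomorph M (Euc (n + 2))) (q : Euc (n + 2)) : Euc (n + 2) :=
  mfderiv (𝓡 (n + 2)) (𝓡 (n + 2)) e (e.symm q) (X (e.symm q))

/-- `X` is parallel for the Levi-Civita connection of `h`: `∇X = 0`. Here and below, tensorial
conditions are expressed in all charts of the smooth structure; by tensoriality it is the same to
express them in one chart around each point. -/
def IsParallel (h : LorentzianMetric n M) (X : ∀ p : M, TangentSpace (𝓡 (n + 2)) p) : Prop :=
  ∀ e ∈ IsManifold.maximalAtlas (𝓡 (n + 2)) ∞ M, ∀ q ∈ e.target, ∀ u : Euc (n + 2),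
    covDeriv (metricInChart h e) (fieldInChart X e) q u = 0

/-- `(M, h)` with the vector field `X` is a Brinkmann wave: `X` is a smooth, light-like
(nowhere zero and null) and parallel vector field. -/
structure IsBrinkmannWave (h : LorentzianMetric n M)
    (X : ∀ p : M, TangentSpace (𝓡 (n + 2)) p) : Prop where
  smooth : ContMDiff (𝓡 (n + 2)) (𝓡 (n + 2)).tangent ∞
    (fun p => (⟨p, X p⟩ : TangentBundle (𝓡 (n + 2)) M))
  ne_zero : ∀ p, X p ≠ 0
  null : ∀ p, h.inner p (X p) (X p) = 0
  parallel : IsParallel h X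

/-- Light-like hypersurface curvature: with `Ξ = ℝ X`, one has `R(U, V) : Ξ^⊥ → Ξ` for all
`U, V ∈ Ξ^⊥`. -/
def HasLightlikeHypersurfaceCurvature (h : LorentzianMetric n M)
    (X : ∀ p : M, TangentSpace (𝓡 (n + 2)) p) : Prop :=
  ∀ e ∈ IsManifold.maximalAtlas (𝓡 (n + 2)) ∞ M, ∀ q ∈ e.target, ∀ U V W : Euc (n + 2),
    metricInChart h e q U (fieldInChart X e q) = 0 →
    metricInChart h e q V (fieldInChart X e q) = 0 →
    metricInChart h e q W (fieldInChart X e q) = 0 →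
      ∃ c : ℝ, curvature (metricInChart h e) q U V W = c • fieldInChart X e q

/-- Ricci-isotropy: the image of the Ricci endomorphism is totally isotropic,
`h(Ric U, Ric V) = 0` for all `U, V`. -/
def IsRicciIsotropic (h : LorentzianMetric n M) : Prop :=
  ∀ e ∈ IsManifold.maximalAtlas (𝓡 (n + 2)) ∞ M, ∀ q ∈ e.target, ∀ U V : Euc (n + 2),
    metricInChart h e q (ricciEnd (metricInChart h e) q U) (ricciEnd (metricInChart h e) q V) = 0

/-! ### Coordinates `(x, y₁, …, yₙ, z)` -/

/-- The `x`-coordinate of a point (or vector) of `ℝⁿ⁺²`. -/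
def xCoord (q : Euc (n + 2)) : ℝ := q 0

/-- The `y`-coordinates of a point (or vector) of `ℝⁿ⁺²`. -/
def yCoord (q : Euc (n + 2)) : Euc n := WithLp.toLp 2 fun k : Fin n => q k.castSucc.succ

/-- The `z`-coordinate of a point (or vector) of `ℝⁿ⁺²`. -/
def zCoord (q : Euc (n + 2)) : ℝ := q (Fin.last (n + 1))

/-- The range of the coordinates `(y, z)` over the domain of the chart `e`. -/
def yzDomain (e : OpenPartialHomeomorph M (Euc (n + 2))) : Set (Euc n × ℝ) :=
  (fun q => (yCoord q, zCoord q)) '' e.target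

/-- `e = (x, y, z)` is a chart of the smooth structure in which
`h = 2 dx dz + f dz² + (∑ₖ uₖ dyₖ) dz + ∑ₖ dyₖ²`,
where the smooth functions `uₖ` and `f` depend on `(y, z)` only. The metric is written as a
quadratic form. -/
structure IsFlatBrinkmannChart (h : LorentzianMetric n M)
    (e : OpenPartialHomeomorph M (Euc (n + 2)))
    (u : Fin n → Euc n → ℝ → ℝ) (f : Euc n → ℝ → ℝ) : Prop where
  mem_atlas : e ∈ IsManifold.maximalAtlas (𝓡 (n + 2)) ∞ M
  smooth_u : ∀ k, ContDiffOn ℝ ∞ (fun w : Euc n × ℝ => u k w.1 w.2) (yzDomain e)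
  smooth_f : ContDiffOn ℝ ∞ (fun w : Euc n × ℝ => f w.1 w.2) (yzDomain e)
  metric_eq : ∀ q ∈ e.target, ∀ v : Euc (n + 2),
    metricInChart h e q v v =
      2 * xCoord v * zCoord v + f (yCoord q) (zCoord q) * zCoord v ^ 2
        + (∑ k, u k (yCoord q) (zCoord q) * yCoord v k) * zCoord v + ∑ k, yCoord v k ^ 2

/-- The first coordinate vector field `∂/∂x` of the chart `e` is `X`. -/
def IsAdaptedChart (X : ∀ p : M, TangentSpace (𝓡 (n + 2)) p)
    (e : OpenPartialHomeomorph M (Euc (n + 2))) : Prop :=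
  ∀ q ∈ e.target, fieldInChart X e q = stdVec 0

/-- `d^*d φ_z = 0` for all `z`, where `φ_z = ∑ₖ uₖ(·, z) dyₖ`, at all `(y, z)` over the domain
of the chart `e`. -/
def CoclosedDifferential (e : OpenPartialHomeomorph M (Euc (n + 2)))
    (u : Fin n → Euc n → ℝ → ℝ) : Prop :=
  ∀ y z, (y, z) ∈ yzDomain e →
    codifferential (extDeriv (oneForm fun k y' => u k y' z)) y = 0

end Manifold

end BrinkmannWave

end

open scoped Manifold ContDiff Topology

noncomputable section

/-! A parallel null field X puts the metric in Walker form. Straighten X to ∂/∂x. Then ∇X = 0 says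
that Γ(·, ∂/∂x) = 0, so the metric does not depend on x and the one-form h(X, ·) is closed. A
potential z of this form serves as a coordinate, and the leaves of Ξ^⊥ are the level sets of z
(`exists_isWalkerMetric`). On a leaf h is degenerate along X only, so it amounts to a metric in the
y-directions that depends on the parameter z. The curvature hypothesis says exactly that the y-part
of R vanishes on Ξ^⊥, which makes these metrics flat. Flat coordinates chosen smoothly in z turn
them all into ∑ dyₖ² and affect only the coefficients of the terms containing dz
(`exists_flat_coordinates`, `exists_isFlatBrinkmannMetric`).

In such coordinates the only y-component of Γ(·, ∂/∂yⱼ) is half the curl of h(∂/∂z, ·), weighted by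
dz. Hence Ric(U, ∂/∂x) = 0, and Ric(U, ∂/∂yⱼ) is ½ dz(U) times the divergence of that curl
(`ricci_yIncl`). So Ric U lies in Ξ^⊥, where h only sees y-parts and is the Euclidean scalar product
of these: h(Ric U, Ric V) = ¼ dz(U) dz(V) ∑ₖ (div curl)ₖ². A sum of squares vanishes only if each
term does, and div curl is half of d^*d φ because φ = 2 h(∂/∂z, ·) on y-vectors. This gives both
directions inside one flat Brinkmann chart (`coclosedDifferential_iff`). Since Ricci-isotropy is a
condition in every chart, the converse direction also needs the curvature and the Ricci endomorphism
to be natural under changes of charts.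

The existence of coordinates rests on a Frobenius theorem for D_v F = A(v, p, F) with smooth
dependence on p. Its radial equations are solved by the inverse function theorem in C([0,1], G), for
which superposition operators must be smooth; integrability together with a Grönwall estimate then
shows that the radial solution satisfies the full system. -/

namespace BrinkmannWave

/-! ### Smoothness of superposition operators on spaces of continuous maps -/

section Superposition

universe u
variable {K : Type*} [TopologicalSpace K] [CompactSpace K]
variable {E : Type u} [NormedAddCommGroup E] [NormedSpace ℝ E]
variable {F : Type u} [NormedAddCommGroup F] [NormedSpace ℝ F]

/-- A bounded bilinear map applied pointwise to continuous maps on a compact space. -/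
def pointwiseBilin (K : Type*) [TopologicalSpace K] [CompactSpace K] {H E F : Type*}
    [NormedAddCommGroup H] [NormedSpace ℝ H] [NormedAddCommGroup E] [NormedSpace ℝ E]
    [NormedAddCommGroup F] [NormedSpace ℝ F] (B : H →L[ℝ] E →L[ℝ] F) :
    C(K, H) →L[ℝ] C(K, E) →L[ℝ] C(K, F) :=
  LinearMap.mkContinuous₂
    (LinearMap.mk₂ ℝ (fun (A : C(K, H)) (g : C(K, E)) =>
      (⟨fun t => B (A t) (g t), by fun_prop⟩ : C(K, F)))
      (by intros; ext; simp) (by intros; ext; simp) (by intros; ext; simp)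
      (by intros; ext; simp)) ‖B‖ (by
    intro A g
    rw [ContinuousMap.norm_le _ (by positivity)]
    intro t
    refine (B.le_opNorm₂ _ _).trans ?_
    gcongr
    · exact A.norm_coe_le_norm t
    · exact g.norm_coe_le_norm t)

@[simp]
lemma pointwiseBilin_apply {H : Type*} [NormedAddCommGroup H] [NormedSpace ℝ H]
    (B : H →L[ℝ] E →L[ℝ] F) (A : C(K, H)) (g : C(K, E)) (t : K) :
    pointwiseBilin K B A g t = B (A t) (g t) := rfl

/-- Continuity of γ ↦ f' ∘ γ in the sup norm controls f' on all segments from γ t to γ t + g t at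
once, uniformly in t; the mean value inequality on each segment then bounds the remainder. The
derivative appears as a bounded linear image of the superposition operator of f', which is the form
needed for induction on the order of smoothness. -/
lemma hasFDerivAt_postcomp {H : Type*} [NormedAddCommGroup H] [NormedSpace ℝ H]
    (B : H →L[ℝ] E →L[ℝ] F) {f : E → F} {f' : E → H}
    (hf : ∀ x, HasFDerivAt f (B (f' x)) x)
    (hc : Continuous f) (hc' : Continuous f') (γ : C(K, E)) :
    HasFDerivAt (fun γ : C(K, E) => (⟨f, hc⟩ : C(E, F)).comp γ)
      (pointwiseBilin K B ((⟨f', hc'⟩ : C(E, H)).comp γ)) γ := by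
  rw [hasFDerivAt_iff_isLittleO_nhds_zero, Asymptotics.isLittleO_iff]
  intro c hcpos
  have hcont : Continuous fun γ : C(K, E) => (⟨f', hc'⟩ : C(E, H)).comp γ :=
    ContinuousMap.continuous_postcomp _
  -- The summand 1 keeps the quotient meaningful when B = 0.
  obtain ⟨δ, hδ, hball⟩ := Metric.continuousAt_iff.1 (hcont.continuousAt (x := γ))
    (c / (‖B‖ + 1)) (by positivity)
  filter_upwards [Metric.ball_mem_nhds (0 : C(K, E)) hδ] with g hg
  rw [ContinuousMap.norm_le _ (by positivity)]
  intro t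
  have hseg : ∀ x ∈ segment ℝ (γ t) (γ t + g t), ‖B (f' x) - B (f' (γ t))‖ ≤ c := by
    intro x hx
    rw [segment_eq_image'] at hx
    obtain ⟨s, hs, rfl⟩ := hx
    have h1 : dist (γ + s • g) γ < δ := by
      rw [dist_eq_norm, add_sub_cancel_left, norm_smul, Real.norm_of_nonneg hs.1]
      have : ‖g‖ < δ := by simpa using hg
      nlinarith [norm_nonneg g, hs.2]
    have h2 := hball h1
    have h3 := (ContinuousMap.dist_apply_le_dist t).trans h2.le
    rw [dist_eq_norm] at h3
    have h4 : ‖f' (γ t + s • g t) - f' (γ t)‖ ≤ c / (‖B‖ + 1) := h3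
    rw [← map_sub]
    refine (B.le_opNorm _).trans ?_
    simp only [add_sub_cancel_left]
    calc ‖B‖ * ‖f' (γ t + s • g t) - f' (γ t)‖ ≤ (‖B‖ + 1) * (c / (‖B‖ + 1)) := by
          gcongr; linarith
      _ = c := by field_simp
  have := (convex_segment (γ t) (γ t + g t)).norm_image_sub_le_of_norm_hasFDerivWithin_le'
    (fun x _ => (hf x).hasFDerivWithinAt) hseg (left_mem_segment ℝ _ _) (right_mem_segment ℝ _ _)
  rw [add_sub_cancel_left] at this
  refine le_trans ?_ (mul_le_mul_of_nonneg_left (g.norm_coe_le_norm t) hcpos.le)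
  simpa using this

/-- The superposition operator `γ ↦ f ∘ γ` of a smooth map is smooth. -/
theorem contDiff_postcomp {f : E → F} (hf : ContDiff ℝ ∞ f) :
    ContDiff ℝ ∞ (fun γ : C(K, E) => (⟨f, hf.continuous⟩ : C(E, F)).comp γ) := by
  -- The target must vary in the induction, since the derivative of f takes values in E →L[ℝ] F; E
  -- and F share a universe so that this space is again an admissible target.
  have key : ∀ (m : ℕ) (F : Type u) [NormedAddCommGroup F] [NormedSpace ℝ F] (f : E → F)
      (hf : ContDiff ℝ ∞ f),
      ContDiff ℝ m (fun γ : C(K, E) => (⟨f, hf.continuous⟩ : C(E, F)).comp γ) := by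
    intro m
    induction m with
    | zero =>
      intro F _ _ f hf
      exact contDiff_zero.2 (ContinuousMap.continuous_postcomp _)
    | succ m ih =>
      intro F _ _ f hf
      have hf' : ContDiff ℝ ∞ (fderiv ℝ f) := hf.fderiv_right (by simp)
      refine (contDiff_succ_iff_hasFDerivAt (n := m)).2
        ⟨_, (pointwiseBilin K (ContinuousLinearMap.id ℝ (E →L[ℝ] F))).contDiff.comp
          (ih _ _ hf'), fun γ => ?_⟩
      exact hasFDerivAt_postcomp (ContinuousLinearMap.id ℝ (E →L[ℝ] F))
        (fun x => (hf.differentiable (by simp) x).hasFDerivAt) _ _ γ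
  exact contDiff_infty.2 fun m => key m F f hf

end Superposition

/-! ### Inverse functions and fixed points depending on parameters -/

/-- The inverse function theorem for smooth maps, on a whole neighbourhood. -/
theorem exists_openPartialHomeomorph_of_contDiffOn {E F : Type*} [NormedAddCommGroup E]
    [NormedSpace ℝ E] [CompleteSpace E] [NormedAddCommGroup F] [NormedSpace ℝ F]
    {f : E → F} {U : Set E} (hU : IsOpen U) (hf : ContDiffOn ℝ ∞ f U) {a : E} (ha : a ∈ U)
    {f' : E ≃L[ℝ] F} (hf' : HasFDerivAt f (f' : E →L[ℝ] F) a) :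
    ∃ e : OpenPartialHomeomorph E F, ⇑e = f ∧ a ∈ e.source ∧ e.source ⊆ U ∧
      ContDiffOn ℝ ∞ e.symm e.target ∧
      ∀ x ∈ e.source, (fderiv ℝ f x).IsInvertible := by
  have hfa : ContDiffAt ℝ ∞ f a := hf.contDiffAt (hU.mem_nhds ha)
  have hcont : ContinuousOn (fderiv ℝ f) U := (hf.continuousOn_fderiv_of_isOpen hU (by simp))
  -- Invertibility of the derivative is an open condition. Cutting the source down to it makes the
  -- inverse smooth at every point of the target, not only at f a.
  set W : Set E := U ∩ fderiv ℝ f ⁻¹' Set.range ((↑) : (E ≃L[ℝ] F) → E →L[ℝ] F) with hW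
  have hWo : IsOpen W := hcont.isOpen_inter_preimage hU (ContinuousLinearEquiv.isOpen)
  have haW : a ∈ W := ⟨ha, ⟨f', hf'.fderiv.symm⟩⟩
  set e0 := hfa.toOpenPartialHomeomorph f hf' (by simp) with he0
  have he0c : ⇑e0 = f := hfa.toOpenPartialHomeomorph_coe hf' (by simp)
  refine ⟨e0.restrOpen W hWo, he0c, ?_, ?_, ?_, ?_⟩
  · exact ⟨hfa.mem_toOpenPartialHomeomorph_source hf' (by simp), haW⟩
  · exact fun x hx => hx.2.1
  · intro y hy
    have hmem : (e0.restrOpen W hWo).symm y ∈ W :=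
      ((e0.restrOpen W hWo).map_target hy).2
    obtain ⟨g, hg⟩ := hmem.2
    refine ContDiffAt.contDiffWithinAt ?_
    refine OpenPartialHomeomorph.contDiffAt_symm (e0.restrOpen W hWo) (f₀' := g) hy ?_ ?_
    · rw [hg]
      exact ((hf.contDiffAt (hU.mem_nhds hmem.1)).differentiableAt (by simp)).hasFDerivAt
    · exact hf.contDiffAt (hU.mem_nhds hmem.1)
  · exact fun x hx => hx.2.2

section FixedPoint

variable {D C : Type*} [NormedAddCommGroup D] [NormedSpace ℝ D] [CompleteSpace D]
  [NormedAddCommGroup C] [NormedSpace ℝ C] [CompleteSpace C]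

/-- Smooth dependence on parameters of a fixed point at which the derivative vanishes. -/
theorem exists_contDiffOn_fixedPoint {R : D × C → C} (hR : ContDiff ℝ ∞ R) {d₀ : D} {c₀ : C}
    (h₀ : R (d₀, c₀) = c₀) (hR' : ∀ η : C, fderiv ℝ R (d₀, c₀) (0, η) = 0) :
    ∃ W : Set D, IsOpen W ∧ d₀ ∈ W ∧ ∃ g : D → C, ContDiffOn ℝ ∞ g W ∧ g d₀ = c₀ ∧
      ∀ d ∈ W, R (d, g d) = g d := by
  set T : D →L[ℝ] C := (fderiv ℝ R (d₀, c₀)).comp (ContinuousLinearMap.inl ℝ D C) with hT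
  have hTR : ∀ x : D × C, fderiv ℝ R (d₀, c₀) x = T x.1 := by
    intro x
    have : x = (x.1, 0) + (0, x.2) := by simp
    conv_lhs => rw [this, map_add, hR', add_zero]
    rfl
  -- Fixed points over d are the preimages of (d, 0) under Φ. At the base point DΦ is (δ, η) ↦ (δ, η
  -- - T δ), because R has no derivative in the fibre there; its inverse adds T δ back.
  set Φ : D × C → D × C := fun x => (x.1, x.2 - R x) with hΦ
  let S : (D × C) ≃L[ℝ] (D × C) := ContinuousLinearEquiv.equivOfInverse
    ((ContinuousLinearMap.fst ℝ D C).prod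
      (ContinuousLinearMap.snd ℝ D C - T.comp (ContinuousLinearMap.fst ℝ D C)))
    ((ContinuousLinearMap.fst ℝ D C).prod
      (ContinuousLinearMap.snd ℝ D C + T.comp (ContinuousLinearMap.fst ℝ D C)))
    (fun x => by simp) (fun x => by simp)
  have hΦs : ContDiff ℝ ∞ Φ := by fun_prop
  have hΦd : HasFDerivAt Φ (S : (D × C) →L[ℝ] (D × C)) (d₀, c₀) := by
    have h1 : HasFDerivAt R (fderiv ℝ R (d₀, c₀)) (d₀, c₀) :=
      (hR.differentiable (by simp) _).hasFDerivAt
    have h2 : HasFDerivAt Φ _ (d₀, c₀) := hasFDerivAt_fst.prodMk (hasFDerivAt_snd.sub h1)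
    refine h2.congr_fderiv ?_
    refine ContinuousLinearMap.ext fun x => Prod.ext ?_ ?_
    · simp [S]
    · simp [S, hTR]
  obtain ⟨e, he, hmem, -, hsymm, -⟩ :=
    exists_openPartialHomeomorph_of_contDiffOn isOpen_univ hΦs.contDiffOn (Set.mem_univ _) hΦd
  have hΦ0 : e (d₀, c₀) = (d₀, 0) := by rw [he]; simp [hΦ, h₀]
  refine ⟨(fun d => (d, (0 : C))) ⁻¹' e.target, e.open_target.preimage (by fun_prop), ?_,
    fun d => (e.symm (d, 0)).2, ?_, ?_, ?_⟩
  · change (d₀, (0 : C)) ∈ e.target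
    rw [← hΦ0]; exact e.map_source hmem
  · exact contDiff_snd.comp_contDiffOn (hsymm.comp (by fun_prop) (fun d hd => hd))
  · change (e.symm (d₀, 0)).2 = c₀
    rw [← hΦ0, e.left_inv hmem]
  · intro d hd
    have h1 : e (e.symm (d, 0)) = (d, 0) := e.right_inv hd
    rw [he] at h1
    have h2 : (e.symm (d, 0)).1 = d := congrArg Prod.fst h1
    have h3 : (e.symm (d, 0)).2 - R (e.symm (d, 0)) = 0 := congrArg Prod.snd h1
    have h4 : e.symm (d, 0) = (d, (e.symm (d, 0)).2) := Prod.ext h2 rfl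
    rw [← h4]
    exact (sub_eq_zero.1 h3).symm

end FixedPoint

lemma exists_bound_of_continuous {X Y : Type*} [NormedAddCommGroup X] [NormedSpace ℝ X]
    [NormedAddCommGroup Y] [NormedSpace ℝ Y] {L : ℝ → X →L[ℝ] Y} (hL : Continuous L) :
    ∃ B : ℝ, ∀ τ ∈ Set.Icc (0 : ℝ) 1, ∀ x, ‖L τ x‖ ≤ B * ‖x‖ := by
  obtain ⟨B, hB⟩ := isCompact_Icc.exists_bound_of_continuousOn (s := Set.Icc (0 : ℝ) 1)
    hL.continuousOn
  exact ⟨B, fun τ hτ x => ((L τ).le_opNorm x).trans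
    (mul_le_mul_of_nonneg_right (hB τ hτ) (norm_nonneg _))⟩

/-! ### The Frobenius theorem with parameters -/

section Frobenius

open unitInterval

universe u
variable {V P G : Type u} [NormedAddCommGroup V] [NormedSpace ℝ V]
  [NormedAddCommGroup P] [NormedSpace ℝ P]
  [NormedAddCommGroup G] [NormedSpace ℝ G]

/-- The primitive vanishing at `0` of a continuous function on the unit interval. -/
def primitiveCLM (G : Type*) [NormedAddCommGroup G] [NormedSpace ℝ G] :
    C(I, G) →L[ℝ] C(I, G) :=
  LinearMap.mkContinuous
    { toFun := fun γ => ⟨fun τ => ∫ s in (0 : ℝ)..τ, γ (Set.projIcc 0 1 zero_le_one s), by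
        have : Continuous fun s : ℝ => γ (Set.projIcc 0 1 zero_le_one s) :=
          γ.continuous.comp continuous_projIcc
        exact (intervalIntegral.continuous_primitive
          (fun a b => this.intervalIntegrable a b) 0).comp continuous_subtype_val⟩
      map_add' := fun γ η => by
        ext τ
        have h : ∀ γ : C(I, G), IntervalIntegrable
            (fun s : ℝ => γ (Set.projIcc 0 1 zero_le_one s)) MeasureTheory.volume 0 τ :=
          fun γ => (γ.continuous.comp continuous_projIcc).intervalIntegrable _ _
        simpa using intervalIntegral.integral_add (h γ) (h η)
      map_smul' := fun c γ => by
        ext τ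
        simp } 1 (fun γ => by
    rw [one_mul, ContinuousMap.norm_le _ (norm_nonneg _)]
    intro τ
    refine (intervalIntegral.norm_integral_le_of_norm_le_const
      (fun s _ => γ.norm_coe_le_norm (Set.projIcc 0 1 zero_le_one s))).trans ?_
    have h1 := τ.2.1
    have h2 := τ.2.2
    rw [sub_zero, abs_of_nonneg h1]
    exact mul_le_of_le_one_right (norm_nonneg _) h2)

lemma primitiveCLM_apply (γ : C(I, G)) (τ : I) :
    primitiveCLM G γ τ = ∫ s in (0 : ℝ)..τ, γ (Set.projIcc 0 1 zero_le_one s) := rfl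

/-- The curve `τ ↦ ((τ v, p, γ(τ)), v)`. -/
def radialCurve (V P G : Type*) [NormedAddCommGroup V] [NormedSpace ℝ V]
    [NormedAddCommGroup P] [NormedSpace ℝ P] [NormedAddCommGroup G] [NormedSpace ℝ G] :
    (V × P) × C(I, G) →L[ℝ] C(I, (V × P × G) × V) :=
  LinearMap.mkContinuous
    { toFun := fun x => ⟨fun τ => (((τ : ℝ) • x.1.1, x.1.2, x.2 τ), x.1.1), by fun_prop⟩
      map_add' := fun x y => by ext τ <;> simp
      map_smul' := fun c x => by ext τ <;> simp [smul_comm (τ : ℝ) c] } 1 (fun x => by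
    rw [one_mul, ContinuousMap.norm_le _ (norm_nonneg _)]
    intro τ
    have h1 : ‖x.1.1‖ ≤ ‖x‖ := (norm_fst_le x.1).trans (norm_fst_le x)
    have h2 : ‖x.1.2‖ ≤ ‖x‖ := (norm_snd_le x.1).trans (norm_fst_le x)
    have h3 : ‖x.2 τ‖ ≤ ‖x‖ := (x.2.norm_coe_le_norm τ).trans (norm_snd_le x)
    have h4 : ‖(τ : ℝ) • x.1.1‖ ≤ ‖x‖ := by
      rw [norm_smul, Real.norm_of_nonneg τ.2.1]
      exact (mul_le_of_le_one_left (norm_nonneg _) τ.2.2).trans h1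
    exact max_le (max_le h4 (max_le h2 h3)) h1)

@[simp]
lemma radialCurve_apply (x : (V × P) × C(I, G)) (τ : I) :
    radialCurve V P G x τ = (((τ : ℝ) • x.1.1, x.1.2, x.2 τ), x.1.1) := rfl

variable [CompleteSpace V] [CompleteSpace P] [CompleteSpace G]

/-- Along each ray the radial equation `γ' = A(τ v, p, γ) v` is solved, smoothly in the
parameters. -/
theorem exists_radial_solution {A : V × P × G → V →L[ℝ] G} (hA : ContDiff ℝ ∞ A)
    {s₀ : P → G} (hs₀ : ContDiff ℝ ∞ s₀) (p₀ : P) :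
    ∃ W : Set (V × P), IsOpen W ∧ (0, p₀) ∈ W ∧ ∃ γ : V × P → C(I, G), ContDiffOn ℝ ∞ γ W ∧
      γ (0, p₀) = ContinuousMap.const _ (s₀ p₀) ∧
      ∀ d ∈ W, γ d = ContinuousMap.const _ (s₀ d.2) + primitiveCLM G
        ((⟨fun x => A x.1 x.2, (hA.continuous.comp continuous_fst).clm_apply continuous_snd⟩ :
          C((V × P × G) × V, G)).comp (radialCurve V P G (d, γ d))) := by
  have hf : ContDiff ℝ ∞ (fun x : (V × P × G) × V => A x.1 x.2) :=
    (hA.comp contDiff_fst).clm_apply contDiff_snd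
  set N : (V × P) × C(I, G) → C(I, G) := fun x =>
    (⟨fun x => A x.1 x.2, (hA.continuous.comp continuous_fst).clm_apply continuous_snd⟩ :
      C((V × P × G) × V, G)).comp (radialCurve V P G x) with hN
  have hNs : ContDiff ℝ ∞ N := (contDiff_postcomp hf).comp (radialCurve V P G).contDiff
  -- At v = 0 the integrand vanishes whatever γ is, so the integral operator is constant in γ and
  -- its fibre derivative is zero. Smallness of v replaces smallness of time, and no contraction
  -- estimate is needed.
  have hN0 : ∀ (p : P) (η : C(I, G)), N ((0, p), η) = 0 := by
    intro p η; ext τ; simp [hN]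
  let κ : G →L[ℝ] C(I, G) := ContinuousLinearMap.const ℝ I
  have hκ : ∀ g, κ g = ContinuousMap.const _ g := fun g => rfl
  set R : (V × P) × C(I, G) → C(I, G) := fun x => κ (s₀ x.1.2) + primitiveCLM G (N x) with hRdef
  have hRs : ContDiff ℝ ∞ R := by
    refine ContDiff.add (κ.contDiff.comp (hs₀.comp ?_)) ((primitiveCLM G).contDiff.comp hNs)
    fun_prop
  have hR0 : R ((0, p₀), κ (s₀ p₀)) = κ (s₀ p₀) := by simp [hRdef, hN0]
  obtain ⟨W, hW, hmem, γ, hγ, hγ0, hfix⟩ := exists_contDiffOn_fixedPoint hRs hR0 (fun η => by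
    have h1 : HasFDerivAt R (fderiv ℝ R ((0, p₀), κ (s₀ p₀))) ((0, p₀), κ (s₀ p₀)) :=
      (hRs.differentiable (by simp) _).hasFDerivAt
    have h2 : HasFDerivAt (fun η : C(I, G) => (((0 : V), p₀), η))
        (ContinuousLinearMap.inr ℝ (V × P) C(I, G)) (κ (s₀ p₀)) := hasFDerivAt_prodMk_right _ _
    have h3 := HasFDerivAt.comp (κ (s₀ p₀)) h1 h2
    have h4 : R ∘ (fun η : C(I, G) => (((0 : V), p₀), η)) = fun _ => κ (s₀ p₀) := by
      ext1 η; simp [hRdef, hN0]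
    rw [h4] at h3
    have := DFunLike.congr_fun (h3.unique (hasFDerivAt_const _ _)) η
    simpa using this)
  exact ⟨W, hW, hmem, γ, hγ, hγ0, fun d hd => (hfix d hd).symm⟩

/-- **Frobenius theorem** for the total differential equation `D_v F = A(v, p, F)` with
parameter `p` and initial values `F(0, p) = s₀(p)`. -/
theorem exists_solution_of_integrable_of_contDiff {A : V × P × G → V →L[ℝ] G}
    (hA : ContDiff ℝ ∞ A) {s₀ : P → G} (hs₀ : ContDiff ℝ ∞ s₀) {p₀ : P}
    (hint : ∀ᶠ x in 𝓝 ((0 : V), p₀, s₀ p₀), ∀ v w,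
      fderiv ℝ A x (w, 0, A x w) v = fderiv ℝ A x (v, 0, A x v) w) :
    ∃ W : Set (V × P), IsOpen W ∧ (0, p₀) ∈ W ∧ ∃ F : V × P → G, ContDiffOn ℝ ∞ F W ∧
      (∀ p, ((0 : V), p) ∈ W → F (0, p) = s₀ p) ∧
      ∀ d ∈ W, ∀ w, fderiv ℝ F d (w, 0) = A (d.1, d.2, F d) w := by
  obtain ⟨W₀, hW₀, hmem, γ, hγ, hγ0, hfix⟩ := exists_radial_solution hA hs₀ p₀
  obtain ⟨O, hOint, hO, h0O⟩ := eventually_nhds_iff.1 hint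
  set f : C((V × P × G) × V, G) :=
    ⟨fun x => A x.1 x.2, (hA.continuous.comp continuous_fst).clm_apply continuous_snd⟩ with hfdef
  have hf : ContDiff ℝ ∞ (fun x : (V × P × G) × V => A x.1 x.2) :=
    (hA.comp contDiff_fst).clm_apply contDiff_snd
  -- the parameters whose whole radial curve stays in `O`
  set c : V × P → C(I, (V × P × G) × V) := fun d => radialCurve V P G (d, γ d) with hc
  have hcs : ContDiffOn ℝ ∞ c W₀ :=
    (radialCurve V P G).contDiff.comp_contDiffOn (contDiffOn_id.prodMk hγ)
  -- Staying in O along the whole curve is an open condition because the unit interval is compact.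
  set W : Set (V × P) := W₀ ∩ c ⁻¹' {g | Set.MapsTo g Set.univ (Prod.fst ⁻¹' O)} with hWdef
  have hWo : IsOpen W := hcs.continuousOn.isOpen_inter_preimage hW₀
    (ContinuousMap.isOpen_setOfPred_mapsTo isCompact_univ (hO.preimage continuous_fst))
  have hWc : ∀ d ∈ W, ∀ τ : I, ((τ : ℝ) • d.1, d.2, γ d τ) ∈ O :=
    fun d hd τ => hd.2 (Set.mem_univ τ)
  have hev : ∀ (τ : I) (g : C(I, G)), HasFDerivAt (fun g : C(I, G) => g τ)
      (ContinuousMap.evalCLM ℝ τ) g := fun τ g =>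
    ContinuousLinearMap.hasFDerivAt (E := C(I, G)) (F := G) (ContinuousMap.evalCLM ℝ τ)
  -- The candidate is the endpoint of the radial solution: F(v, p) = γ_{(v,p)}(1).
  refine ⟨W, hWo, ⟨hmem, ?_⟩, fun d => γ d 1, ?_, ?_, ?_⟩
  · intro τ _
    simpa [hc, hγ0] using h0O
  · exact (ContinuousMap.evalCLM ℝ (1 : I)).contDiff.comp_contDiffOn (hγ.mono Set.inter_subset_left)
  · intro p hp
    have h1 := hfix _ hp.1
    have h2 : f.comp (radialCurve V P G ((0, p), γ (0, p))) = 0 := by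
      ext τ; simp [hfdef]
    rw [h2, map_zero, add_zero] at h1
    simp only [h1]; rfl
  rintro ⟨v, p⟩ hd w
  set d : V × P := (v, p) with hddef
  have hγd : HasFDerivAt γ (fderiv ℝ γ d) d :=
    ((hγ.contDiffAt (hW₀.mem_nhds hd.1)).differentiableAt (by simp)).hasFDerivAt
  set γ' : C(I, G) := fderiv ℝ γ d (w, 0) with hγ'
  -- the derivative of the integrand
  have hcd : HasFDerivAt c ((radialCurve V P G).comp ((ContinuousLinearMap.id ℝ _).prod
      (fderiv ℝ γ d))) d :=
    (radialCurve V P G).hasFDerivAt.comp d ((hasFDerivAt_id d).prodMk hγd)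
  have hNs : ContDiff ℝ ∞ (fun g : C(I, (V × P × G) × V) => f.comp g) := contDiff_postcomp hf
  have hNd : HasFDerivAt (fun d => f.comp (c d)) _ d :=
    ((hNs.differentiable (by simp) (c d)).hasFDerivAt).comp d hcd
  set M : C(I, G) := fderiv ℝ (fun d => f.comp (c d)) d (w, 0) with hM
  have hMapply : ∀ τ : I, M τ = A ((τ : ℝ) • v, p, γ d τ) w +
      fderiv ℝ A ((τ : ℝ) • v, p, γ d τ) ((τ : ℝ) • w, 0, γ' τ) v := by
    intro τ
    have h1 : HasFDerivAt (fun d => f.comp (c d) τ)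
        ((ContinuousMap.evalCLM ℝ τ).comp (fderiv ℝ (fun d => f.comp (c d)) d)) d :=
      (hev τ _).comp d hNd.differentiableAt.hasFDerivAt
    have h2 : HasFDerivAt (fun d : V × P => ((τ : ℝ) • d.1, d.2, γ d τ))
        (((τ : ℝ) • ContinuousLinearMap.fst ℝ V P).prod ((ContinuousLinearMap.snd ℝ V P).prod
          ((ContinuousMap.evalCLM ℝ τ).comp (fderiv ℝ γ d)))) d :=
      (hasFDerivAt_fst.const_smul _).prodMk (hasFDerivAt_snd.prodMk
        ((hev τ _).comp d hγd))
    have h3 := ((hA.differentiable (by simp) ((τ : ℝ) • d.1, d.2, γ d τ)).hasFDerivAt).comp d h2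
    have h4 := h3.clm_apply (hasFDerivAt_fst (𝕜 := ℝ) (p := d))
    have h5 := DFunLike.congr_fun (h1.unique h4) (w, 0)
    simpa [hddef] using h5
  have hγ'M : γ' = primitiveCLM G M := by
    let κ : G →L[ℝ] C(I, G) := ContinuousLinearMap.const ℝ I
    have h1 : HasFDerivAt (fun d : V × P => κ (s₀ d.2) + primitiveCLM G (f.comp (c d)))
        (κ.comp ((fderiv ℝ s₀ d.2).comp (ContinuousLinearMap.snd ℝ V P)) +
          (primitiveCLM G).comp (fderiv ℝ (fun d => f.comp (c d)) d)) d :=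
      (κ.hasFDerivAt.comp d (((hs₀.differentiable (by simp) _).hasFDerivAt).comp d
        hasFDerivAt_snd)).add ((primitiveCLM G).hasFDerivAt.comp d
        hNd.differentiableAt.hasFDerivAt)
    have h2 : γ =ᶠ[𝓝 d] fun d : V × P => κ (s₀ d.2) + primitiveCLM G (f.comp (c d)) := by
      filter_upwards [hW₀.mem_nhds hd.1] with d' hd'
      exact hfix d' hd'
    have h3 := DFunLike.congr_fun (hγd.unique (h1.congr_of_eventuallyEq h2)) (w, 0)
    simpa using h3
  -- continuous extensions to the real line
  set pr : ℝ → I := Set.projIcc 0 1 zero_le_one with hpr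
  have hprc : Continuous pr := continuous_projIcc
  have hprI : ∀ τ : ℝ, ∀ hτ : τ ∈ Set.Icc (0 : ℝ) 1, pr τ = ⟨τ, hτ⟩ :=
    fun τ hτ => Set.projIcc_of_mem zero_le_one hτ
  set a : ℝ → G := fun τ => s₀ p + ∫ s in (0 : ℝ)..τ, f.comp (c d) (pr s) with ha
  set b : ℝ → G := fun τ => ∫ s in (0 : ℝ)..τ, M (pr s) with hb
  have haI : ∀ τ, ∀ hτ : τ ∈ Set.Icc (0 : ℝ) 1, γ d ⟨τ, hτ⟩ = a τ := by
    intro τ hτ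
    rw [hfix d hd.1]; rfl
  have hbI : ∀ τ, ∀ hτ : τ ∈ Set.Icc (0 : ℝ) 1, γ' ⟨τ, hτ⟩ = b τ := by
    intro τ hτ
    rw [hγ'M]; rfl
  have had : ∀ τ, HasDerivAt a (f.comp (c d) (pr τ)) τ := fun τ =>
    (intervalIntegral.integral_hasDerivAt_right
      (((f.comp (c d)).continuous.comp hprc).intervalIntegrable _ _)
      (((f.comp (c d)).continuous.comp hprc).stronglyMeasurableAtFilter _ _)
      ((f.comp (c d)).continuous.comp hprc).continuousAt).const_add _
  have hbd : ∀ τ, HasDerivAt b (M (pr τ)) τ := fun τ =>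
    intervalIntegral.integral_hasDerivAt_right
      ((M.continuous.comp hprc).intervalIntegrable _ _)
      ((M.continuous.comp hprc).stronglyMeasurableAtFilter _ _)
      (M.continuous.comp hprc).continuousAt
  set x : ℝ → V × P × G := fun τ => (τ • v, p, a τ) with hx
  have hxd : ∀ τ, HasDerivAt x (v, 0, f.comp (c d) (pr τ)) τ := fun τ => by
    have h1 : HasDerivAt (fun τ : ℝ => τ • v) v τ := by
      simpa using (hasDerivAt_id τ).smul_const v
    exact h1.prodMk ((hasDerivAt_const τ p).prodMk (had τ))
  -- J measures how far the variation b of the radial solution in the direction w is from the value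
  -- τ A(x) w that the full system predicts at the point τ v. Integrability cancels everything in J'
  -- except a term linear in J, so J(0) = 0 and Grönwall give J = 0; the case τ = 1 is the claim.
  set J : ℝ → G := fun τ => b τ - τ • A (x τ) w with hJ
  have hJd : ∀ τ, HasDerivAt J (M (pr τ) - (τ • fderiv ℝ A (x τ) (v, 0, f.comp (c d) (pr τ)) w
      + A (x τ) w)) τ := by
    intro τ
    have h1 : HasDerivAt (fun τ => A (x τ)) (fderiv ℝ A (x τ) (v, 0, f.comp (c d) (pr τ))) τ :=
      ((hA.differentiable (by simp) (x τ)).hasFDerivAt).comp_hasDerivAt τ (hxd τ)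
    have h2 := h1.clm_apply (hasDerivAt_const τ w)
    have h3 := (hasDerivAt_id τ).smul h2
    exact ((hbd τ).sub h3).congr_deriv (by simp)
  have hxc : Continuous x := continuous_iff_continuousAt.2 fun τ => (hxd τ).continuousAt
  have hA'c : Continuous (fderiv ℝ A) := hA.continuous_fderiv (by simp)
  obtain ⟨B, hB⟩ := exists_bound_of_continuous (hA'c.comp hxc)
  have hJ0 := eq_zero_of_abs_deriv_le_mul_abs_self_of_eq_zero_right (f := J) (a := 0) (b := 1)
    (K := B * ‖v‖)
    (continuous_iff_continuousAt.2 fun τ => (hJd τ).continuousAt).continuousOn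
    (fun τ _ => (hJd τ).hasDerivWithinAt) (by simp [hJ, hb]) (fun τ hτ => by
      have hτ' : τ ∈ Set.Icc (0 : ℝ) 1 := ⟨hτ.1, hτ.2.le⟩
      have hxO : x τ ∈ O := by
        have := hWc d hd ⟨τ, hτ'⟩
        rwa [haI] at this
      have hcomp : f.comp (c d) (pr τ) = A (x τ) v := by
        rw [hprI τ hτ']
        change A (τ • v, p, γ d ⟨τ, hτ'⟩) v = A (x τ) v
        rw [haI]
      have hMx : M (pr τ) = A (x τ) w + fderiv ℝ A (x τ) (τ • w, 0, b τ) v := by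
        rw [hprI τ hτ', hMapply, haI, hbI]
      have hi := hOint (x τ) hxO v w
      have hval : M (pr τ) - (τ • fderiv ℝ A (x τ) (v, 0, f.comp (c d) (pr τ)) w + A (x τ) w)
          = fderiv ℝ A (x τ) (0, 0, J τ) v := by
        have h1 : ((0 : V), (0 : P), J τ) = (τ • w, 0, b τ) - τ • (w, 0, A (x τ) w) := by
          simp [hJ]
        rw [hMx, hcomp, ← hi, h1, map_sub, map_smul, sub_apply,
          smul_apply]
        abel
      rw [hval]
      refine ((fderiv ℝ A (x τ) (0, 0, J τ)).le_opNorm v).trans ?_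
      have h2 : ‖fderiv ℝ A (x τ) (0, 0, J τ)‖ ≤ B * ‖J τ‖ := by
        refine (hB τ hτ' _).trans_eq ?_
        simp [Prod.norm_def]
      calc _ ≤ (B * ‖J τ‖) * ‖v‖ := mul_le_mul_of_nonneg_right h2 (norm_nonneg _)
        _ = _ := by ring)
  have h1mem : (1 : ℝ) ∈ Set.Icc (0 : ℝ) 1 := by simp
  have hfin := hJ0 1 h1mem
  have hFd : HasFDerivAt (fun d => γ d 1)
      ((ContinuousMap.evalCLM ℝ (1 : I)).comp (fderiv ℝ γ d)) d :=
    (hev 1 _).comp d hγd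
  rw [hFd.fderiv]
  have h5 : γ' 1 = b 1 := hbI 1 h1mem
  have h6 : γ d 1 = a 1 := haI 1 h1mem
  change γ' 1 = A (d.1, d.2, γ d 1) w
  rw [h5, h6]
  simpa [hJ, hx, sub_eq_zero, hddef] using hfin

end Frobenius

/-- A smooth function near a point extends to a global smooth function, up to shrinking the
neighbourhood. -/
lemma exists_contDiff_eventuallyEq {E F : Type*} [NormedAddCommGroup E] [NormedSpace ℝ E]
    [FiniteDimensional ℝ E] [NormedAddCommGroup F] [NormedSpace ℝ F] {f : E → F} {U : Set E}
    (hU : IsOpen U) (hf : ContDiffOn ℝ ∞ f U) {a : E} (ha : a ∈ U) :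
    ∃ g : E → F, ContDiff ℝ ∞ g ∧ g =ᶠ[𝓝 a] f := by
  obtain ⟨r, hr, hrU⟩ := Metric.isOpen_iff.1 hU a ha
  -- Such extensions are needed because the superposition operator acts on curves through the whole
  -- space and so requires globally smooth data.
  let χ : ContDiffBump a := ⟨r / 4, r / 2, by linarith, by linarith⟩
  have hts : tsupport χ ⊆ U := by
    rw [χ.tsupport_eq]
    exact (Metric.closedBall_subset_ball (by change r / 2 < r; linarith)).trans hrU
  refine ⟨fun x => χ x • f x, contDiff_iff_contDiffAt.2 fun x => ?_, ?_⟩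
  · by_cases hx : x ∈ U
    · exact χ.contDiff.contDiffAt.smul (hf.contDiffAt (hU.mem_nhds hx))
    · have h0 : (fun x => χ x • f x) =ᶠ[𝓝 x] fun _ => 0 := by
        have : (tsupport χ)ᶜ ∈ 𝓝 x :=
          (isClosed_tsupport _).isOpen_compl.mem_nhds fun h => hx (hts h)
        filter_upwards [this] with y hy
        rw [image_eq_zero_of_notMem_tsupport hy, zero_smul]
      exact contDiffAt_const.congr_of_eventuallyEq h0
  · filter_upwards [χ.eventuallyEq_one] with x hx
    rw [hx]; simp

section Frobenius

universe u
variable {V P G : Type u} [NormedAddCommGroup V] [NormedSpace ℝ V] [FiniteDimensional ℝ V]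
  [NormedAddCommGroup P] [NormedSpace ℝ P] [FiniteDimensional ℝ P]
  [NormedAddCommGroup G] [NormedSpace ℝ G] [FiniteDimensional ℝ G]

/-- **Frobenius theorem** for a total differential equation `D_v F = A(v, p, F)` with parameter
`p`, which is integrable on an open set. -/
theorem exists_solution_of_integrable {A : V × P × G → V →L[ℝ] G} {O : Set (V × P × G)}
    (hO : IsOpen O) (hA : ContDiffOn ℝ ∞ A O) {s₀ : P → G} {U : Set P} (hU : IsOpen U)
    (hs₀ : ContDiffOn ℝ ∞ s₀ U) {p₀ : P} (hp₀ : p₀ ∈ U) (h0O : (0, p₀, s₀ p₀) ∈ O)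
    (hint : ∀ x ∈ O, ∀ v w, fderiv ℝ A x (w, 0, A x w) v = fderiv ℝ A x (v, 0, A x v) w) :
    ∃ W : Set (V × P), IsOpen W ∧ (0, p₀) ∈ W ∧ ∃ F : V × P → G, ContDiffOn ℝ ∞ F W ∧
      (∀ p, ((0 : V), p) ∈ W → F (0, p) = s₀ p) ∧
      ∀ d ∈ W, (d.1, d.2, F d) ∈ O ∧ ∀ w, fderiv ℝ F d (w, 0) = A (d.1, d.2, F d) w := by
  have := FiniteDimensional.complete ℝ V
  have := FiniteDimensional.complete ℝ P
  have := FiniteDimensional.complete ℝ G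
  obtain ⟨A', hA', hAA'⟩ := exists_contDiff_eventuallyEq hO hA h0O
  obtain ⟨s', hs', hss'⟩ := exists_contDiff_eventuallyEq hU hs₀ hp₀
  have hs0 : s' p₀ = s₀ p₀ := hss'.self_of_nhds
  obtain ⟨O', hO'sub, hO', h0O'⟩ := eventually_nhds_iff.1 (hAA'.and (hO.mem_nhds h0O))
  obtain ⟨U', hU'sub, hU', h0U'⟩ := eventually_nhds_iff.1 hss'
  obtain ⟨W, hW, hmem, F, hF, hF0, hFd⟩ := exists_solution_of_integrable_of_contDiff
    (p₀ := p₀) hA' hs' (by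
      rw [hs0]
      filter_upwards [hO'.mem_nhds h0O'] with x hx v w
      have h1 : fderiv ℝ A' x = fderiv ℝ A x := Filter.EventuallyEq.fderiv_eq (by
        filter_upwards [hO'.mem_nhds hx] with y hy using (hO'sub y hy).1)
      rw [h1, (hO'sub x hx).1]
      exact hint x (hO'sub x hx).2 v w)
  have hcont : ContinuousOn (fun d : V × P => (d.1, d.2, F d)) W :=
    continuousOn_fst.prodMk (continuousOn_snd.prodMk hF.continuousOn)
  -- On this smaller domain the graph of F stays where the global extension agrees with A.
  have hW1 : IsOpen (W ∩ (fun d : V × P => (d.1, d.2, F d)) ⁻¹' O') :=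
    hcont.isOpen_inter_preimage hW hO'
  refine ⟨_, hW1.inter (hU'.preimage continuous_snd), ⟨⟨hmem, ?_⟩, h0U'⟩, F,
    hF.mono fun d hd => hd.1.1, ?_, ?_⟩
  · change ((0 : V), p₀, F (0, p₀)) ∈ O'
    rw [hF0 _ hmem, hs0]; exact h0O'
  · intro p hp
    rw [hF0 p hp.1.1]; exact hU'sub p hp.2
  · intro d hd
    have h1 := hO'sub _ hd.1.2
    exact ⟨h1.2, fun w => by rw [hFd d hd.1.1, h1.1]⟩

end Frobenius

/-! ### Flow boxes, potentials and a uniqueness principle -/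

/-- Straightening of a vector field at a point where it does not vanish. -/
theorem exists_straightening {V : Type} [NormedAddCommGroup V] [NormedSpace ℝ V]
    [FiniteDimensional ℝ V] {X : V → V} {U : Set V} (hU : IsOpen U) (hX : ContDiffOn ℝ ∞ X U)
    {a : V} (ha : a ∈ U) {e₀ : V} {ℓ : V →L[ℝ] ℝ} (hℓ : ℓ e₀ = 1) (L : V ≃L[ℝ] V)
    (hL : L e₀ = X a) :
    ∃ e : OpenPartialHomeomorph V V, a ∈ e.source ∧ e a = 0 ∧ e.source ⊆ U ∧
      ContDiffOn ℝ ∞ e e.source ∧ ContDiffOn ℝ ∞ e.symm e.target ∧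
      ∀ q ∈ e.source, fderiv ℝ e q (X q) = e₀ := by
  have := FiniteDimensional.complete ℝ V
  -- The flow of X is the Frobenius system with one-dimensional time, parametrised by the initial
  -- point. Integrability is automatic: both of its sides are the same vector multiplied by v w.
  let A : ℝ × V × V → ℝ →L[ℝ] V := fun x =>
    ContinuousLinearMap.smulRightL ℝ ℝ V (ContinuousLinearMap.id ℝ ℝ) (X x.2.2)
  have hAapply : ∀ x t, A x t = t • X x.2.2 := fun x t => by simp [A]
  have hO : IsOpen {x : ℝ × V × V | x.2.2 ∈ U} := hU.preimage (by fun_prop)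
  have hA : ContDiffOn ℝ ∞ A {x : ℝ × V × V | x.2.2 ∈ U} :=
    (ContinuousLinearMap.contDiff _).comp_contDiffOn
      (hX.comp (by fun_prop) (fun x hx => hx))
  obtain ⟨W, hW, hmem, F, hF, hF0, hFW⟩ := exists_solution_of_integrable (s₀ := fun p : V => p)
    (p₀ := a) hO hA isOpen_univ contDiffOn_id (Set.mem_univ _) ha (by
      have key : ∀ (x : ℝ × V × V) (v w : ℝ), fderiv ℝ A x (w, 0, A x w) v =
          (w * v) • fderiv ℝ A x (1, 0, A x 1) 1 := by
        intro x v w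
        have h1 : (w, (0 : V), A x w) = w • ((1 : ℝ), (0 : V), A x 1) := by simp [hAapply]
        have h2 : v = v • (1 : ℝ) := by simp
        rw [h1, map_smul, smul_apply, mul_smul]
        conv_lhs => rw [h2, map_smul]
      intro x _ v w
      rw [key x v w, key x w v, mul_comm])
  -- Λ is L on the kernel of ℓ and zero on e₀. The map F ∘ j flows for time ℓ x from the initial
  -- point a + Λ x; its derivative at 0 is L, because L e₀ = X a.
  set Λ : V →L[ℝ] V := (L : V →L[ℝ] V).comp (ContinuousLinearMap.id ℝ V - ℓ.smulRight e₀) with hΛ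
  have hΛe : Λ e₀ = 0 := by simp [hΛ, hℓ]
  set j : V → ℝ × V := fun x => (ℓ x, a + Λ x) with hj
  have hjs : ContDiff ℝ ∞ j := by fun_prop
  have hjd : ∀ x, HasFDerivAt j (ℓ.prod Λ) x := fun x =>
    ℓ.hasFDerivAt.prodMk (Λ.hasFDerivAt.const_add _)
  have hFd : ∀ d ∈ W, HasFDerivAt F (fderiv ℝ F d) d := fun d hd =>
    ((hF.contDiffAt (hW.mem_nhds hd)).differentiableAt (by simp)).hasFDerivAt
  have hj0 : j 0 = (0, a) := by simp [hj]
  have hW' : IsOpen (j ⁻¹' W) := hW.preimage hjs.continuous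
  have h0W' : (0 : V) ∈ j ⁻¹' W := by change j 0 ∈ W; rw [hj0]; exact hmem
  have hΦd : ∀ x ∈ j ⁻¹' W, HasFDerivAt (F ∘ j) ((fderiv ℝ F (j x)).comp (ℓ.prod Λ)) x :=
    fun x hx => (hFd _ hx).comp x (hjd x)
  have hsnd : ∀ p, fderiv ℝ F (0, a) (0, p) = p := by
    intro p
    have h1 : HasFDerivAt (fun p : V => ((0 : ℝ), p)) (ContinuousLinearMap.inr ℝ ℝ V) a :=
      hasFDerivAt_prodMk_right _ _
    have h2 := (hFd _ hmem).comp a h1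
    have h3 : (F ∘ fun p : V => ((0 : ℝ), p)) =ᶠ[𝓝 a] fun p => p := by
      have : (fun p : V => ((0 : ℝ), p)) ⁻¹' W ∈ 𝓝 a :=
        (hW.preimage (by fun_prop)).mem_nhds hmem
      filter_upwards [this] with p hp using hF0 p hp
    exact DFunLike.congr_fun (h2.unique ((hasFDerivAt_id a).congr_of_eventuallyEq h3)) p
  have hfst : ∀ d ∈ W, ∀ t : ℝ, fderiv ℝ F d (t, 0) = t • X (F d) := fun d hd t => by
    rw [(hFW d hd).2, hAapply]
  have hΦ0 : (fderiv ℝ F (j 0)).comp (ℓ.prod Λ) = (L : V →L[ℝ] V) := by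
    ext x
    have h1 : (ℓ x, Λ x) = (ℓ x, (0 : V)) + (0, Λ x) := by simp
    change fderiv ℝ F (j 0) (ℓ x, Λ x) = L x
    rw [hj0, h1, map_add, hsnd, hfst _ hmem, hF0 a hmem]
    simp [hΛ, hL]
  obtain ⟨e, he, h0e, hesub, hesymm, -⟩ := exists_openPartialHomeomorph_of_contDiffOn hW'
    (hF.comp hjs.contDiffOn fun x hx => hx) h0W' (f' := L) (by rw [← hΦ0]; exact hΦd 0 h0W')
  have he0 : e 0 = a := by rw [he]; change F (j 0) = a; rw [hj0]; exact hF0 a hmem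
  refine ⟨e.symm, ?_, ?_, ?_, hesymm, ?_, ?_⟩
  · rw [← he0]; exact e.map_source h0e
  · rw [← he0]; exact e.left_inv h0e
  · intro q hq
    have h1 := (hFW _ (hesub (e.map_target hq))).1
    have h2 : F (j (e.symm q)) = q := by
      have := e.right_inv hq
      rwa [he] at this
    rwa [← h2]
  · change ContDiffOn ℝ ∞ e e.source
    rw [he]
    exact (hF.comp hjs.contDiffOn fun x hx => hx).mono hesub
  · intro q hq
    have hx := e.map_target hq
    have h1 : HasFDerivAt e ((fderiv ℝ F (j (e.symm q))).comp (ℓ.prod Λ)) (e.symm q) := by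
      rw [he]; exact hΦd _ (hesub hx)
    have h2 : HasFDerivAt e.symm (fderiv ℝ e.symm q) (e (e.symm q)) := by
      rw [e.right_inv hq]
      exact ((hesymm.contDiffAt (e.open_target.mem_nhds hq)).differentiableAt
        (by simp)).hasFDerivAt
    have h3 := h2.comp _ h1
    have h4 : (e.symm ∘ e) =ᶠ[𝓝 (e.symm q)] id := by
      filter_upwards [e.open_source.mem_nhds hx] with y hy using e.left_inv hy
    have h5 := DFunLike.congr_fun
      (h3.unique ((hasFDerivAt_id _).congr_of_eventuallyEq h4)) e₀
    have h6 : F (j (e.symm q)) = q := by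
      have := e.right_inv hq
      rwa [he] at this
    -- Moving along e₀ changes only the flow time, since Λ e₀ = 0; the derivative is therefore X
    -- itself, at every point and not just at a.
    have h7 : fderiv ℝ F (j (e.symm q)) (ℓ e₀, Λ e₀) = X q := by
      rw [hΛe, hfst _ (hesub hx), hℓ, h6, one_smul]
    rw [← h7]
    exact h5

/-- A closed one-form on a ball has a smooth potential. -/
theorem exists_potential {V : Type*} [NormedAddCommGroup V] [NormedSpace ℝ V] {a : V} {r : ℝ}
    {α : V → V →L[ℝ] ℝ} (hα : ContDiffOn ℝ ∞ α (Metric.ball a r))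
    (hclosed : ∀ q ∈ Metric.ball a r, ∀ u v, fderiv ℝ α q u v = fderiv ℝ α q v u) :
    ∃ z : V → ℝ, z a = 0 ∧ ContDiffOn ℝ ∞ z (Metric.ball a r) ∧
      ∀ q ∈ Metric.ball a r, HasFDerivAt z (α q) q := by
  have ho : IsOpen (Metric.ball a r) := Metric.isOpen_ball
  have hd : ∀ q ∈ Metric.ball a r, HasFDerivWithinAt α (fderiv ℝ α q) (Metric.ball a r) q :=
    fun q hq => ((hα.contDiffAt (ho.mem_nhds hq)).differentiableAt
      (by simp)).hasFDerivAt.hasFDerivWithinAt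
  obtain ⟨z, hz⟩ := (convex_ball a r).exists_forall_hasFDerivWithinAt_of_hasFDerivWithinAt_symmetric
    hd (fun q hq u _ v _ => hclosed q hq u v)
  have hz' : ∀ q ∈ Metric.ball a r, HasFDerivAt z (α q) q := fun q hq =>
    (hz q hq).hasFDerivAt (ho.mem_nhds hq)
  refine ⟨fun q => z q - z a, by simp, ?_, fun q hq => (hz' q hq).sub_const _⟩
  refine ContDiffOn.sub ?_ contDiffOn_const
  refine (contDiffOn_infty_iff_fderiv_of_isOpen ho).2 ⟨fun q hq =>
    (hz' q hq).differentiableAt.differentiableWithinAt, hα.congr fun q hq => (hz' q hq).fderiv⟩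

/-- A function on a ball which satisfies a linear total differential inequality and vanishes at
the centre is zero. -/
lemma eq_zero_of_norm_fderiv_le {V Q : Type*} [NormedAddCommGroup V] [NormedSpace ℝ V]
    [NormedAddCommGroup Q] [NormedSpace ℝ Q] {r K : ℝ} {D : V → Q}
    (hD : ∀ x ∈ Metric.ball (0 : V) r, DifferentiableAt ℝ D x) (h0 : D 0 = 0)
    (hb : ∀ x ∈ Metric.ball (0 : V) r, ∀ v, ‖fderiv ℝ D x v‖ ≤ K * ‖v‖ * ‖D x‖) :
    ∀ x ∈ Metric.ball (0 : V) r, D x = 0 := by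
  intro x hx
  have hmem : ∀ τ ∈ Set.Icc (0 : ℝ) 1, τ • x ∈ Metric.ball (0 : V) r := by
    intro τ hτ
    rw [mem_ball_zero_iff] at hx ⊢
    rw [norm_smul, Real.norm_of_nonneg hτ.1]
    exact (mul_le_of_le_one_left (norm_nonneg _) hτ.2).trans_lt hx
  have hd : ∀ τ ∈ Set.Icc (0 : ℝ) 1, HasDerivAt (fun τ : ℝ => D (τ • x))
      (fderiv ℝ D (τ • x) x) τ := by
    intro τ hτ
    have h1 : HasDerivAt (fun τ : ℝ => τ • x) x τ := by
      simpa using (hasDerivAt_id τ).smul_const x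
    exact (hD _ (hmem τ hτ)).hasFDerivAt.comp_hasDerivAt τ h1
  have := eq_zero_of_abs_deriv_le_mul_abs_self_of_eq_zero_right (f := fun τ : ℝ => D (τ • x))
    (a := 0) (b := 1) (K := K * ‖x‖)
    (fun τ hτ => (hd τ hτ).continuousAt.continuousWithinAt)
    (fun τ hτ => (hd τ ⟨hτ.1, hτ.2.le⟩).hasDerivWithinAt) (by simpa using h0)
    (fun τ hτ => hb _ (hmem τ ⟨hτ.1, hτ.2.le⟩) x) 1 (by simp)
  simpa using this

lemma differentiableAt_clm_apply_comp {V A B : Type*} [NormedAddCommGroup V] [NormedSpace ℝ V]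
    [NormedAddCommGroup A] [NormedSpace ℝ A] [NormedAddCommGroup B] [NormedSpace ℝ B]
    (L : A →L[ℝ] B) {f : V → A} {x : V} (hf : DifferentiableAt ℝ f x) :
    DifferentiableAt ℝ (fun x => L (f x)) x :=
  L.differentiableAt.comp x hf

/-! ### Flat coordinates for a family of flat metrics -/

section FlatCoordinates

variable {Y : Type*} [NormedAddCommGroup Y] [NormedSpace ℝ Y]

/-- The difference of a bilinear form `H` and the pull-back of the bilinear form `S` by `p`. -/
def pullbackDefect (S H : Y →L[ℝ] Y →L[ℝ] ℝ) (p : Y →L[ℝ] Y) : Y →L[ℝ] Y →L[ℝ] ℝ :=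
  H - ((ContinuousLinearMap.compL ℝ Y Y ℝ).flip p).comp (S.comp p)

lemma pullbackDefect_apply (S H : Y →L[ℝ] Y →L[ℝ] ℝ) (p : Y →L[ℝ] Y) (a b : Y) :
    pullbackDefect S H p a b = H a b - S (p a) (p b) := rfl

/-- If `p' = p ∘ γ` and `γ` is metric with respect to `H`, the pull-back defect stays zero. -/
lemma pullbackDefect_eq_zero {V : Type*} [NormedAddCommGroup V] [NormedSpace ℝ V] {r K : ℝ}
    {S : Y →L[ℝ] Y →L[ℝ] ℝ} {H : V → Y →L[ℝ] Y →L[ℝ] ℝ} {p : V → Y →L[ℝ] Y} {γ : V → V →L[ℝ] Y →L[ℝ] Y}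
    (hH : ∀ x ∈ Metric.ball (0 : V) r, DifferentiableAt ℝ H x)
    (hp : ∀ x ∈ Metric.ball (0 : V) r, DifferentiableAt ℝ p x)
    (hK : ∀ x ∈ Metric.ball (0 : V) r, ‖γ x‖ ≤ K)
    (hpγ : ∀ x ∈ Metric.ball (0 : V) r, ∀ v, fderiv ℝ p x v = (p x).comp (γ x v))
    (hHγ : ∀ x ∈ Metric.ball (0 : V) r, ∀ v a b,
      fderiv ℝ H x v a b = H x (γ x v a) b + H x a (γ x v b))
    (h0 : pullbackDefect S (H 0) (p 0) = 0) :
    ∀ x ∈ Metric.ball (0 : V) r, pullbackDefect S (H x) (p x) = 0 := by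
  have hdiff : ∀ x ∈ Metric.ball (0 : V) r,
      DifferentiableAt ℝ (fun x => pullbackDefect S (H x) (p x)) x := by
    intro x hx
    have h1 := hH x hx
    have h2 := hp x hx
    have h3 := differentiableAt_clm_apply_comp (A := Y →L[ℝ] Y) (B := (Y →L[ℝ] ℝ) →L[ℝ] Y →L[ℝ] ℝ)
      (ContinuousLinearMap.compL ℝ Y Y ℝ).flip h2
    have h4 : DifferentiableAt ℝ (fun x => S.comp (p x)) x :=
      (differentiableAt_const S).clm_comp h2
    have h5 := h3.clm_comp h4
    exact DifferentiableAt.fun_sub (𝕜 := ℝ) (E := V) (F := Y →L[ℝ] Y →L[ℝ] ℝ) h1 h5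
  -- Differentiating H and the pull-back of S obeys the same rule in γ, so the derivative of their
  -- difference is linear in that difference and the uniqueness principle applies, with constant 2 K
  -- for the two slots.
  have happ : ∀ x ∈ Metric.ball (0 : V) r, ∀ v a b,
      fderiv ℝ (fun x => pullbackDefect S (H x) (p x)) x v a b =
        pullbackDefect S (H x) (p x) (γ x v a) b + pullbackDefect S (H x) (p x) a (γ x v b) := by
    intro x hx v a b
    have h1 := (((hdiff x hx).hasFDerivAt.clm_apply (hasFDerivAt_const a x)).clm_apply
      (hasFDerivAt_const b x))
    have h2 := ((hH x hx).hasFDerivAt.clm_apply (hasFDerivAt_const a x)).clm_apply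
      (hasFDerivAt_const b x)
    have h3 := (((hasFDerivAt_const S x).clm_apply
      ((hp x hx).hasFDerivAt.clm_apply (hasFDerivAt_const a x))).clm_apply
      ((hp x hx).hasFDerivAt.clm_apply (hasFDerivAt_const b x)))
    have h4 := DFunLike.congr_fun (h1.unique (h2.sub h3)) v
    simp [hpγ x hx, hHγ x hx] at h4
    rw [h4]
    simp only [pullbackDefect_apply]
    ring
  refine eq_zero_of_norm_fderiv_le (D := fun x => pullbackDefect S (H x) (p x)) (K := 2 * K)
    hdiff h0 fun x hx v => ?_
  have hγ : ∀ a, ‖γ x v a‖ ≤ K * ‖v‖ * ‖a‖ := fun a =>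
    ((γ x).le_opNorm₂ v a).trans (by gcongr; exact hK x hx)
  have hK0 : 0 ≤ K := le_trans (by positivity) (hK x hx)
  refine ContinuousLinearMap.opNorm_le_bound₂ _ (by positivity) fun a b => ?_
  rw [happ x hx]
  refine (norm_add_le _ _).trans ?_
  have h1 := (pullbackDefect S (H x) (p x)).le_opNorm₂ (γ x v a) b
  have h2 := (pullbackDefect S (H x) (p x)).le_opNorm₂ a (γ x v b)
  calc _ ≤ ‖pullbackDefect S (H x) (p x)‖ * (K * ‖v‖ * ‖a‖) * ‖b‖ +
        ‖pullbackDefect S (H x) (p x)‖ * ‖a‖ * (K * ‖v‖ * ‖b‖) := by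
        refine add_le_add (h1.trans ?_) (h2.trans ?_)
        · gcongr; exact hγ a
        · gcongr; exact hγ b
    _ = _ := by ring

end FlatCoordinates

section FlatCoordinates

variable {Y : Type} [NormedAddCommGroup Y] [NormedSpace ℝ Y] [FiniteDimensional ℝ Y]

/-- Parallel transport along the line `{0} × ℝ` of a metric connection is isometric. -/
lemma exists_parallel_frame {O : Set (Y × ℝ)} (hO : IsOpen O) (h0 : (0, 0) ∈ O)
    {H : Y × ℝ → Y →L[ℝ] Y →L[ℝ] ℝ} {γ : Y × ℝ → (Y × ℝ) →L[ℝ] Y →L[ℝ] Y}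
    (hH : ContDiffOn ℝ ∞ H O) (hγ : ContDiffOn ℝ ∞ γ O)
    (hcompat : ∀ q ∈ O, ∀ u b c,
      fderiv ℝ H q u b c = H q (γ q u b) c + H q b (γ q u c)) :
    ∃ r > 0, ∃ B : ℝ → Y →L[ℝ] Y, ContDiffOn ℝ ∞ B (Metric.ball 0 r) ∧
      B 0 = ContinuousLinearMap.id ℝ Y ∧ ∀ t ∈ Metric.ball (0 : ℝ) r,
        (0, t) ∈ O ∧ pullbackDefect (H (0, 0)) (H (0, t)) (B t) = 0 := by
  let j : ℝ → Y × ℝ := fun t => (0, t)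
  have hj : ∀ t, HasFDerivAt j (ContinuousLinearMap.inr ℝ Y ℝ) t := fun t =>
    hasFDerivAt_prodMk_right _ _
  have hjs : ContDiff ℝ ∞ j := by fun_prop
  let c : ℝ → Y →L[ℝ] Y := fun t => γ (0, t) (0, 1)
  have hc : ContDiffOn ℝ ∞ c (j ⁻¹' O) :=
    (hγ.comp hjs.contDiffOn fun t ht => ht).clm_apply contDiffOn_const
  -- The transport equation B' = B ∘ γ(0, t)(0, 1). The second factor ℝ is a dummy parameter, set to
  -- 0 below.
  let A : ℝ × ℝ × (Y →L[ℝ] Y) → ℝ →L[ℝ] (Y →L[ℝ] Y) := fun x =>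
    ContinuousLinearMap.smulRightL ℝ ℝ (Y →L[ℝ] Y) (ContinuousLinearMap.id ℝ ℝ)
      (x.2.2.comp (c x.1))
  have hAapply : ∀ x t, A x t = t • x.2.2.comp (c x.1) := fun x t => by simp [A]
  have hOA : IsOpen {x : ℝ × ℝ × (Y →L[ℝ] Y) | j x.1 ∈ O} :=
    hO.preimage (hjs.continuous.comp continuous_fst)
  have hA : ContDiffOn ℝ ∞ A {x : ℝ × ℝ × (Y →L[ℝ] Y) | j x.1 ∈ O} := by
    refine (ContinuousLinearMap.contDiff _).comp_contDiffOn (ContDiffOn.clm_comp ?_ ?_)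
    · fun_prop
    · exact hc.comp (by fun_prop) fun x hx => hx
  obtain ⟨W, hW, hmem, F, hF, hF0, hFW⟩ := exists_solution_of_integrable
    (s₀ := fun _ : ℝ => ContinuousLinearMap.id ℝ Y) (p₀ := 0) hOA hA isOpen_univ contDiffOn_const
    (Set.mem_univ _) h0 (by
      have key : ∀ (x : ℝ × ℝ × (Y →L[ℝ] Y)) (v w : ℝ), fderiv ℝ A x (w, 0, A x w) v =
          (w * v) • fderiv ℝ A x (1, 0, A x 1) 1 := by
        intro x v w
        have h1 : (w, (0 : ℝ), A x w) = w • ((1 : ℝ), (0 : ℝ), A x 1) := by simp [hAapply]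
        have h2 : v = v • (1 : ℝ) := by simp
        rw [h1, map_smul, smul_apply, mul_smul]
        conv_lhs => rw [h2, map_smul]
      intro x _ v w
      rw [key x v w, key x w v, mul_comm])
  have hk : ContDiff ℝ ∞ (fun t : ℝ => (t, (0 : ℝ))) := by fun_prop
  have hγc : ContinuousAt (fun t => ‖(γ (j t)).comp (ContinuousLinearMap.inr ℝ Y ℝ)‖) 0 := by
    have h1 : ContinuousAt (fun t => γ (j t)) 0 :=
      ContinuousAt.comp (f := j) (hγ.continuousOn.continuousAt (hO.mem_nhds h0))
        hjs.continuous.continuousAt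
    exact (h1.clm_comp continuousAt_const).norm
  obtain ⟨r, hr, hball⟩ := Metric.mem_nhds_iff.1 (Filter.inter_mem (Filter.inter_mem
    ((hW.preimage hk.continuous).mem_nhds hmem) ((hO.preimage hjs.continuous).mem_nhds h0))
    (hγc.eventually (gt_mem_nhds (lt_add_one _))))
  have hBd : ∀ t ∈ Metric.ball (0 : ℝ) r, HasFDerivAt (fun t => F (t, 0))
      ((fderiv ℝ F (t, 0)).comp (ContinuousLinearMap.inl ℝ ℝ ℝ)) t := fun t ht =>
    ((hF.contDiffAt (hW.mem_nhds (hball ht).1.1)).differentiableAt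
      (by simp)).hasFDerivAt.comp t (hasFDerivAt_prodMk_left _ _)
  have hHd : ∀ t ∈ Metric.ball (0 : ℝ) r, HasFDerivAt (fun t => H (0, t))
      ((fderiv ℝ H (0, t)).comp (ContinuousLinearMap.inr ℝ Y ℝ)) t := fun t ht =>
    ((hH.contDiffAt (hO.mem_nhds (hball ht).1.2)).differentiableAt
      (by simp)).hasFDerivAt.comp t (hj t)
  refine ⟨r, hr, fun t => F (t, 0), hF.comp hk.contDiffOn fun t ht => (hball ht).1.1,
    hF0 0 hmem, fun t ht => ⟨(hball ht).1.2, ?_⟩⟩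
  refine pullbackDefect_eq_zero (H := fun t => H (0, t)) (p := fun t => F (t, 0))
    (γ := fun t => (γ (0, t)).comp (ContinuousLinearMap.inr ℝ Y ℝ))
    (fun t ht => (hHd t ht).differentiableAt) (fun t ht => (hBd t ht).differentiableAt)
    (fun t ht => (hball ht).2.le) ?_ ?_ ?_ t ht
  · intro t ht v
    rw [(hBd t ht).fderiv]
    have h1 : (γ (0, t)) (0, v) = v • γ (0, t) (0, 1) := by
      rw [← map_smul]; simp
    simp only [ContinuousLinearMap.comp_apply, ContinuousLinearMap.inl_apply,
      ContinuousLinearMap.inr_apply]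
    rw [(hFW _ (hball ht).1.1).2, hAapply, h1, ContinuousLinearMap.comp_smul]
  · intro t ht v a b
    rw [(hHd t ht).fderiv]
    exact hcompat _ (hball ht).1.2 (0, v) a b
  · change pullbackDefect _ _ (F (0, 0)) = 0
    rw [hF0 0 hmem]
    ext a b
    simp [pullbackDefect_apply]

/-- If a family `H(·, z)` of metrics on `Y` is flat, there are coordinates `F(·, z)`, depending
smoothly on `z`, in which each of them becomes the constant metric `H(0, 0)`. Here `γ` is a metric
connection on the bundle `Y → Y × ℝ`, torsion free and flat in the directions of `Y`. -/
theorem exists_flat_coordinates {O : Set (Y × ℝ)} (hO : IsOpen O) (h0 : (0, 0) ∈ O)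
    {H : Y × ℝ → Y →L[ℝ] Y →L[ℝ] ℝ} {γ : Y × ℝ → (Y × ℝ) →L[ℝ] Y →L[ℝ] Y}
    (hH : ContDiffOn ℝ ∞ H O) (hγ : ContDiffOn ℝ ∞ γ O)
    (hsymm : ∀ q ∈ O, ∀ a b, γ q (a, 0) b = γ q (b, 0) a)
    (hflat : ∀ q ∈ O, ∀ a b c, fderiv ℝ γ q (a, 0) (b, 0) c + γ q (a, 0) (γ q (b, 0) c) =
      fderiv ℝ γ q (b, 0) (a, 0) c + γ q (b, 0) (γ q (a, 0) c))
    (hcompat : ∀ q ∈ O, ∀ u b c,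
      fderiv ℝ H q u b c = H q (γ q u b) c + H q b (γ q u c)) :
    ∃ W : Set (Y × ℝ), IsOpen W ∧ (0, 0) ∈ W ∧ W ⊆ O ∧ ∃ F : Y × ℝ → Y, ContDiffOn ℝ ∞ F W ∧
      F (0, 0) = 0 ∧ (∀ a, fderiv ℝ F (0, 0) (a, 0) = a) ∧
      ∀ q ∈ W, ∀ a b, H (0, 0) (fderiv ℝ F q (a, 0)) (fderiv ℝ F q (b, 0)) = H q a b := by
  obtain ⟨r₀, hr₀, B, hB, hB0, hBdefect⟩ := exists_parallel_frame hO h0 hH hγ hcompat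
  let Q := Y →L[ℝ] Y
  -- the system for the coordinates and their differential
  let k : Y × ℝ × (Y × Q) → Y × ℝ := fun x => (x.1, x.2.1)
  have hk : ContDiff ℝ ∞ k := by fun_prop
  have hkd : ∀ x, HasFDerivAt k ((ContinuousLinearMap.fst ℝ Y (ℝ × (Y × Q))).prod
      ((ContinuousLinearMap.fst ℝ ℝ (Y × Q)).comp
        (ContinuousLinearMap.snd ℝ Y (ℝ × (Y × Q))))) x := fun x =>
    hasFDerivAt_fst.prodMk (hasFDerivAt_fst.comp x hasFDerivAt_snd)
  let A₂ : Y × ℝ × (Y × Q) → Y →L[ℝ] Q := fun x =>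
    (ContinuousLinearMap.compL ℝ Y Y Y x.2.2.2).comp
      ((γ (k x)).comp (ContinuousLinearMap.inl ℝ Y ℝ))
  let A : Y × ℝ × (Y × Q) → Y →L[ℝ] (Y × Q) := fun x => (x.2.2.2 : Y →L[ℝ] Y).prod (A₂ x)
  have hAapply : ∀ x a, A x a = (x.2.2.2 a, (x.2.2.2).comp (γ (k x) (a, 0))) := fun x a => rfl
  have hOA : IsOpen (k ⁻¹' O) := hO.preimage hk.continuous
  have hγd : ∀ q ∈ O, HasFDerivAt γ (fderiv ℝ γ q) q := fun q hq =>
    ((hγ.contDiffAt (hO.mem_nhds hq)).differentiableAt (by simp)).hasFDerivAt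
  have hA₂ : ContDiffOn ℝ ∞ A₂ (k ⁻¹' O) := by
    refine ContDiffOn.clm_comp ?_ (ContDiffOn.clm_comp ?_ contDiffOn_const)
    · have h1 : ContDiff ℝ ∞ (fun x : Y × ℝ × (Y × (Y →L[ℝ] Y)) => x.2.2.2) := by fun_prop
      have h2 : ContDiff ℝ ∞ (ContinuousLinearMap.compL ℝ Y Y Y) :=
        ContinuousLinearMap.contDiff (𝕜 := ℝ) (E := Y →L[ℝ] Y)
          (F := (Y →L[ℝ] Y) →L[ℝ] (Y →L[ℝ] Y)) _
      exact (ContDiff.comp (𝕜 := ℝ) (F := Y →L[ℝ] Y) h2 h1).contDiffOn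
    · exact hγ.comp hk.contDiffOn fun x hx => hx
  have hA : ContDiffOn ℝ ∞ A (k ⁻¹' O) := by
    have h1 : ContDiffOn ℝ ∞ (fun x : Y × ℝ × (Y × Q) => x.2.2.2) (k ⁻¹' O) := by fun_prop
    have h2 : A = fun x => (ContinuousLinearMap.inl ℝ Y Q).comp x.2.2.2 +
        (ContinuousLinearMap.inr ℝ Y Q).comp (A₂ x) := by
      ext x a <;> simp [A]
    rw [h2]
    exact (contDiffOn_const.clm_comp h1).add (contDiffOn_const.clm_comp hA₂)
  have hAderiv : ∀ x ∈ k ⁻¹' O, ∀ (v : Y) (f : Y) (p : Q) (a : Y),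
      fderiv ℝ A x (v, 0, (f, p)) a = (p a, (x.2.2.2).comp (fderiv ℝ γ (k x) (v, 0) (a, 0)) +
        p.comp (γ (k x) (a, 0))) := by
    intro x hx v f p a
    have h1 := (((hA.contDiffAt (hOA.mem_nhds hx)).differentiableAt
      (by simp)).hasFDerivAt).clm_apply (hasFDerivAt_const a x)
    have h2 : HasFDerivAt (fun x : Y × ℝ × (Y × Q) => x.2.2.2)
        ((ContinuousLinearMap.snd ℝ Y Q).comp ((ContinuousLinearMap.snd ℝ ℝ (Y × Q)).comp
          (ContinuousLinearMap.snd ℝ Y (ℝ × (Y × Q))))) x :=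
      (hasFDerivAt_snd (𝕜 := ℝ) (p := x)).snd.snd
    have h3' : HasFDerivAt (fun x => γ (k x)) _ x :=
      HasFDerivAt.comp (g := γ) (f := k) x (hγd (k x) hx) (hkd x)
    have h3 := h3'.clm_apply (hasFDerivAt_const (a, (0 : ℝ)) x)
    have h4 := (h2.clm_apply (hasFDerivAt_const a x)).prodMk (h2.clm_comp h3)
    have h5 := DFunLike.congr_fun (h1.unique h4) (v, 0, (f, p))
    simpa using h5
  have hB0' : (0 : ℝ) ∈ Metric.ball (0 : ℝ) r₀ := Metric.mem_ball_self hr₀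
  -- The unknown is the pair (f, p) with df = p and dp = p ∘ γ in the Y-directions. The initial
  -- value (0, B z) makes p an isometry onto H(0, 0) at each point (0, z), smoothly in z.
  obtain ⟨W, hW, hmem, F, hF, hF0, hFW⟩ := exists_solution_of_integrable
    (s₀ := fun z : ℝ => ((0 : Y), B z)) (p₀ := 0) hOA hA Metric.isOpen_ball
    (contDiffOn_const.prodMk hB) hB0' h0 (by
      -- The first component of the integrability condition is vanishing torsion, the second is
      -- vanishing curvature in the Y-directions.
      intro x hx v w
      rw [hAapply, hAapply, hAderiv x hx, hAderiv x hx]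
      refine Prod.ext ?_ ?_
      · change (x.2.2.2) (γ (k x) (w, 0) v) = (x.2.2.2) (γ (k x) (v, 0) w)
        rw [hsymm _ hx]
      · refine ContinuousLinearMap.ext fun c => ?_
        change (x.2.2.2) (fderiv ℝ γ (k x) (w, 0) (v, 0) c) +
          (x.2.2.2) (γ (k x) (w, 0) (γ (k x) (v, 0) c)) =
          (x.2.2.2) (fderiv ℝ γ (k x) (v, 0) (w, 0) c) +
          (x.2.2.2) (γ (k x) (v, 0) (γ (k x) (w, 0) c))
        rw [← map_add, ← map_add, hflat _ hx])
  have hFd : ∀ d ∈ W, HasFDerivAt F (fderiv ℝ F d) d := fun d hd =>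
    ((hF.contDiffAt (hW.mem_nhds hd)).differentiableAt (by simp)).hasFDerivAt
  have hWO : ∀ d ∈ W, d ∈ O := fun d hd => (hFW d hd).1
  have hF1 : ∀ d ∈ W, ∀ a, fderiv ℝ (fun d => (F d).1) d (a, 0) = (F d).2 a := by
    intro d hd a
    have h1 := ((hFd d hd).fst).fderiv
    rw [h1, ContinuousLinearMap.comp_apply, (hFW d hd).2]
    rfl
  have hγc : ContinuousAt (fun q => ‖(γ q).comp (ContinuousLinearMap.inl ℝ Y ℝ)‖) (0, 0) :=
    ((hγ.continuousOn.continuousAt (hO.mem_nhds h0)).clm_comp continuousAt_const).norm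
  obtain ⟨r, hr, hball⟩ := Metric.mem_nhds_iff.1 (Filter.inter_mem (hW.mem_nhds hmem)
    (hγc.eventually (gt_mem_nhds (lt_add_one _))))
  have hmemball : ∀ {v : Y} {z : ℝ}, v ∈ Metric.ball (0 : Y) r → z ∈ Metric.ball (0 : ℝ) r →
      (v, z) ∈ Metric.ball ((0 : Y), (0 : ℝ)) r := by
    intro v z hv hz
    rw [← ball_prod_same]
    exact ⟨hv, hz⟩
  have h0ball : (0 : Y) ∈ Metric.ball (0 : Y) r := Metric.mem_ball_self hr
  refine ⟨Metric.ball 0 r ×ˢ Metric.ball 0 (min r r₀), Metric.isOpen_ball.prod Metric.isOpen_ball,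
    ⟨h0ball, Metric.mem_ball_self (lt_min hr hr₀)⟩, ?_, fun d => (F d).1, ?_, ?_, ?_, ?_⟩
  · rintro ⟨v, z⟩ ⟨hv, hz⟩
    exact hWO _ (hball (hmemball hv (Metric.ball_subset_ball (min_le_left _ _) hz))).1
  · exact contDiff_fst.comp_contDiffOn (hF.mono fun d hd =>
      (hball (hmemball hd.1 (Metric.ball_subset_ball (min_le_left _ _) hd.2))).1)
  · simp only [hF0 0 hmem]
  · intro a
    rw [hF1 _ hmem, hF0 0 hmem]
    simp only [hB0]
    rfl
  rintro ⟨y, z⟩ ⟨hy, hz⟩ a b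
  have hzr : z ∈ Metric.ball (0 : ℝ) r := Metric.ball_subset_ball (min_le_left _ _) hz
  have hzr₀ : z ∈ Metric.ball (0 : ℝ) r₀ := Metric.ball_subset_ball (min_le_right _ _) hz
  have hyz : ∀ v ∈ Metric.ball (0 : Y) r, (v, z) ∈ W := fun v hv => (hball (hmemball hv hzr)).1
  have hj : ∀ v : Y, HasFDerivAt (fun v : Y => (v, z)) (ContinuousLinearMap.inl ℝ Y ℝ) v :=
    fun v => hasFDerivAt_prodMk_left _ _
  have hpd : ∀ v ∈ Metric.ball (0 : Y) r, HasFDerivAt (fun v => (F (v, z)).2)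
      ((ContinuousLinearMap.snd ℝ Y Q).comp
        ((fderiv ℝ F (v, z)).comp (ContinuousLinearMap.inl ℝ Y ℝ))) v := fun v hv =>
    ((hFd _ (hyz v hv)).comp v (hj v)).snd
  have hHd : ∀ v ∈ Metric.ball (0 : Y) r, HasFDerivAt (fun v => H (v, z))
      ((fderiv ℝ H (v, z)).comp (ContinuousLinearMap.inl ℝ Y ℝ)) v := fun v hv =>
    HasFDerivAt.comp (g := H) v ((hH.contDiffAt (hO.mem_nhds (hWO _ (hyz v hv)))).differentiableAt
      (by simp)).hasFDerivAt (hj v)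
  -- For fixed z, the isometry property spreads from y = 0 over the leaf, since the connection is
  -- metric.
  have key := pullbackDefect_eq_zero (S := H (0, 0)) (H := fun v => H (v, z))
    (p := fun v => (F (v, z)).2) (γ := fun v => (γ (v, z)).comp (ContinuousLinearMap.inl ℝ Y ℝ))
    (fun v hv => (hHd v hv).differentiableAt) (fun v hv => (hpd v hv).differentiableAt)
    (fun v hv => (hball (hmemball hv hzr)).2.le) (fun v hv a => by
      rw [(hpd v hv).fderiv]
      change (fderiv ℝ F (v, z) (a, 0)).2 = _
      rw [(hFW _ (hyz v hv)).2]
      rfl) (fun v hv u b c => by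
      rw [(hHd v hv).fderiv]
      exact hcompat _ (hWO _ (hyz v hv)) (u, 0) b c) (by
      rw [hF0 z (hyz 0 h0ball)]
      exact (hBdefect z hzr₀).2) y hy
  have h1 := DFunLike.congr_fun (DFunLike.congr_fun key a) b
  rw [pullbackDefect_apply] at h1
  rw [hF1 _ (hyz y hy), hF1 _ (hyz y hy)]
  exact (sub_eq_zero.1 h1).symm

end FlatCoordinates

/-! ### The Levi-Civita connection of a metric in coordinates -/

/-- `g` is a smooth, symmetric and non-degenerate metric on the open set `O`. -/
structure IsMetricOn {m : ℕ} (g : Euc m → Euc m →L[ℝ] Euc m →L[ℝ] ℝ) (O : Set (Euc m)) :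
    Prop where
  isOpen : IsOpen O
  contDiffOn : ContDiffOn ℝ ∞ g O
  symm : ∀ q ∈ O, ∀ u v, g q u v = g q v u
  nondegenerate : ∀ q ∈ O, ∀ u, (∀ v, g q u v = 0) → u = 0

section LocalGeometry

variable {m : ℕ} {g : Euc m → Euc m →L[ℝ] Euc m →L[ℝ] ℝ} {O : Set (Euc m)} {q : Euc m}

namespace IsMetricOn

/-- Nondegeneracy is injectivity into a dual space of the same dimension. It guarantees that
`ContinuousLinearMap.inverse` in the definitions of `christoffel` and `ricciEnd` is a true inverse
and not its default value 0. -/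
lemma isInvertible (hg : IsMetricOn g O) (hq : q ∈ O) : (g q).IsInvertible := by
  have hinj : Function.Injective (g q).toLinearMap := by
    rw [← LinearMap.ker_eq_bot, LinearMap.ker_eq_bot']
    intro u hu
    exact hg.nondegenerate q hq u fun v => DFunLike.congr_fun (show g q u = 0 from hu) v
  have hdim : Module.finrank ℝ (Euc m) = Module.finrank ℝ (Euc m →L[ℝ] ℝ) := by
    rw [← (LinearMap.toContinuousLinearMap (𝕜 := ℝ) (E := Euc m) (F' := ℝ)).finrank_eq]
    exact (Subspace.dual_finrank_eq (K := ℝ) (V := Euc m)).symm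
  refine ⟨(LinearEquiv.ofInjectiveOfFinrankEq (g q).toLinearMap hinj hdim).toContinuousLinearEquiv,
    ?_⟩
  ext u v
  rfl

lemma eq_of_forall (hg : IsMetricOn g O) (hq : q ∈ O) {u v : Euc m}
    (h : ∀ w, g q u w = g q v w) : u = v :=
  sub_eq_zero.1 (hg.nondegenerate q hq _ fun w => by rw [map_sub, sub_apply, h, sub_self])

lemma apply_inverse (hg : IsMetricOn g O) (hq : q ∈ O) (α : Euc m →L[ℝ] ℝ) :
    g q ((g q).inverse α) = α :=
  (hg.isInvertible hq).self_apply_inverse α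

lemma hasFDerivAt (hg : IsMetricOn g O) (hq : q ∈ O) : HasFDerivAt g (fderiv ℝ g q) q :=
  ((hg.contDiffOn.contDiffAt (hg.isOpen.mem_nhds hq)).differentiableAt (by simp)).hasFDerivAt

lemma fderiv_symm (hg : IsMetricOn g O) (hq : q ∈ O) (w u v : Euc m) :
    fderiv ℝ g q w u v = fderiv ℝ g q w v u := by
  have h1 := ((hg.hasFDerivAt hq).clm_apply (hasFDerivAt_const u q)).clm_apply
    (hasFDerivAt_const v q)
  have h2 := ((hg.hasFDerivAt hq).clm_apply (hasFDerivAt_const v q)).clm_apply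
    (hasFDerivAt_const u q)
  have h3 : (fun q => g q u v) =ᶠ[𝓝 q] fun q => g q v u := by
    filter_upwards [hg.isOpen.mem_nhds hq] with x hx using hg.symm x hx u v
  have := DFunLike.congr_fun (h1.unique (h2.congr_of_eventuallyEq h3)) w
  simpa using this

/-- The Koszul formula. -/
lemma koszul (hg : IsMetricOn g O) (hq : q ∈ O) (u v w : Euc m) :
    g q (christoffel g q u v) w = (1 / 2 : ℝ) *
      (fderiv ℝ g q u v w + fderiv ℝ g q v u w - fderiv ℝ g q w u v) := by
  rw [christoffel, hg.apply_inverse hq]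
  simp

lemma christoffel_symm (hg : IsMetricOn g O) (hq : q ∈ O) (u v : Euc m) :
    christoffel g q u v = christoffel g q v u := by
  refine hg.eq_of_forall hq fun w => ?_
  rw [hg.koszul hq, hg.koszul hq, hg.fderiv_symm hq w u v]
  ring

/-- Metric compatibility ∇g = 0: adding two Koszul formulas leaves only the derivative in the
direction u. -/
lemma fderiv_eq (hg : IsMetricOn g O) (hq : q ∈ O) (u v w : Euc m) :
    fderiv ℝ g q u v w = g q (christoffel g q u v) w + g q v (christoffel g q u w) := by
  rw [hg.symm q hq v, hg.koszul hq, hg.koszul hq, hg.fderiv_symm hq u w v,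
    hg.fderiv_symm hq v u w]
  ring

lemma contDiffOn_fderiv_apply (hg : IsMetricOn g O) (u v w : Euc m) :
    ContDiffOn ℝ ∞ (fun q => fderiv ℝ g q u v w) O := by
  have h1 : ContDiffOn ℝ ∞ (fun q => g q v w) O :=
    (hg.contDiffOn.clm_apply contDiffOn_const).clm_apply contDiffOn_const
  refine ((h1.fderiv_of_isOpen hg.isOpen (m := ∞) (by simp)).clm_apply
    (contDiffOn_const (c := u))).congr fun q hq => ?_
  have h2 := ((hg.hasFDerivAt hq).clm_apply (hasFDerivAt_const v q)).clm_apply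
    (hasFDerivAt_const w q)
  rw [h2.fderiv]
  simp

end IsMetricOn

/-- The Christoffel map as a bilinear map. -/
def christoffelCLM (g : Euc m → Euc m →L[ℝ] Euc m →L[ℝ] ℝ) (q : Euc m) :
    Euc m →L[ℝ] Euc m →L[ℝ] Euc m :=
  LinearMap.toContinuousBilinearMap (LinearMap.mk₂ ℝ (fun u v => christoffel g q u v)
    (fun u v w => by
      rw [christoffel, christoffel, christoffel, ← map_add, ← smul_add]
      congr 2; ext x; simp; ring)
    (fun c u w => by
      rw [christoffel, christoffel, ← map_smul, smul_comm c]
      congr 2; ext x; simp; ring)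
    (fun u v w => by
      rw [christoffel, christoffel, christoffel, ← map_add, ← smul_add]
      congr 2; ext x; simp; ring)
    (fun c u w => by
      rw [christoffel, christoffel, ← map_smul, smul_comm c]
      congr 2; ext x; simp; ring))

@[simp]
lemma christoffelCLM_apply (u v : Euc m) : christoffelCLM g q u v = christoffel g q u v := rfl

lemma IsMetricOn.contDiffOn_christoffelCLM (hg : IsMetricOn g O) :
    ContDiffOn ℝ ∞ (christoffelCLM g) O := by
  have hd := hg.contDiffOn_fderiv_apply
  have hinv : ContDiffOn ℝ ∞ (fun q => (g q).inverse) O := fun q hq =>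
    ((hg.isInvertible hq).contDiffAt_map_inverse.comp q
      (hg.contDiffOn.contDiffAt (hg.isOpen.mem_nhds hq))).contDiffWithinAt
  refine contDiffOn_clm_apply.2 fun u => contDiffOn_clm_apply.2 fun v => ?_
  simp only [christoffelCLM_apply, christoffel]
  refine hinv.clm_apply ?_
  refine contDiffOn_clm_apply.2 fun w => ?_
  refine (contDiffOn_const (c := (1 / 2 : ℝ))).smul
    (((hd u v w).add (hd v u w)).sub (hd w u v))

lemma IsMetricOn.hasFDerivAt_christoffelCLM (hg : IsMetricOn g O) (hq : q ∈ O) :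
    HasFDerivAt (christoffelCLM g) (fderiv ℝ (christoffelCLM g) q) q :=
  ((hg.contDiffOn_christoffelCLM.contDiffAt (hg.isOpen.mem_nhds hq)).differentiableAt
    (by simp)).hasFDerivAt

/-- This is the expression ∂Γ + ΓΓ, antisymmetrised. Differentiating the bundled map
`christoffelCLM` instead of the function with v, w inserted makes linearity in every argument
available. -/
lemma IsMetricOn.curvature_eq (hg : IsMetricOn g O) (hq : q ∈ O) (u v w : Euc m) :
    curvature g q u v w =
      (fderiv ℝ (christoffelCLM g) q u v w + christoffel g q u (christoffel g q v w)) -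
      (fderiv ℝ (christoffelCLM g) q v u w + christoffel g q v (christoffel g q u w)) := by
  have h : ∀ a b c : Euc m, covDeriv g (fun q' => christoffel g q' b c) q a =
      fderiv ℝ (christoffelCLM g) q a b c + christoffel g q a (christoffel g q b c) := by
    intro a b c
    have h1 := ((hg.hasFDerivAt_christoffelCLM hq).clm_apply (hasFDerivAt_const b q)).clm_apply
      (hasFDerivAt_const c q)
    have h2 : fderiv ℝ (fun q' => christoffel g q' b c) q a =
        fderiv ℝ (christoffelCLM g) q a b c := by
      have h3 := DFunLike.congr_fun h1.fderiv a
      simpa using h3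
    rw [covDeriv, h2]
  rw [curvature, h, h]

end LocalGeometry

lemma two_le_infty : minSmoothness ℝ 2 ≤ (∞ : WithTop ℕ∞) := by
  rw [minSmoothness_of_isRCLikeNormedField]
  exact WithTop.coe_le_coe.2 (le_top (a := (2 : ℕ∞)))

/-! ### Naturality of connection and curvature under local isometries -/

section Naturality

variable {m : ℕ} {g g' : Euc m → Euc m →L[ℝ] Euc m →L[ℝ] ℝ} {O O' : Set (Euc m)} {q : Euc m}
  {φ : Euc m → Euc m}

/-- `φ` is a local isometry from `(O', g')` to `(O, g)`. -/
structure IsLocalIsometry (g' : Euc m → Euc m →L[ℝ] Euc m →L[ℝ] ℝ) (O' : Set (Euc m))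
    (g : Euc m → Euc m →L[ℝ] Euc m →L[ℝ] ℝ) (O : Set (Euc m)) (φ : Euc m → Euc m) : Prop where
  source : IsMetricOn g' O'
  target : IsMetricOn g O
  contDiffOn : ContDiffOn ℝ ∞ φ O'
  mapsTo : Set.MapsTo φ O' O
  isInvertible : ∀ q ∈ O', (fderiv ℝ φ q).IsInvertible
  apply_eq : ∀ q ∈ O', ∀ u v, g' q u v = g (φ q) (fderiv ℝ φ q u) (fderiv ℝ φ q v)

namespace IsLocalIsometry

variable (h : IsLocalIsometry g' O' g O φ) (hq : q ∈ O')
include h hq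

lemma contDiffAt : ContDiffAt ℝ ∞ φ q := h.contDiffOn.contDiffAt (h.source.isOpen.mem_nhds hq)

lemma hasFDerivAt : HasFDerivAt φ (fderiv ℝ φ q) q :=
  ((h.contDiffAt hq).differentiableAt (by simp)).hasFDerivAt

lemma hasFDerivAt_fderiv : HasFDerivAt (fderiv ℝ φ) (fderiv ℝ (fderiv ℝ φ) q) q :=
  (((h.contDiffAt hq).fderiv_right (m := ∞) (by simp)).differentiableAt (by simp)).hasFDerivAt

lemma hasFDerivAt_fderiv_fderiv :
    HasFDerivAt (fderiv ℝ (fderiv ℝ φ)) (fderiv ℝ (fderiv ℝ (fderiv ℝ φ)) q) q := by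
  have h1 : ContDiffAt ℝ ∞ (fderiv ℝ φ) q := (h.contDiffAt hq).fderiv_right (by simp)
  exact ((h1.fderiv_right (m := ∞) (by simp)).differentiableAt (by simp)).hasFDerivAt

lemma snd_symm (u v : Euc m) :
    fderiv ℝ (fderiv ℝ φ) q u v = fderiv ℝ (fderiv ℝ φ) q v u :=
  (h.contDiffAt hq).isSymmSndFDerivAt two_le_infty u v

/-- Symmetry of the second derivative of Dφ; it removes the third-order terms when the curvature is
antisymmetrised. -/
lemma thd_symm (a b c : Euc m) : fderiv ℝ (fderiv ℝ (fderiv ℝ φ)) q a b c =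
    fderiv ℝ (fderiv ℝ (fderiv ℝ φ)) q b a c := by
  have h1 : ContDiffAt ℝ ∞ (fderiv ℝ φ) q := (h.contDiffAt hq).fderiv_right (by simp)
  exact DFunLike.congr_fun (h1.isSymmSndFDerivAt two_le_infty a b) c

/-- The product rule for g' = φ^*g. Three instances, inserted in the Koszul formula, give the
transformation law of Γ. -/
lemma fderiv_metric (u v w : Euc m) : fderiv ℝ g' q u v w =
    fderiv ℝ g (φ q) (fderiv ℝ φ q u) (fderiv ℝ φ q v) (fderiv ℝ φ q w) +
      g (φ q) (fderiv ℝ (fderiv ℝ φ) q u v) (fderiv ℝ φ q w) +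
      g (φ q) (fderiv ℝ φ q v) (fderiv ℝ (fderiv ℝ φ) q u w) := by
  have h1 := ((h.source.hasFDerivAt hq).clm_apply (hasFDerivAt_const v q)).clm_apply
    (hasFDerivAt_const w q)
  have h2 : HasFDerivAt (fun x => g (φ x)) _ q :=
    HasFDerivAt.comp (g := g) q (h.target.hasFDerivAt (h.mapsTo hq)) (h.hasFDerivAt hq)
  have hd := h.hasFDerivAt_fderiv hq
  have h3 := (h2.clm_apply (hd.clm_apply (hasFDerivAt_const v q))).clm_apply
    (hd.clm_apply (hasFDerivAt_const w q))
  have h4 : (fun x => g' x v w) =ᶠ[𝓝 q]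
      fun x => g (φ x) (fderiv ℝ φ x v) (fderiv ℝ φ x w) := by
    filter_upwards [h.source.isOpen.mem_nhds hq] with x hx using h.apply_eq x hx v w
  have h5 := DFunLike.congr_fun (h1.unique (h3.congr_of_eventuallyEq h4)) u
  simp at h5
  rw [h5]
  ring

/-- The transformation law of the Christoffel map. -/
lemma fderiv_christoffel (u v : Euc m) : fderiv ℝ φ q (christoffel g' q u v) =
    christoffel g (φ q) (fderiv ℝ φ q u) (fderiv ℝ φ q v) + fderiv ℝ (fderiv ℝ φ) q u v := by
  refine h.target.eq_of_forall (h.mapsTo hq) fun w => ?_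
  obtain ⟨w, rfl⟩ : ∃ w', fderiv ℝ φ q w' = w :=
    ⟨(fderiv ℝ φ q).inverse w, (h.isInvertible q hq).self_apply_inverse w⟩
  rw [← h.apply_eq q hq, h.source.koszul hq, map_add, add_apply,
    h.target.koszul (h.mapsTo hq), h.fderiv_metric hq, h.fderiv_metric hq, h.fderiv_metric hq,
    h.snd_symm hq v u, h.snd_symm hq w u, h.snd_symm hq w v,
    h.target.symm _ (h.mapsTo hq) (fderiv ℝ φ q u) (fderiv ℝ (fderiv ℝ φ) q v w),
    h.target.symm _ (h.mapsTo hq) (fderiv ℝ φ q v) (fderiv ℝ (fderiv ℝ φ) q u w)]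
  ring

/-- The curvature tensor is natural. -/
lemma fderiv_curvature (a b c : Euc m) : fderiv ℝ φ q (curvature g' q a b c) =
    curvature g (φ q) (fderiv ℝ φ q a) (fderiv ℝ φ q b) (fderiv ℝ φ q c) := by
  -- This is the derivative of the transformation law of Γ. The last four terms on the right are
  -- together symmetric in a and b, so they cancel in the curvature.
  have key : ∀ a b c : Euc m,
      fderiv ℝ φ q (fderiv ℝ (christoffelCLM g') q a b c +
        christoffel g' q a (christoffel g' q b c)) =
      fderiv ℝ (christoffelCLM g) (φ q) (fderiv ℝ φ q a) (fderiv ℝ φ q b) (fderiv ℝ φ q c) +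
        christoffel g (φ q) (fderiv ℝ φ q a)
          (christoffel g (φ q) (fderiv ℝ φ q b) (fderiv ℝ φ q c)) +
        (christoffelCLM g (φ q) (fderiv ℝ (fderiv ℝ φ) q a b) (fderiv ℝ φ q c) +
        christoffelCLM g (φ q) (fderiv ℝ φ q b) (fderiv ℝ (fderiv ℝ φ) q a c) +
        christoffelCLM g (φ q) (fderiv ℝ φ q a) (fderiv ℝ (fderiv ℝ φ) q b c) +
        fderiv ℝ (fderiv ℝ (fderiv ℝ φ)) q a b c) := by
    intro a b c
    have hd := h.hasFDerivAt_fderiv hq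
    have hb := hd.clm_apply (hasFDerivAt_const b q)
    have hc := hd.clm_apply (hasFDerivAt_const c q)
    have h1 := hd.clm_apply (((h.source.hasFDerivAt_christoffelCLM hq).clm_apply
      (hasFDerivAt_const b q)).clm_apply (hasFDerivAt_const c q))
    have h2 : HasFDerivAt (fun x => christoffelCLM g (φ x)) _ q :=
      HasFDerivAt.comp (g := christoffelCLM g) q
        (h.target.hasFDerivAt_christoffelCLM (h.mapsTo hq)) (h.hasFDerivAt hq)
    have h3 := ((h2.clm_apply hb).clm_apply hc).add
      (((h.hasFDerivAt_fderiv_fderiv hq).clm_apply (hasFDerivAt_const b q)).clm_apply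
        (hasFDerivAt_const c q))
    have h4 : (fun x => fderiv ℝ φ x (christoffelCLM g' x b c)) =ᶠ[𝓝 q]
        (fun x => christoffelCLM g (φ x) (fderiv ℝ φ x b) (fderiv ℝ φ x c)) +
          fun x => fderiv ℝ (fderiv ℝ φ) x b c := by
      filter_upwards [h.source.isOpen.mem_nhds hq] with x hx using h.fderiv_christoffel hx b c
    have h5 := DFunLike.congr_fun (h1.unique (h3.congr_of_eventuallyEq h4)) a
    simp at h5
    rw [map_add, h.fderiv_christoffel hq, h.fderiv_christoffel hq, ← christoffelCLM_apply
      (fderiv ℝ φ q a) (_ + _), map_add, christoffelCLM_apply, christoffelCLM_apply]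
    simp only [christoffelCLM_apply]
    rw [← sub_eq_zero] at h5 ⊢
    rw [← h5]
    abel
  rw [h.source.curvature_eq hq, h.target.curvature_eq (h.mapsTo hq), map_sub, key, key,
    h.snd_symm hq b a, h.thd_symm hq b a]
  abel

end IsLocalIsometry

end Naturality

/-! ### The Ricci tensor and the Ricci endomorphism -/

section Ricci

variable {m : ℕ} {g g' : Euc m → Euc m →L[ℝ] Euc m →L[ℝ] ℝ} {O O' : Set (Euc m)} {q : Euc m}
  {φ : Euc m → Euc m}

lemma sum_smul_stdVec (v : Euc m) : ∑ i, v i • stdVec i = v := by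
  have := (EuclideanSpace.basisFun (Fin m) ℝ).sum_repr v
  simpa [stdVec] using this

/-- The endomorphism `w ↦ R(w, u)v`. -/
def curvatureTrace (g : Euc m → Euc m →L[ℝ] Euc m →L[ℝ] ℝ) (q u v : Euc m) :
    Euc m →L[ℝ] Euc m :=
  (((fderiv ℝ (christoffelCLM g) q).flip u).flip v +
    (christoffelCLM g q).flip (christoffel g q u v)) -
  ((fderiv ℝ (christoffelCLM g) q u).flip v +
    (christoffelCLM g q u).comp ((christoffelCLM g q).flip v))

namespace IsMetricOn

variable (hg : IsMetricOn g O) (hq : q ∈ O)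
include hg hq

lemma curvatureTrace_apply (u v w : Euc m) :
    curvatureTrace g q u v w = curvature g q w u v := by
  rw [hg.curvature_eq hq]
  rfl

/-- The basis-free form of the Ricci tensor, to which invariance of the trace under conjugation
applies. -/
lemma ricci_eq_trace (u v : Euc m) :
    ricci g q u v = LinearMap.trace ℝ (Euc m) (curvatureTrace g q u v).toLinearMap := by
  rw [LinearMap.trace_eq_sum_inner _ (EuclideanSpace.basisFun (Fin m) ℝ), ricci]
  refine Finset.sum_congr rfl fun i _ => ?_
  have h1 : EuclideanSpace.basisFun (Fin m) ℝ i = stdVec i := by simp [stdVec]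
  rw [ContinuousLinearMap.coe_coe, h1, hg.curvatureTrace_apply hq]
  simp [stdVec, EuclideanSpace.inner_single_left]

lemma ricci_add_right (u v w : Euc m) : ricci g q u (v + w) = ricci g q u v + ricci g q u w := by
  simp only [ricci, hg.curvature_eq hq, ← christoffelCLM_apply, map_add, ← Finset.sum_add_distrib]
  refine Finset.sum_congr rfl fun i _ => ?_
  simp only [PiLp.add_apply, PiLp.sub_apply]
  ring

lemma ricci_smul_right (c : ℝ) (u v : Euc m) : ricci g q u (c • v) = c * ricci g q u v := by
  simp only [ricci, hg.curvature_eq hq, ← christoffelCLM_apply, map_smul, Finset.mul_sum]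
  refine Finset.sum_congr rfl fun i _ => ?_
  simp only [PiLp.add_apply, PiLp.sub_apply, PiLp.smul_apply, smul_eq_mul]
  ring

/-- Linearity of Ric(u, ·) identifies the covector that `ricciEnd` assembles from standard
components. Later arguments use `ricciEnd` through this characterisation only. -/
lemma metric_ricciEnd (u v : Euc m) : g q (ricciEnd g q u) v = ricci g q u v := by
  let L : Euc m →ₗ[ℝ] ℝ :=
    { toFun := fun v => ricci g q u v
      map_add' := hg.ricci_add_right hq u
      map_smul' := fun c v => hg.ricci_smul_right hq c u v }
  rw [ricciEnd, hg.apply_inverse hq]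
  have h1 : ricci g q u v = L (∑ i, v i • stdVec i) := by rw [sum_smul_stdVec]; rfl
  rw [h1, map_sum]
  simp [L, mul_comm]

end IsMetricOn

namespace IsLocalIsometry

variable (h : IsLocalIsometry g' O' g O φ) (hq : q ∈ O')
include h hq

/-- By naturality of the curvature, Dφ conjugates w ↦ R(w, u)v into the corresponding endomorphism
of the target, and conjugate endomorphisms have equal traces. -/
lemma ricci_eq (u v : Euc m) :
    ricci g' q u v = ricci g (φ q) (fderiv ℝ φ q u) (fderiv ℝ φ q v) := by
  obtain ⟨L, hL⟩ := h.isInvertible q hq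
  rw [h.source.ricci_eq_trace hq, h.target.ricci_eq_trace (h.mapsTo hq),
    ← LinearMap.trace_conj' _ L.toLinearEquiv]
  congr 1
  ext1 w
  have h1 := h.fderiv_curvature hq (L.symm w) u v
  rw [← hL] at h1 ⊢
  have h2 : curvatureTrace g' q u v (L.symm w) = curvature g' q (L.symm w) u v :=
    h.source.curvatureTrace_apply hq _ _ _
  have h3 : curvatureTrace g (φ q) (L u) (L v) w = curvature g (φ q) w (L u) (L v) :=
    h.target.curvatureTrace_apply (h.mapsTo hq) _ _ _
  change L (curvatureTrace g' q u v (L.symm w)) = curvatureTrace g (φ q) (L u) (L v) w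
  rw [h2, h3]
  simpa using h1

lemma fderiv_ricciEnd (u : Euc m) :
    fderiv ℝ φ q (ricciEnd g' q u) = ricciEnd g (φ q) (fderiv ℝ φ q u) := by
  refine h.target.eq_of_forall (h.mapsTo hq) fun w => ?_
  obtain ⟨w, rfl⟩ : ∃ w', fderiv ℝ φ q w' = w :=
    ⟨(fderiv ℝ φ q).inverse w, (h.isInvertible q hq).self_apply_inverse w⟩
  rw [← h.apply_eq q hq, h.source.metric_ricciEnd hq, h.target.metric_ricciEnd (h.mapsTo hq),
    h.ricci_eq hq]

/-- The scalar products of the image of the Ricci endomorphism are natural. -/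
lemma metric_ricciEnd_ricciEnd (u v : Euc m) : g' q (ricciEnd g' q u) (ricciEnd g' q v) =
    g (φ q) (ricciEnd g (φ q) (fderiv ℝ φ q u)) (ricciEnd g (φ q) (fderiv ℝ φ q v)) := by
  rw [h.apply_eq q hq, h.fderiv_ricciEnd hq, h.fderiv_ricciEnd hq]

end IsLocalIsometry

end Ricci

/-! ### The splitting of ℝⁿ⁺² into coordinates (x, y, z) -/

section Coordinates

variable {n : ℕ}

/-- The inclusion `y ↦ (0, y, 0)` of `ℝⁿ` into `ℝⁿ⁺²`. -/
def yIncl (n : ℕ) : Euc n →L[ℝ] Euc (n + 2) :=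
  LinearMap.toContinuousLinearMap
    { toFun := fun a => WithLp.toLp 2 (Fin.cons 0 (Fin.snoc (fun k => a k) 0))
      map_add' := fun a b => by
        ext i
        refine Fin.cases (by simp) (fun i => ?_) i
        refine Fin.lastCases (by simp) (fun i => by simp) i
      map_smul' := fun c a => by
        ext i
        refine Fin.cases (by simp) (fun i => ?_) i
        refine Fin.lastCases (by simp) (fun i => by simp) i }

/-- The projection `(x, y, z) ↦ y`. -/
def yProj (n : ℕ) : Euc (n + 2) →L[ℝ] Euc n :=
  LinearMap.toContinuousLinearMap
    { toFun := yCoord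
      map_add' := fun a b => by ext i; simp [yCoord]
      map_smul' := fun c a => by ext i; simp [yCoord] }

/-- The projection `(x, y, z) ↦ z`. -/
def zProj (n : ℕ) : Euc (n + 2) →L[ℝ] ℝ := EuclideanSpace.proj (Fin.last (n + 1))

/-- The projection `(x, y, z) ↦ x`. -/
def xProj (n : ℕ) : Euc (n + 2) →L[ℝ] ℝ := EuclideanSpace.proj 0

/-- The coordinate vector `∂/∂z`. -/
abbrev zVec (n : ℕ) : Euc (n + 2) := stdVec (Fin.last (n + 1))

lemma yProj_apply (v : Euc (n + 2)) : yProj n v = yCoord v := rfl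
lemma zProj_apply (v : Euc (n + 2)) : zProj n v = zCoord v := rfl
lemma xProj_apply (v : Euc (n + 2)) : xProj n v = xCoord v := rfl

@[simp] lemma yIncl_zero_coord (a : Euc n) : yIncl n a 0 = 0 := rfl
@[simp] lemma yIncl_castSucc_succ (a : Euc n) (k : Fin n) : yIncl n a k.castSucc.succ = a k := by
  simp [yIncl]
@[simp] lemma yIncl_succ_last (a : Euc n) : yIncl n a (Fin.last n).succ = 0 := by
  simp [yIncl]

@[simp] lemma xCoord_yIncl (a : Euc n) : xCoord (yIncl n a) = 0 := rfl
@[simp] lemma yCoord_yIncl (a : Euc n) : yCoord (yIncl n a) = a := by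
  ext k; simp [yCoord]
@[simp] lemma zCoord_yIncl (a : Euc n) : zCoord (yIncl n a) = 0 := by
  rw [zCoord, ← Fin.succ_last, yIncl_succ_last]
@[simp] lemma xCoord_stdVec_zero : xCoord (stdVec 0 : Euc (n + 2)) = 1 := by
  simp [xCoord, stdVec]
@[simp] lemma yCoord_stdVec_zero : yCoord (stdVec 0 : Euc (n + 2)) = 0 := by
  ext k; simp [yCoord, stdVec]
@[simp] lemma zCoord_stdVec_zero : zCoord (stdVec 0 : Euc (n + 2)) = 0 := by
  simp [zCoord, stdVec]
@[simp] lemma xCoord_zVec : xCoord (zVec n) = 0 := by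
  simp [xCoord, stdVec, Fin.ext_iff]
@[simp] lemma yCoord_zVec : yCoord (zVec n) = 0 := by
  ext k
  simp [yCoord, stdVec]
@[simp] lemma zCoord_zVec : zCoord (zVec n) = 1 := by
  simp [zCoord, stdVec]

lemma eq_of_coords {v w : Euc (n + 2)} (hx : xCoord v = xCoord w) (hy : yCoord v = yCoord w)
    (hz : zCoord v = zCoord w) : v = w := by
  ext i
  refine Fin.cases hx (fun i => ?_) i
  refine Fin.lastCases ?_ (fun k => ?_) i
  · rw [Fin.succ_last]; exact hz
  · exact congrFun (congrArg WithLp.ofLp hy) k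

lemma coord_add (v w : Euc (n + 2)) : xCoord (v + w) = xCoord v + xCoord w ∧
    yCoord (v + w) = yCoord v + yCoord w ∧ zCoord (v + w) = zCoord v + zCoord w :=
  ⟨rfl, map_add (yProj n) v w, rfl⟩

lemma coord_smul (c : ℝ) (v : Euc (n + 2)) : xCoord (c • v) = c * xCoord v ∧
    yCoord (c • v) = c • yCoord v ∧ zCoord (c • v) = c * zCoord v :=
  ⟨rfl, map_smul (yProj n) c v, rfl⟩

lemma coord_decomp (v : Euc (n + 2)) :
    v = xCoord v • stdVec 0 + yIncl n (yCoord v) + zCoord v • zVec n := by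
  refine eq_of_coords ?_ ?_ ?_ <;> simp [coord_add, coord_smul]

lemma stdVec_castSucc_succ (k : Fin n) :
    (stdVec k.castSucc.succ : Euc (n + 2)) = yIncl n (stdVec k) := by
  refine eq_of_coords ?_ ?_ ?_
  · simp [xCoord, stdVec, Fin.ext_iff]
  · ext j
    simp [yCoord, stdVec]
  · rw [zCoord_yIncl, zCoord, ← Fin.succ_last]
    simp [stdVec]

lemma sum_univ_coord {A : Type*} [AddCommMonoid A] (f : Fin (n + 2) → A) :
    ∑ i, f i = f 0 + (∑ k : Fin n, f k.castSucc.succ) + f (Fin.last (n + 1)) := by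
  rw [Fin.sum_univ_succ, Fin.sum_univ_castSucc, Fin.succ_last]
  exact (add_assoc _ _ _).symm

end Coordinates

/-! ### Walker metrics -/

/-- A metric with a parallel null vector `∂/∂x`, in coordinates `(x, y, z)` with
`h(∂/∂x, ·) = dz`. -/
structure IsWalkerMetric {n : ℕ} (g : Euc (n + 2) → Euc (n + 2) →L[ℝ] Euc (n + 2) →L[ℝ] ℝ)
    (O : Set (Euc (n + 2))) : Prop extends IsMetricOn g O where
  fderiv_stdVec_zero : ∀ q ∈ O, ∀ u v, fderiv ℝ g q (stdVec 0) u v = 0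
  stdVec_zero_left : ∀ q ∈ O, ∀ v, g q (stdVec 0) v = zCoord v

/-- A metric of the form `2 dx dz + f dz² + (∑ₖ uₖ dyₖ) dz + ∑ₖ dyₖ²` with coefficients
independent of `x`. -/
structure IsFlatBrinkmannMetric {n : ℕ} (g : Euc (n + 2) → Euc (n + 2) →L[ℝ] Euc (n + 2) →L[ℝ] ℝ)
    (O : Set (Euc (n + 2))) : Prop extends IsWalkerMetric g O where
  yIncl_yIncl : ∀ q ∈ O, ∀ a b, g q (yIncl n a) (yIncl n b) = ∑ k, a k * b k

section Walker

variable {n : ℕ} {g : Euc (n + 2) → Euc (n + 2) →L[ℝ] Euc (n + 2) →L[ℝ] ℝ}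
  {O : Set (Euc (n + 2))} {q : Euc (n + 2)}

/-- A metric with vanishing derivative in a direction is constant in this direction. -/
lemma apply_add_smul_eq {m : ℕ} {g : Euc m → Euc m →L[ℝ] Euc m →L[ℝ] ℝ} {O : Set (Euc m)}
    {e₀ x : Euc m} {t : ℝ} (hO : IsOpen O) (hconv : Convex ℝ O) (hg : ContDiffOn ℝ ∞ g O)
    (hd : ∀ q ∈ O, ∀ u v, fderiv ℝ g q e₀ u v = 0) (hx : x ∈ O) (hxt : x + t • e₀ ∈ O) :
    g (x + t • e₀) = g x := by
  ext a b
  have hs : ∀ s ∈ Set.Icc (0 : ℝ) 1, x + s • (t • e₀) ∈ O := fun s hs =>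
    hconv.add_smul_mem hx hxt hs
  have h1 : ∀ s ∈ Set.Icc (0 : ℝ) 1,
      HasDerivWithinAt (fun s : ℝ => g (x + s • (t • e₀)) a b) 0 (Set.Icc 0 1) s := by
    intro s hs'
    have h2 : HasDerivAt (fun s : ℝ => x + s • (t • e₀)) (t • e₀) s := by
      simpa using ((hasDerivAt_id s).smul_const (t • e₀)).const_add x
    have h3 := (((hg.contDiffAt (hO.mem_nhds (hs s hs'))).differentiableAt
      (by simp)).hasFDerivAt.clm_apply (hasFDerivAt_const a _)).clm_apply (hasFDerivAt_const b _)
    have h4 := h3.comp_hasDerivAt s h2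
    refine (h4.congr_deriv ?_).hasDerivWithinAt
    simp [hd _ (hs s hs')]
  have h5 := constant_of_has_deriv_right_zero
    (f := fun s : ℝ => g (x + s • (t • e₀)) a b) (a := 0) (b := 1)
    (fun s hs => (h1 s hs).continuousWithinAt)
    (fun s hs => ((h1 s ⟨hs.1, hs.2.le⟩).mono_of_mem_nhdsWithin
      (Icc_mem_nhdsGE_of_mem hs))) 1 (by simp)
  simpa using h5

namespace IsWalkerMetric

variable (hg : IsWalkerMetric g O) (hq : q ∈ O)
include hg hq

lemma fderiv_apply_stdVec_zero (u v : Euc (n + 2)) : fderiv ℝ g q u (stdVec 0) v = 0 := by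
  have h1 := ((hg.hasFDerivAt hq).clm_apply (hasFDerivAt_const (stdVec 0) q)).clm_apply
    (hasFDerivAt_const v q)
  have h2 : (fun x => g x (stdVec 0) v) =ᶠ[𝓝 q] fun _ => zCoord v := by
    filter_upwards [hg.isOpen.mem_nhds hq] with x hx using hg.stdVec_zero_left x hx v
  have := DFunLike.congr_fun
    (h1.unique ((hasFDerivAt_const (zCoord v) q).congr_of_eventuallyEq h2)) u
  simpa using this

/-- Since dz = g(∂/∂x, ·), this is the Koszul formula tested against ∂/∂x: each term differentiates
either along ∂/∂x or a coefficient of dz, which is constant. Thus the form dz is parallel. -/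
lemma zCoord_christoffel (u v : Euc (n + 2)) : zCoord (christoffel g q u v) = 0 := by
  rw [← hg.stdVec_zero_left q hq, hg.symm q hq, hg.koszul hq, hg.fderiv_stdVec_zero q hq,
    hg.fderiv_symm hq, hg.fderiv_apply_stdVec_zero hq, hg.fderiv_symm hq v,
    hg.fderiv_apply_stdVec_zero hq]
  simp

/-- The field ∂/∂x is parallel, for the same reasons. -/
lemma christoffel_stdVec_zero (u : Euc (n + 2)) : christoffel g q u (stdVec 0) = 0 := by
  refine hg.eq_of_forall hq fun w => ?_
  rw [hg.koszul hq, hg.fderiv_stdVec_zero q hq, hg.fderiv_apply_stdVec_zero hq,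
    hg.fderiv_symm hq w, hg.fderiv_apply_stdVec_zero hq]
  simp

lemma christoffel_stdVec_zero_left (u : Euc (n + 2)) : christoffel g q (stdVec 0) u = 0 := by
  rw [hg.christoffel_symm hq, hg.christoffel_stdVec_zero hq]

/-- On vectors tangent to the level sets of `z`, the metric depends on the `y`-parts only. -/
lemma apply_of_zCoord_eq_zero {v w : Euc (n + 2)} (hv : zCoord v = 0) (hw : zCoord w = 0) :
    g q v w = g q (yIncl n (yCoord v)) (yIncl n (yCoord w)) := by
  conv_lhs => rw [coord_decomp v, coord_decomp w]
  simp only [hv, hw, zero_smul, add_zero, map_add, map_smul, add_apply, smul_apply,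
    hg.stdVec_zero_left q hq, zCoord_yIncl, zCoord_stdVec_zero,
    hg.symm q hq (yIncl n (yCoord v)) (stdVec 0)]
  simp

/-- The coefficients of the connection do not depend on `x`. -/
lemma fderiv_christoffelCLM_stdVec_zero (u v : Euc (n + 2)) :
    fderiv ℝ (christoffelCLM g) q (stdVec 0) u v = 0 := by
  obtain ⟨δ, hδ, hball⟩ := Metric.isOpen_iff.1 hg.isOpen q hq
  have hconst : ∀ x ∈ Metric.ball q δ, ∀ t : ℝ, x + t • stdVec 0 ∈ Metric.ball q δ →
      g (x + t • stdVec 0) = g x := fun x hx t hxt =>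
    apply_add_smul_eq Metric.isOpen_ball (convex_ball q δ) (hg.contDiffOn.mono hball)
      (fun x hx => hg.fderiv_stdVec_zero x (hball hx)) hx hxt
  have hline : HasDerivAt (fun t : ℝ => q + t • (stdVec 0 : Euc (n + 2))) (stdVec 0) 0 := by
    simpa using ((hasDerivAt_id (0 : ℝ)).smul_const (stdVec 0 : Euc (n + 2))).const_add q
  have hev : ∀ᶠ t : ℝ in 𝓝 0, q + t • (stdVec 0 : Euc (n + 2)) ∈ Metric.ball q δ :=
    hline.continuousAt.eventually_mem (by simpa using Metric.ball_mem_nhds q hδ)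
  have hchr : ∀ᶠ t : ℝ in 𝓝 0, christoffel g (q + t • stdVec 0) u v = christoffel g q u v := by
    filter_upwards [hev] with t ht
    -- Γ involves the first derivative of g, so translation invariance is needed on a neighbourhood
    -- of q and not only at q.
    have h1 : (fun x => g (x + t • stdVec 0)) =ᶠ[𝓝 q] g := by
      have h2 : ∀ᶠ x in 𝓝 q, x + t • stdVec 0 ∈ Metric.ball q δ :=
        ContinuousAt.eventually_mem (f := fun x => x + t • (stdVec 0 : Euc (n + 2))) (by fun_prop)
          (Metric.isOpen_ball.mem_nhds ht)
      filter_upwards [h2, Metric.ball_mem_nhds q hδ] with x hx hx' using hconst x hx' t hx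
    have h3 : fderiv ℝ g (q + t • stdVec 0) = fderiv ℝ g q := by
      rw [← h1.fderiv_eq]
      exact (fderiv_comp_add_right (𝕜 := ℝ) (f := g) (t • stdVec 0)).symm
    simp only [christoffel, h3, hconst q (Metric.mem_ball_self hδ) t ht]
  have h1 := ((hg.hasFDerivAt_christoffelCLM hq).clm_apply
    (hasFDerivAt_const u q)).clm_apply (hasFDerivAt_const v q)
  have h2 := HasFDerivAt.comp_hasDerivAt_of_eq (0 : ℝ) h1 hline (by simp)
  have h3 := h2.unique ((hasDerivAt_const (0 : ℝ) (christoffel g q u v)).congr_of_eventuallyEq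
    hchr)
  simpa using h3

end IsWalkerMetric

end Walker

/-! ### The Ricci tensor of a flat Brinkmann metric -/

section FlatBrinkmann

variable {n : ℕ} {g : Euc (n + 2) → Euc (n + 2) →L[ℝ] Euc (n + 2) →L[ℝ] ℝ}
  {O : Set (Euc (n + 2))} {q : Euc (n + 2)}

/-- The exterior derivative in the `y`-directions of the one-form `h(∂/∂z, ·)`. -/
def transverseCurl (g : Euc (n + 2) → Euc (n + 2) →L[ℝ] Euc (n + 2) →L[ℝ] ℝ) (q : Euc (n + 2))
    (b c : Euc n) : ℝ :=
  fderiv ℝ g q (yIncl n b) (zVec n) (yIncl n c) - fderiv ℝ g q (yIncl n c) (zVec n) (yIncl n b)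

/-- The divergence in the `y`-directions of `transverseCurl`. -/
def transverseDivCurl (g : Euc (n + 2) → Euc (n + 2) →L[ℝ] Euc (n + 2) →L[ℝ] ℝ)
    (q : Euc (n + 2)) (b : Euc n) : ℝ :=
  ∑ k : Fin n, fderiv ℝ (fun q' => transverseCurl g q' b (stdVec k)) q (yIncl n (stdVec k))

lemma IsMetricOn.contDiffOn_transverseCurl (hg : IsMetricOn g O) (b c : Euc n) :
    ContDiffOn ℝ ∞ (fun q => transverseCurl g q b c) O :=
  (hg.contDiffOn_fderiv_apply _ _ _).sub (hg.contDiffOn_fderiv_apply _ _ _)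

namespace IsFlatBrinkmannMetric

variable (hg : IsFlatBrinkmannMetric g O) (hq : q ∈ O)
include hg hq

lemma apply_eq_sum {v w : Euc (n + 2)} (hv : zCoord v = 0) (hw : zCoord w = 0) :
    g q v w = ∑ k, yCoord v k * yCoord w k := by
  rw [hg.apply_of_zCoord_eq_zero hq hv hw, hg.yIncl_yIncl q hq]

lemma fderiv_yIncl_yIncl (u : Euc (n + 2)) (a b : Euc n) :
    fderiv ℝ g q u (yIncl n a) (yIncl n b) = 0 := by
  have h1 := ((hg.hasFDerivAt hq).clm_apply (hasFDerivAt_const (yIncl n a) q)).clm_apply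
    (hasFDerivAt_const (yIncl n b) q)
  have h2 : (fun x => g x (yIncl n a) (yIncl n b)) =ᶠ[𝓝 q] fun _ => ∑ k, a k * b k := by
    filter_upwards [hg.isOpen.mem_nhds hq] with x hx using hg.yIncl_yIncl x hx a b
  have := DFunLike.congr_fun
    (h1.unique ((hasFDerivAt_const (∑ k, a k * b k) q).congr_of_eventuallyEq h2)) u
  simpa using this

/-- Only the ∂/∂z-part of v contributes: the components g(∂/∂x, ·) and g(∂/∂yᵢ, ∂/∂yⱼ) are constant.
-/
lemma fderiv_apply_yIncl (u v : Euc (n + 2)) (c : Euc n) :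
    fderiv ℝ g q u v (yIncl n c) = zCoord v * fderiv ℝ g q u (zVec n) (yIncl n c) := by
  conv_lhs => rw [coord_decomp v]
  simp only [map_add, map_smul, add_apply, smul_apply, hg.fderiv_apply_stdVec_zero hq,
    hg.fderiv_yIncl_yIncl hq, smul_eq_mul]
  ring

/-- In the Koszul formula the first term vanishes and the other two combine to the curl of h(∂/∂z,
·). This is the only source of the operator d^*d. -/
lemma yCoord_christoffel_yIncl (u : Euc (n + 2)) (b : Euc n) (k : Fin n) :
    yCoord (christoffel g q u (yIncl n b)) k =
      (1 / 2 : ℝ) * zCoord u * transverseCurl g q b (stdVec k) := by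
  have h1 : g q (christoffel g q u (yIncl n b)) (yIncl n (stdVec k)) =
      yCoord (christoffel g q u (yIncl n b)) k := by
    rw [hg.apply_eq_sum hq (hg.zCoord_christoffel hq _ _) (zCoord_yIncl _), yCoord_yIncl]
    simp [stdVec]
  rw [← h1, hg.koszul hq, hg.fderiv_yIncl_yIncl hq, hg.fderiv_apply_yIncl hq (yIncl n b) u,
    hg.fderiv_apply_yIncl hq (yIncl n (stdVec k)) u, transverseCurl]
  ring

lemma yCoord_christoffel_yIncl_of_zCoord_eq_zero {u : Euc (n + 2)} (hu : zCoord u = 0)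
    (b : Euc n) : yCoord (christoffel g q u (yIncl n b)) = 0 := by
  ext k
  rw [hg.yCoord_christoffel_yIncl hq, hu]
  simp

lemma yCoord_christoffel_of_zCoord_eq_zero {u v : Euc (n + 2)} (hu : zCoord u = 0)
    (hv : zCoord v = 0) : yCoord (christoffel g q u v) = 0 := by
  have h1 : christoffel g q u v = christoffel g q u (yIncl n (yCoord v)) := by
    conv_lhs => rw [coord_decomp v, hv, zero_smul, add_zero, ← christoffelCLM_apply, map_add,
      map_smul, christoffelCLM_apply, christoffelCLM_apply, hg.christoffel_stdVec_zero hq]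
    simp
  rw [h1, hg.yCoord_christoffel_yIncl_of_zCoord_eq_zero hq hu]

/-- The inner term has neither a y- nor a z-part, so it is a multiple of the parallel field ∂/∂x. -/
lemma christoffel_christoffel_of_zCoord_eq_zero (u : Euc (n + 2)) {v w : Euc (n + 2)}
    (hv : zCoord v = 0) (hw : zCoord w = 0) :
    christoffel g q u (christoffel g q v w) = 0 := by
  rw [coord_decomp (christoffel g q v w), hg.yCoord_christoffel_of_zCoord_eq_zero hq hv hw,
    hg.zCoord_christoffel hq, ← christoffelCLM_apply]
  simp [hg.christoffel_stdVec_zero hq]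

/-- A linear functional applied to the derivative of the connection coefficients. -/
lemma clm_fderiv_christoffelCLM {F : Type*} [NormedAddCommGroup F] [NormedSpace ℝ F]
    (L : Euc (n + 2) →L[ℝ] F) (u v w : Euc (n + 2)) :
    L (fderiv ℝ (christoffelCLM g) q u v w) = fderiv ℝ (fun x => L (christoffel g x v w)) q u := by
  have h1 := ((hg.hasFDerivAt_christoffelCLM hq).clm_apply
    (hasFDerivAt_const v q)).clm_apply (hasFDerivAt_const w q)
  have h2 : HasFDerivAt (fun x => L (christoffel g x v w)) _ q := L.hasFDerivAt.comp q h1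
  have h3 := DFunLike.congr_fun h2.fderiv u
  simpa using h3.symm

lemma fderiv_eq_zero_of_forall {F : Type*} [NormedAddCommGroup F] [NormedSpace ℝ F]
    {s : Euc (n + 2) → F} (hs : ∀ x ∈ O, s x = 0) (u : Euc (n + 2)) : fderiv ℝ s q u = 0 := by
  have h1 : s =ᶠ[𝓝 q] fun _ => 0 := by
    filter_upwards [hg.isOpen.mem_nhds hq] with x hx using hs x hx
  rw [h1.fderiv_eq]
  simp

/-- R(·, ·) ∂/∂x = 0, because ∂/∂x is parallel. -/
lemma ricci_stdVec_zero (u : Euc (n + 2)) : ricci g q u (stdVec 0) = 0 := by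
  have h1 : ∀ u v : Euc (n + 2), fderiv ℝ (christoffelCLM g) q u v (stdVec 0) = 0 := by
    intro u v
    have := hg.clm_fderiv_christoffelCLM hq (ContinuousLinearMap.id ℝ _) u v (stdVec 0)
    rw [ContinuousLinearMap.id_apply] at this
    rw [this]
    exact hg.fderiv_eq_zero_of_forall hq (fun x hx => hg.christoffel_stdVec_zero hx v) u
  refine Finset.sum_eq_zero fun i _ => ?_
  rw [hg.curvature_eq hq, h1, h1, hg.christoffel_stdVec_zero hq, hg.christoffel_stdVec_zero hq,
    ← christoffelCLM_apply, ← christoffelCLM_apply, map_zero, map_zero]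
  simp

/-- In the trace, the ∂/∂x-term vanishes because Γ is independent of x and Γ(∂/∂x, ·) = 0, and the
∂/∂z-term vanishes because dz ∘ Γ = 0. In the y-terms the products of two Γ's have no y-part, and
what remains is ∂ₖ of the k-th y-component of Γ(u, ∂_b), a divergence of the curl. -/
lemma ricci_yIncl (u : Euc (n + 2)) (b : Euc n) :
    ricci g q u (yIncl n b) = (1 / 2 : ℝ) * zCoord u * transverseDivCurl g q b := by
  rw [ricci, sum_univ_coord]
  have hx : curvature g q (stdVec 0) u (yIncl n b) = 0 := by
    have h1 : fderiv ℝ (christoffelCLM g) q u (stdVec 0) (yIncl n b) = 0 := by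
      have := hg.clm_fderiv_christoffelCLM hq (ContinuousLinearMap.id ℝ _) u (stdVec 0) (yIncl n b)
      rw [ContinuousLinearMap.id_apply] at this
      rw [this]
      exact hg.fderiv_eq_zero_of_forall hq
        (fun x hx => hg.christoffel_stdVec_zero_left hx (yIncl n b)) u
    rw [hg.curvature_eq hq, hg.fderiv_christoffelCLM_stdVec_zero hq, h1,
      hg.christoffel_stdVec_zero_left hq, hg.christoffel_stdVec_zero_left hq,
      ← christoffelCLM_apply (g := g) (q := q) (u := u), map_zero]
    simp
  have hz : curvature g q (zVec n) u (yIncl n b) (Fin.last (n + 1)) = 0 := by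
    have h1 : ∀ u v w : Euc (n + 2), zCoord (fderiv ℝ (christoffelCLM g) q u v w) = 0 := by
      intro u v w
      rw [← zProj_apply, hg.clm_fderiv_christoffelCLM hq (zProj n)]
      exact hg.fderiv_eq_zero_of_forall hq (fun x hx => hg.zCoord_christoffel hx v w) u
    change zCoord _ = 0
    rw [hg.curvature_eq hq, ← zProj_apply, map_sub, map_add, map_add]
    simp only [zProj_apply, h1, hg.zCoord_christoffel hq]
    simp
  have hy : ∀ k : Fin n, curvature g q (stdVec k.castSucc.succ) u (yIncl n b) k.castSucc.succ =
      (1 / 2 : ℝ) * zCoord u *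
        fderiv ℝ (fun q' => transverseCurl g q' b (stdVec k)) q (yIncl n (stdVec k)) := by
    intro k
    rw [stdVec_castSucc_succ]
    let Lk : Euc (n + 2) →L[ℝ] ℝ := EuclideanSpace.proj k.castSucc.succ
    have hLk : ∀ v, Lk v = yCoord v k := fun v => rfl
    have h1 : Lk (fderiv ℝ (christoffelCLM g) q (yIncl n (stdVec k)) u (yIncl n b)) =
        (1 / 2 : ℝ) * zCoord u *
          fderiv ℝ (fun q' => transverseCurl g q' b (stdVec k)) q (yIncl n (stdVec k)) := by
      rw [hg.clm_fderiv_christoffelCLM hq Lk]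
      have h2 : (fun x => Lk (christoffel g x u (yIncl n b))) =ᶠ[𝓝 q]
          fun x => ((1 / 2 : ℝ) * zCoord u) * transverseCurl g x b (stdVec k) := by
        filter_upwards [hg.isOpen.mem_nhds hq] with x hx
        rw [hLk, hg.yCoord_christoffel_yIncl hx]
      have h3 : DifferentiableAt ℝ (fun x => transverseCurl g x b (stdVec k)) q :=
        ((hg.contDiffOn_transverseCurl b (stdVec k)).contDiffAt
          (hg.isOpen.mem_nhds hq)).differentiableAt (by simp)
      rw [h2.fderiv_eq, fderiv_const_mul h3]
      simp
    have h2 : Lk (fderiv ℝ (christoffelCLM g) q u (yIncl n (stdVec k)) (yIncl n b)) = 0 := by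
      rw [hg.clm_fderiv_christoffelCLM hq Lk]
      refine hg.fderiv_eq_zero_of_forall hq (fun x hx => ?_) u
      rw [hLk, hg.yCoord_christoffel_yIncl_of_zCoord_eq_zero hx (zCoord_yIncl _)]
      simp
    have h3 : ∀ v : Euc (n + 2), v k.castSucc.succ = Lk v := fun v => rfl
    rw [h3, hg.curvature_eq hq, map_sub, map_add, map_add, h1, h2,
      hg.christoffel_christoffel_of_zCoord_eq_zero hq u (zCoord_yIncl _) (zCoord_yIncl _), hLk,
      hg.yCoord_christoffel_of_zCoord_eq_zero hq (zCoord_yIncl _) (hg.zCoord_christoffel hq _ _)]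
    simp
  rw [hx, hz, Finset.sum_congr rfl fun k _ => hy k, ← Finset.mul_sum, transverseDivCurl]
  simp

/-- The scalar products of the image of the Ricci endomorphism of a flat Brinkmann metric. -/
theorem metric_ricciEnd_ricciEnd (u v : Euc (n + 2)) :
    g q (ricciEnd g q u) (ricciEnd g q v) =
      (1 / 4 : ℝ) * zCoord u * zCoord v * ∑ k, transverseDivCurl g q (stdVec k) ^ 2 := by
  -- The image of the Ricci endomorphism lies in Ξ^⊥, where the scalar product is Euclidean in the
  -- y-parts and so positive semidefinite.
  have hz : ∀ u, zCoord (ricciEnd g q u) = 0 := by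
    intro u
    rw [← hg.stdVec_zero_left q hq, hg.symm q hq, hg.metric_ricciEnd hq,
      hg.ricci_stdVec_zero hq]
  have hy : ∀ u k, yCoord (ricciEnd g q u) k =
      (1 / 2 : ℝ) * zCoord u * transverseDivCurl g q (stdVec k) := by
    intro u k
    rw [← hg.ricci_yIncl hq, ← hg.metric_ricciEnd hq, hg.apply_eq_sum hq (hz u) (zCoord_yIncl _),
      yCoord_yIncl]
    simp [stdVec]
  rw [hg.apply_eq_sum hq (hz u) (hz v), Finset.mul_sum]
  refine Finset.sum_congr rfl fun k _ => ?_
  rw [hy, hy]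
  ring

/-- Ricci-isotropy of a flat Brinkmann metric at a point. -/
theorem ricciIsotropic_iff :
    (∀ u v, g q (ricciEnd g q u) (ricciEnd g q v) = 0) ↔
      ∀ k : Fin n, transverseDivCurl g q (stdVec k) = 0 := by
  constructor
  · intro h k
    -- The single pair U = V = ∂/∂z already gives the whole sum of squares.
    have h1 := h (zVec n) (zVec n)
    rw [hg.metric_ricciEnd_ricciEnd hq, zCoord_zVec] at h1
    have h2 : ∑ k, transverseDivCurl g q (stdVec k) ^ 2 = 0 := by linarith
    rw [Finset.sum_eq_zero_iff_of_nonneg fun k _ => sq_nonneg _] at h2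
    exact pow_eq_zero_iff two_ne_zero |>.1 (h2 k (Finset.mem_univ k))
  · intro h u v
    rw [hg.metric_ricciEnd_ricciEnd hq]
    simp [h]

end IsFlatBrinkmannMetric

end FlatBrinkmann

/-! ### The operator d^*d on one-forms of ℝⁿ -/

section Codifferential

variable {n : ℕ}

open ContinuousAlternatingMap in
/-- The exterior derivative of a one-form. -/
lemma extDeriv_ofSubsingleton {A : Euc n → Euc n →L[ℝ] ℝ} {y : Euc n}
    (hA : DifferentiableAt ℝ A y) (v : Fin 2 → Euc n) :
    extDeriv (fun y => ofSubsingleton ℝ (Euc n) ℝ (0 : Fin 1) (A y)) y v =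
      fderiv ℝ A y (v 0) (v 1) - fderiv ℝ A y (v 1) (v 0) := by
  have h1 : DifferentiableAt ℝ (fun y => ofSubsingleton ℝ (Euc n) ℝ (0 : Fin 1) (A y)) y :=
    (ofSubsingletonLIE (𝕜 := ℝ) (E := Euc n) (F := ℝ) (0 : Fin 1)).toContinuousLinearEquiv.differentiableAt.comp y hA
  rw [extDeriv_apply h1, Fin.sum_univ_two]
  have h2 : ∀ w : Fin 1 → Euc n, ∀ u,
      fderiv ℝ (fun y => ofSubsingleton ℝ (Euc n) ℝ (0 : Fin 1) (A y) w) y u =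
        fderiv ℝ A y u (w 0) := by
    intro w u
    have h3 : HasFDerivAt (fun y => A y (w 0)) _ y :=
      hA.hasFDerivAt.clm_apply (hasFDerivAt_const (w 0) y)
    change fderiv ℝ (fun y => A y (w 0)) y u = _
    rw [h3.fderiv]
    simp
  rw [h2, h2]
  simp [Fin.removeNth, sub_eq_add_neg]

open ContinuousAlternatingMap in
/-- The Laplacian-type operator `d^*d` on one-forms. -/
lemma codifferential_extDeriv_ofSubsingleton {A : Euc n → Euc n →L[ℝ] ℝ} {U : Set (Euc n)}
    (hU : IsOpen U) (hA : ContDiffOn ℝ ∞ A U) {y : Euc n} (hy : y ∈ U) (v : Fin 1 → Euc n) :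
    codifferential (extDeriv fun y => ofSubsingleton ℝ (Euc n) ℝ (0 : Fin 1) (A y)) y v =
      ∑ j : Fin n, fderiv ℝ (fun y' => fderiv ℝ A y' (v 0) (stdVec j) -
        fderiv ℝ A y' (stdVec j) (v 0)) y (stdVec j) := by
  have h1 : ContDiffOn ℝ ∞ (fun y => ofSubsingleton ℝ (Euc n) ℝ (0 : Fin 1) (A y)) U :=
    (ofSubsingletonLIE (𝕜 := ℝ) (E := Euc n) (F := ℝ) (0 : Fin 1)).toContinuousLinearEquiv.contDiff.comp_contDiffOn hA
  have h2 : DifferentiableAt ℝ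
      (extDeriv fun y => ofSubsingleton ℝ (Euc n) ℝ (0 : Fin 1) (A y)) y := by
    have h3 := ((h1.fderiv_of_isOpen hU (m := ∞) (by simp)).contDiffAt
      (hU.mem_nhds hy)).differentiableAt (by simp)
    exact (alternatizeUncurryFinCLM ℝ (Euc n) ℝ).differentiableAt.comp y h3
  have h4 : ∀ j : Fin n, (fderiv ℝ (extDeriv fun y => ofSubsingleton ℝ (Euc n) ℝ (0 : Fin 1) (A y))
      y (stdVec j)).curryLeft (stdVec j) v = fderiv ℝ (fun y' => fderiv ℝ A y' (stdVec j) (v 0) -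
        fderiv ℝ A y' (v 0) (stdVec j)) y (stdVec j) := by
    intro j
    have h5 := h2.hasFDerivAt.continuousAlternatingMap_apply_const (Matrix.vecCons (stdVec j) v)
    have h6 : (fun y' => extDeriv (fun y => ofSubsingleton ℝ (Euc n) ℝ (0 : Fin 1) (A y)) y'
        (Matrix.vecCons (stdVec j) v)) =ᶠ[𝓝 y] fun y' => fderiv ℝ A y' (stdVec j) (v 0) -
          fderiv ℝ A y' (v 0) (stdVec j) := by
      filter_upwards [hU.mem_nhds hy] with y' hy'
      rw [extDeriv_ofSubsingleton ((hA.contDiffAt (hU.mem_nhds hy')).differentiableAt (by simp))]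
      simp
    rw [← h6.fderiv_eq, h5.fderiv]
    simp
  have h7 : codifferential (extDeriv fun y => ofSubsingleton ℝ (Euc n) ℝ (0 : Fin 1) (A y)) y v =
      -∑ j : Fin n, (fderiv ℝ (extDeriv fun y => ofSubsingleton ℝ (Euc n) ℝ (0 : Fin 1) (A y))
        y (stdVec j)).curryLeft (stdVec j) v := by
    simp [codifferential, ContinuousAlternatingMap.sum_apply]
  -- The sign in the codifferential is absorbed by exchanging the two arguments of the curl.
  rw [h7, ← Finset.sum_neg_distrib]
  refine Finset.sum_congr rfl fun j _ => ?_
  rw [h4, ← _root_.neg_apply, ← fderiv_fun_neg]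
  simp only [neg_sub]

end Codifferential

/-! ### Comparison of d^*d φ with the divergence of the transverse curl -/

section FlatBrinkmann

variable {n : ℕ} {g : Euc (n + 2) → Euc (n + 2) →L[ℝ] Euc (n + 2) →L[ℝ] ℝ}
  {O : Set (Euc (n + 2))} {q : Euc (n + 2)}

/-- `d^*d` of the one-form `2 h(∂/∂z, ·)` in the `y`-directions. -/
lemma IsMetricOn.codifferential_extDeriv_oneForm (hg : IsMetricOn g O) (hq : q ∈ O)
    {a : Fin n → Euc n → ℝ → ℝ}
    (ha : ∀ q ∈ O, ∀ c, 2 * g q (zVec n) (yIncl n c) = ∑ k, a k (yCoord q) (zCoord q) * c k)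
    (v : Fin 1 → Euc n) :
    codifferential (extDeriv (oneForm fun k y => a k y (zCoord q))) (yCoord q) v =
      2 * transverseDivCurl g q (v 0) := by
  -- τ parametrises the y-plane through q, with x and z frozen at their values at q; this turns
  -- derivatives of φ_z on ℝⁿ into derivatives of g along `yIncl`.
  let τ : Euc n → Euc (n + 2) := fun y => q + yIncl n (y - yCoord q)
  have hτd : ∀ y, HasFDerivAt τ (yIncl n) y := fun y => by
    have := ((yIncl n).hasFDerivAt.comp y ((hasFDerivAt_id y).sub_const (yCoord q))).const_add q
    rwa [ContinuousLinearMap.comp_id] at this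
  have hτs : ContDiff ℝ ∞ τ :=
    contDiff_const.add ((yIncl n).contDiff.comp (contDiff_id.sub contDiff_const))
  have hτq : τ (yCoord q) = q := by simp [τ]
  have hτy : ∀ y, yCoord (τ y) = y := fun y => by
    rw [(coord_add _ _).2.1, yCoord_yIncl, add_sub_cancel]
  have hτz : ∀ y, zCoord (τ y) = zCoord q := fun y => by
    rw [(coord_add _ _).2.2, zCoord_yIncl, add_zero]
  have hU : IsOpen (τ ⁻¹' O) := hg.isOpen.preimage hτs.continuous
  have hyU : yCoord q ∈ τ ⁻¹' O := by rw [Set.mem_preimage, hτq]; exact hq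
  let A : Euc n → Euc n →L[ℝ] ℝ := fun y =>
    ∑ k : Fin n, a k y (zCoord q) • (EuclideanSpace.proj k : Euc n →L[ℝ] ℝ)
  have hA : ∀ y ∈ τ ⁻¹' O, ∀ c, A y c = 2 * g (τ y) (zVec n) (yIncl n c) := by
    intro y hy c
    rw [ha _ hy, hτy, hτz]
    simp [A]
  -- Smoothness is inherited from g: the coefficients a are constrained only over O.
  have hAs : ContDiffOn ℝ ∞ A (τ ⁻¹' O) := by
    refine contDiffOn_clm_apply.2 fun c => ?_
    refine ContDiffOn.congr ?_ fun y hy => hA y hy c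
    exact contDiffOn_const.mul (((hg.contDiffOn.comp hτs.contDiffOn fun _ hy => hy).clm_apply
      contDiffOn_const).clm_apply contDiffOn_const)
  have hAd : ∀ y ∈ τ ⁻¹' O, ∀ b c, fderiv ℝ A y b c =
      2 * fderiv ℝ g (τ y) (yIncl n b) (zVec n) (yIncl n c) := by
    intro y hy b c
    have h1 : HasFDerivAt (fun y => A y c) _ y :=
      (((hAs.contDiffAt (hU.mem_nhds hy)).differentiableAt (by simp)).hasFDerivAt).clm_apply
        (hasFDerivAt_const c y)
    have h2 : HasFDerivAt (fun y => 2 * g (τ y) (zVec n) (yIncl n c)) _ y :=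
      (((((hg.hasFDerivAt hy).clm_apply (hasFDerivAt_const (zVec n) _)).clm_apply
        (hasFDerivAt_const (yIncl n c) _)).comp y (hτd y)).const_mul 2)
    have h3 : (fun y => A y c) =ᶠ[𝓝 y] fun y => 2 * g (τ y) (zVec n) (yIncl n c) := by
      filter_upwards [hU.mem_nhds hy] with y' hy' using hA y' hy' c
    have h4 := DFunLike.congr_fun (h1.unique (h2.congr_of_eventuallyEq h3)) b
    simpa using h4
  have h1 := codifferential_extDeriv_ofSubsingleton hU hAs hyU v
  refine h1.trans ?_
  rw [transverseDivCurl, Finset.mul_sum]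
  refine Finset.sum_congr rfl fun j _ => ?_
  have h2 : (fun y' => fderiv ℝ A y' (v 0) (stdVec j) - fderiv ℝ A y' (stdVec j) (v 0))
      =ᶠ[𝓝 (yCoord q)] fun y' => 2 * transverseCurl g (τ y') (v 0) (stdVec j) := by
    filter_upwards [hU.mem_nhds hyU] with y' hy'
    rw [hAd y' hy', hAd y' hy', transverseCurl]
    ring
  have h3 : DifferentiableAt ℝ (fun x => transverseCurl g x (v 0) (stdVec j)) (τ (yCoord q)) := by
    rw [hτq]
    exact ((hg.contDiffOn_transverseCurl _ _).contDiffAt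
      (hg.isOpen.mem_nhds hq)).differentiableAt (by simp)
  have h4 : HasFDerivAt (fun y' => 2 * transverseCurl g (τ y') (v 0) (stdVec j)) _ (yCoord q) :=
    (h3.hasFDerivAt.comp (yCoord q) (hτd _)).const_mul 2
  rw [h2.fderiv_eq, h4.fderiv, hτq]
  simp

lemma IsMetricOn.codifferential_extDeriv_oneForm_eq_zero_iff (hg : IsMetricOn g O) (hq : q ∈ O)
    {a : Fin n → Euc n → ℝ → ℝ}
    (ha : ∀ q ∈ O, ∀ c, 2 * g q (zVec n) (yIncl n c) = ∑ k, a k (yCoord q) (zCoord q) * c k) :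
    codifferential (extDeriv (oneForm fun k y => a k y (zCoord q))) (yCoord q) = 0 ↔
      ∀ k : Fin n, transverseDivCurl g q (stdVec k) = 0 := by
  have h1 := hg.codifferential_extDeriv_oneForm hq ha
  constructor
  · intro h k
    have := h1 fun _ => stdVec k
    rw [h] at this
    simpa using this
  · intro h
    set c := codifferential (extDeriv (oneForm fun k y => a k y (zCoord q))) (yCoord q) with hc
    let ℓ : Euc n →L[ℝ] ℝ := (ContinuousAlternatingMap.ofSubsingleton ℝ (Euc n) ℝ (0 : Fin 1)).symm c
    have h2 : ∀ v, c v = ℓ (v 0) := fun v => by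
      have h3 : v = fun _ => v 0 := by
        ext i
        rw [Subsingleton.elim i 0]
      conv_lhs => rw [h3]
      rfl
    have h3 : ∀ k, ℓ (stdVec k) = 0 := fun k => by
      have := h1 fun _ => stdVec k
      rw [h2, h] at this
      simpa using this
    ext v
    rw [h2, ← sum_smul_stdVec (v 0), map_sum]
    simp [h3]

end FlatBrinkmann

/-! ### Metric, vector fields and transition maps in charts -/

section Charts

variable {n : ℕ} {M : Type*} [TopologicalSpace M] [ChartedSpace (Euc (n + 2)) M]
  {e e' : OpenPartialHomeomorph M (Euc (n + 2))}
  {q u v : Euc (n + 2)}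

lemma mdifferentiable_of_mem_maximalAtlas (he : e ∈ IsManifold.maximalAtlas (𝓡 (n + 2)) ∞ M) :
    e.MDifferentiable (𝓡 (n + 2)) (𝓡 (n + 2)) :=
  ⟨(contMDiffOn_of_mem_maximalAtlas he).mdifferentiableOn (by simp),
    (contMDiffOn_symm_of_mem_maximalAtlas he).mdifferentiableOn (by simp)⟩

lemma mfderiv_mfderiv_symm (he : e ∈ IsManifold.maximalAtlas (𝓡 (n + 2)) ∞ M) (hq : q ∈ e.target)
    (v : TangentSpace (𝓡 (n + 2)) q) :
    mfderiv (𝓡 (n + 2)) (𝓡 (n + 2)) e (e.symm q) (mfderiv (𝓡 (n + 2)) (𝓡 (n + 2)) e.symm q v) = v :=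
  DFunLike.congr_fun ((mdifferentiable_of_mem_maximalAtlas he).comp_symm_deriv hq) v

lemma mfderiv_symm_mfderiv (he : e ∈ IsManifold.maximalAtlas (𝓡 (n + 2)) ∞ M) (hq : q ∈ e.target)
    (v : TangentSpace (𝓡 (n + 2)) (e.symm q)) :
    mfderiv (𝓡 (n + 2)) (𝓡 (n + 2)) e.symm q (mfderiv (𝓡 (n + 2)) (𝓡 (n + 2)) e (e.symm q) v) = v := by
  have h1 := DFunLike.congr_fun
    ((mdifferentiable_of_mem_maximalAtlas he).symm_comp_deriv (e.map_target hq)) v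
  rw [e.right_inv hq] at h1
  exact h1

lemma mfderiv_symm_fieldInChart (X : ∀ p : M, TangentSpace (𝓡 (n + 2)) p)
    (he : e ∈ IsManifold.maximalAtlas (𝓡 (n + 2)) ∞ M) (hq : q ∈ e.target) :
    mfderiv (𝓡 (n + 2)) (𝓡 (n + 2)) e.symm q (fieldInChart X e q) = X (e.symm q) :=
  mfderiv_symm_mfderiv he hq _

variable [IsManifold (𝓡 (n + 2)) ∞ M]

/-- The coordinate vector fields of a chart are smooth. -/
lemma contMDiffOn_mfderiv_symm (he : e ∈ IsManifold.maximalAtlas (𝓡 (n + 2)) ∞ M)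
    (u : Euc (n + 2)) :
    ContMDiffOn (𝓡 (n + 2)) (𝓡 (n + 2)).tangent ∞
      (fun q => (⟨e.symm q, mfderiv (𝓡 (n + 2)) (𝓡 (n + 2)) e.symm q u⟩ :
        TangentBundle (𝓡 (n + 2)) M)) e.target := by
  have h1 := (contMDiffOn_symm_of_mem_maximalAtlas he).contMDiffOn_tangentMapWithin
    (m := ∞) (by simp) e.open_target.uniqueMDiffOn
  have h2 : ContMDiff (𝓡 (n + 2)) (𝓡 (n + 2)).tangent ∞
      (fun q => (⟨q, u⟩ : TangentBundle (𝓡 (n + 2)) (Euc (n + 2)))) :=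
    contMDiff_vectorSpace_iff_contDiff.2 contDiff_const
  refine (h1.comp h2.contMDiffOn fun q hq => hq).congr fun q hq => ?_
  simp only [Function.comp, tangentMapWithin, mfderivWithin_of_isOpen e.open_target hq]

/-- The components are the values of the smooth section h on pairs of coordinate vector fields,
which are smooth sections along e⁻¹. The target is written as the trivial line bundle so that
evaluation of bundle morphisms applies. -/
lemma contDiffOn_metricInChart (h : LorentzianMetric n M)
    (he : e ∈ IsManifold.maximalAtlas (𝓡 (n + 2)) ∞ M) :
    ContDiffOn ℝ ∞ (metricInChart h e) e.target := by
  refine contDiffOn_clm_apply.2 fun u => contDiffOn_clm_apply.2 fun v => ?_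
  have hψ : ContMDiffOn (𝓡 (n + 2))
      ((𝓡 (n + 2)).prod 𝓘(ℝ, Euc (n + 2) →L[ℝ] Euc (n + 2) →L[ℝ] ℝ)) ∞
      (fun q => Bundle.TotalSpace.mk' (Euc (n + 2) →L[ℝ] Euc (n + 2) →L[ℝ] ℝ)
        (E := fun p : M => TangentSpace (𝓡 (n + 2)) p →L[ℝ] TangentSpace (𝓡 (n + 2)) p →L[ℝ]
          Bundle.Trivial M ℝ p) (e.symm q) (h.inner (e.symm q))) e.target :=
    h.contMDiff.comp_contMDiffOn (contMDiffOn_symm_of_mem_maximalAtlas he)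
  have h1 := ContMDiffOn.clm_bundle_apply₂ (F₁ := Euc (n + 2)) (F₂ := Euc (n + 2)) (F₃ := ℝ)
    (E₁ := fun p : M => TangentSpace (𝓡 (n + 2)) p)
    (E₂ := fun p : M => TangentSpace (𝓡 (n + 2)) p) (E₃ := Bundle.Trivial M ℝ)
    hψ (contMDiffOn_mfderiv_symm he u) (contMDiffOn_mfderiv_symm he v)
  have h2 : ContMDiffOn (𝓡 (n + 2)) 𝓘(ℝ, ℝ) ∞ (fun q => metricInChart h e q u v) e.target := by
    intro q hq
    have h3 := h1 q hq
    simp only [Bundle.contMDiffWithinAt_totalSpace] at h3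
    exact h3.2
  exact h2.contDiffOn

lemma contDiffOn_fieldInChart {X : ∀ p : M, TangentSpace (𝓡 (n + 2)) p}
    (hX : ContMDiff (𝓡 (n + 2)) (𝓡 (n + 2)).tangent ∞
      (fun p => (⟨p, X p⟩ : TangentBundle (𝓡 (n + 2)) M)))
    (he : e ∈ IsManifold.maximalAtlas (𝓡 (n + 2)) ∞ M) :
    ContDiffOn ℝ ∞ (fieldInChart X e) e.target := by
  have h1 := (contMDiffOn_of_mem_maximalAtlas he).contMDiffOn_tangentMapWithin
    (m := ∞) (by simp) e.open_source.uniqueMDiffOn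
  have h2 := h1.comp (hX.comp_contMDiffOn (contMDiffOn_symm_of_mem_maximalAtlas he))
    fun q hq => e.map_target hq
  have h3 : ContMDiffOn (𝓡 (n + 2)) 𝓘(ℝ, Euc (n + 2)) ∞ (fieldInChart X e) e.target := by
    refine ((contMDiff_snd_tangentBundle_modelSpace (Euc (n + 2))
      (𝓡 (n + 2))).comp_contMDiffOn h2).congr fun q hq => ?_
    simp only [Function.comp, tangentMapWithin,
      mfderivWithin_of_isOpen e.open_source (e.map_target hq)]
    rfl
  exact h3.contDiffOn

/-- A Lorentzian metric is non-degenerate. -/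
lemma LorentzianMetric.eq_zero_of_forall (h : LorentzianMetric n M) {p : M}
    {v : TangentSpace (𝓡 (n + 2)) p} (hv : ∀ w, h.inner p v w = 0) : v = 0 := by
  obtain ⟨b, hb⟩ := h.signature p
  refine b.ext_elem fun j => ?_
  have h1 := hv (b j)
  rw [← b.sum_repr v, map_sum, sum_apply, Finset.sum_eq_single j] at h1
  · rw [map_smul, smul_apply, hb, if_pos rfl] at h1
    rw [map_zero, Finsupp.zero_apply]
    split_ifs at h1 <;> simpa using h1
  · intro i _ hij
    rw [map_smul, smul_apply, hb, if_neg hij, smul_zero]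
  · simp

lemma isMetricOn_metricInChart (h : LorentzianMetric n M)
    (he : e ∈ IsManifold.maximalAtlas (𝓡 (n + 2)) ∞ M) :
    IsMetricOn (metricInChart h e) e.target where
  isOpen := e.open_target
  contDiffOn := contDiffOn_metricInChart h he
  symm q _ u v := h.symm _ _ _
  nondegenerate q hq u hu := by
    have h1 := h.eq_zero_of_forall (p := e.symm q)
      (v := mfderiv (𝓡 (n + 2)) (𝓡 (n + 2)) e.symm q u) fun w => by
        rw [← mfderiv_symm_mfderiv he hq w]
        exact hu _
    rw [← mfderiv_mfderiv_symm he hq u, h1]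
    exact map_zero _

/-- The change of charts. -/
lemma isLocalIsometry_transition (h : LorentzianMetric n M)
    (he : e ∈ IsManifold.maximalAtlas (𝓡 (n + 2)) ∞ M)
    (he' : e' ∈ IsManifold.maximalAtlas (𝓡 (n + 2)) ∞ M) :
    IsLocalIsometry (metricInChart h e') (e'.symm.trans e).source (metricInChart h e) e.target
      (e'.symm.trans e) ∧ ∀ q ∈ (e'.symm.trans e).source, ∀ v,
      fderiv ℝ (e'.symm.trans e) q v = mfderiv (𝓡 (n + 2)) (𝓡 (n + 2)) e (e'.symm q)
        (mfderiv (𝓡 (n + 2)) (𝓡 (n + 2)) e'.symm q v) := by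
  have hsub : (e'.symm.trans e).source ⊆ e'.target := fun q hq => by
    simp only [OpenPartialHomeomorph.trans_source] at hq
    exact hq.1
  have hsub' : ∀ q ∈ (e'.symm.trans e).source, e'.symm q ∈ e.source := fun q hq => by
    simp only [OpenPartialHomeomorph.trans_source] at hq
    exact hq.2
  have hd : ∀ q ∈ (e'.symm.trans e).source, ∀ v,
      fderiv ℝ (e'.symm.trans e) q v = mfderiv (𝓡 (n + 2)) (𝓡 (n + 2)) e (e'.symm q)
        (mfderiv (𝓡 (n + 2)) (𝓡 (n + 2)) e'.symm q v) := by
    intro q hq v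
    have h1 := mfderiv_comp q
      ((mdifferentiable_of_mem_maximalAtlas he).mdifferentiableAt (hsub' q hq))
      ((mdifferentiable_of_mem_maximalAtlas he').mdifferentiableAt_symm (hsub hq))
    rw [← mfderiv_eq_fderiv]
    exact DFunLike.congr_fun h1 v
  have hm := isMetricOn_metricInChart h he'
  refine ⟨⟨⟨(e'.symm.trans e).open_source, hm.contDiffOn.mono hsub, fun q hq => hm.symm q (hsub hq),
    fun q hq => hm.nondegenerate q (hsub hq)⟩, isMetricOn_metricInChart h he, ?_, ?_, ?_, ?_⟩, hd⟩
  · refine ContMDiffOn.contDiffOn ?_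
    exact (contMDiffOn_of_mem_maximalAtlas he).comp
      ((contMDiffOn_symm_of_mem_maximalAtlas he').mono hsub) hsub'
  · intro q hq
    exact e.map_source (hsub' q hq)
  · intro q hq
    have hinj : Function.Injective (fderiv ℝ (e'.symm.trans e) q).toLinearMap := by
      intro u v huv
      have h1 : fderiv ℝ (e'.symm.trans e) q u = fderiv ℝ (e'.symm.trans e) q v := huv
      rw [hd q hq, hd q hq] at h1
      have h2 := (mdifferentiable_of_mem_maximalAtlas he).mfderiv_injective (hsub' q hq) h1
      exact (mdifferentiable_of_mem_maximalAtlas he').symm.mfderiv_injective (hsub hq) h2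
    refine ⟨(LinearEquiv.ofInjectiveEndo _ hinj).toContinuousLinearEquiv, ?_⟩
    ext v
    rfl
  · intro q hq u v
    have h1 : ∀ v, mfderiv (𝓡 (n + 2)) (𝓡 (n + 2)) e.symm (e (e'.symm q))
        (fderiv ℝ (e'.symm.trans e) q v) = mfderiv (𝓡 (n + 2)) (𝓡 (n + 2)) e'.symm q v := by
      intro v
      rw [hd q hq]
      exact DFunLike.congr_fun
        ((mdifferentiable_of_mem_maximalAtlas he).symm_comp_deriv (hsub' q hq)) _
    have h2 : e.symm ((e'.symm.trans e) q) = e'.symm q := e.left_inv (hsub' q hq)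
    let B : M → Euc (n + 2) →L[ℝ] Euc (n + 2) →L[ℝ] ℝ := h.inner
    change B (e'.symm q) _ _ = B (e.symm ((e'.symm.trans e) q)) _ _
    rw [h2]
    exact congrArg₂ (fun a b => B (e'.symm q) a b) (h1 u).symm (h1 v).symm

end Charts

/-! ### Ricci-isotropy in a flat Brinkmann chart, and the converse direction -/

section FlatCharts

variable {n : ℕ} {M : Type*} [TopologicalSpace M] [ChartedSpace (Euc (n + 2)) M]
  [IsManifold (𝓡 (n + 2)) ∞ M] {h : LorentzianMetric n M}
  {e e' : OpenPartialHomeomorph M (Euc (n + 2))}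
  {a : Fin n → Euc n → ℝ → ℝ} {f : Euc n → ℝ → ℝ} {q : Euc (n + 2)}

namespace IsFlatBrinkmannChart

variable (hc : IsFlatBrinkmannChart h e a f)
include hc

/-- Polarisation of the quadratic form in `metric_eq`. The factor 2 clears the halves with which the
cross term uₖ dyₖ dz enters the bilinear form. -/
lemma two_mul_apply (hq : q ∈ e.target) (v w : Euc (n + 2)) :
    2 * metricInChart h e q v w =
      2 * (xCoord v * zCoord w + xCoord w * zCoord v)
        + 2 * (f (yCoord q) (zCoord q) * (zCoord v * zCoord w))
        + ((∑ k, a k (yCoord q) (zCoord q) * yCoord v k) * zCoord w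
          + (∑ k, a k (yCoord q) (zCoord q) * yCoord w k) * zCoord v)
        + 2 * ∑ k, yCoord v k * yCoord w k := by
  have hm := isMetricOn_metricInChart h hc.mem_atlas
  have h1 := hc.metric_eq q hq (v + w)
  obtain ⟨hx, hy, hz⟩ := coord_add v w
  have h2 : ∑ k, a k (yCoord q) (zCoord q) * yCoord (v + w) k =
      ∑ k, a k (yCoord q) (zCoord q) * yCoord v k +
        ∑ k, a k (yCoord q) (zCoord q) * yCoord w k := by
    rw [← Finset.sum_add_distrib]
    refine Finset.sum_congr rfl fun k _ => ?_
    rw [hy, PiLp.add_apply]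
    ring
  have h3 : ∑ k, yCoord (v + w) k ^ 2 =
      ∑ k, yCoord v k ^ 2 + ∑ k, yCoord w k ^ 2 + 2 * ∑ k, yCoord v k * yCoord w k := by
    rw [Finset.mul_sum, ← Finset.sum_add_distrib, ← Finset.sum_add_distrib]
    refine Finset.sum_congr rfl fun k _ => ?_
    rw [hy, PiLp.add_apply]
    ring
  rw [h2, h3, hx, hz, map_add, map_add, add_apply, add_apply, hm.symm q hq w v,
    hc.metric_eq q hq v, hc.metric_eq q hq w] at h1
  linear_combination h1

lemma zVec_yIncl (hq : q ∈ e.target) (c : Euc n) :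
    2 * metricInChart h e q (zVec n) (yIncl n c) =
      ∑ k, a k (yCoord q) (zCoord q) * c k := by
  rw [hc.two_mul_apply hq]
  simp

/-- The metric in a flat Brinkmann chart. -/
lemma isFlatBrinkmannMetric : IsFlatBrinkmannMetric (metricInChart h e) e.target where
  toIsMetricOn := isMetricOn_metricInChart h hc.mem_atlas
  fderiv_stdVec_zero q hq u v := by
    have hm := isMetricOn_metricInChart h hc.mem_atlas
    have hline : HasDerivAt (fun t : ℝ => q + t • (stdVec 0 : Euc (n + 2))) (stdVec 0) 0 := by
      simpa using ((hasDerivAt_id (0 : ℝ)).smul_const (stdVec 0 : Euc (n + 2))).const_add q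
    have hev : ∀ᶠ t : ℝ in 𝓝 0, q + t • (stdVec 0 : Euc (n + 2)) ∈ e.target :=
      hline.continuousAt.eventually_mem (by simpa using hm.isOpen.mem_nhds hq)
    have hconst : (fun t : ℝ => metricInChart h e (q + t • stdVec 0) u v) =ᶠ[𝓝 0]
        fun _ => metricInChart h e q u v := by
      filter_upwards [hev] with t ht
      have h1 := hc.two_mul_apply ht u v
      have hy : yCoord (q + t • stdVec 0) = yCoord q := by simp [coord_add, coord_smul]
      have hz : zCoord (q + t • stdVec 0) = zCoord q := by simp [coord_add, coord_smul]
      rw [hy, hz, ← hc.two_mul_apply hq u v] at h1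
      linarith
    have h1 := ((hm.hasFDerivAt hq).clm_apply (hasFDerivAt_const u q)).clm_apply
      (hasFDerivAt_const v q)
    have h2 := HasFDerivAt.comp_hasDerivAt_of_eq (0 : ℝ) h1 hline (by simp)
    have h3 := h2.unique ((hasDerivAt_const (0 : ℝ) (metricInChart h e q u v)).congr_of_eventuallyEq
      hconst)
    simpa using h3
  stdVec_zero_left q hq v := by
    have h1 := hc.two_mul_apply hq (stdVec 0) v
    simp at h1
    exact h1
  yIncl_yIncl q hq b c := by
    have h1 := hc.two_mul_apply hq (yIncl n b) (yIncl n c)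
    simp at h1
    exact h1

/-- In a flat Brinkmann chart, Ricci-isotropy is the equation `d^*d φ = 0`. -/
lemma coclosedDifferential_iff : CoclosedDifferential e a ↔ ∀ q ∈ e.target, ∀ u v,
    metricInChart h e q (ricciEnd (metricInChart h e) q u) (ricciEnd (metricInChart h e) q v) =
      0 := by
  have hg := hc.isFlatBrinkmannMetric
  have hiff : ∀ q ∈ e.target, codifferential (extDeriv (oneForm fun k y => a k y (zCoord q)))
      (yCoord q) = 0 ↔ ∀ u v, metricInChart h e q (ricciEnd (metricInChart h e) q u)
        (ricciEnd (metricInChart h e) q v) = 0 := fun q hq =>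
    (hg.codifferential_extDeriv_oneForm_eq_zero_iff hq
      fun q hq c => hc.zVec_yIncl hq c).trans (hg.ricciIsotropic_iff hq).symm
  constructor
  · intro hco q hq
    exact (hiff q hq).1 (hco _ _ ⟨q, hq, rfl⟩)
  · rintro hric y z ⟨q, hq, hyz⟩
    obtain ⟨rfl, rfl⟩ := Prod.ext_iff.1 hyz
    exact (hiff q hq).2 (hric q hq)

end IsFlatBrinkmannChart

/-- An atlas of flat Brinkmann charts with `d^*d φ = 0` forces Ricci-isotropy. -/
theorem isRicciIsotropic_of_charts
    (H : ∀ p : M, ∃ e : OpenPartialHomeomorph M (Euc (n + 2)), p ∈ e.source ∧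
      ∃ (a : Fin n → Euc n → ℝ → ℝ) (f : Euc n → ℝ → ℝ),
        IsFlatBrinkmannChart h e a f ∧ CoclosedDifferential e a) : IsRicciIsotropic h := by
  intro e' he' q hq u v
  obtain ⟨e, hpe, a, f, hc, hco⟩ := H (e'.symm q)
  have hq' : q ∈ (e'.symm.trans e).source := by
    simpa only [OpenPartialHomeomorph.trans_source] using ⟨hq, hpe⟩
  -- The chart e' is arbitrary; the transition to the flat Brinkmann chart is a local isometry and
  -- preserves the scalar products h(Ric U, Ric V).
  have h1 := (isLocalIsometry_transition h hc.mem_atlas he').1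
  rw [h1.metric_ricciEnd_ricciEnd hq']
  exact hc.coclosedDifferential_iff.1 hco _ (h1.mapsTo hq') _ _

end FlatCharts

/-! ### Linear algebra of a null vector in a Lorentzian space -/

section LorentzAlgebra

variable {n : ℕ}

/-- A null vector of a Lorentzian scalar product can be completed to a basis adapted to the
form `2 dx dz + ∑ₖ dyₖ² + (…) dz²`. -/
lemma exists_adapted_basis {V : Type*} [NormedAddCommGroup V] [NormedSpace ℝ V]
    {B : V →L[ℝ] V →L[ℝ] ℝ} (hsymm : ∀ u v, B u v = B v u)
    (b : Module.Basis (Fin (n + 2)) ℝ V)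
    (hb : ∀ i j, B (b i) (b j) = if i = j then (if i = 0 then -1 else 1) else 0)
    {ξ : V} (hξ : ξ ≠ 0) (hnull : B ξ ξ = 0) :
    ∃ L : Euc (n + 2) ≃L[ℝ] V, L (stdVec 0) = ξ ∧ (∀ w, B ξ (L w) = zCoord w) ∧
      ∀ c d, B (L (yIncl n c)) (L (yIncl n d)) = ∑ k, c k * d k := by
  let σ : Euc (n + 1) →ₗ[ℝ] V :=
    { toFun := fun c => ∑ i, c i • b i.succ
      map_add' := fun c d => by simp [add_smul, Finset.sum_add_distrib]
      map_smul' := fun r c => by simp [mul_smul, Finset.smul_sum] }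
  have hσ : ∀ c, σ c = ∑ i, c i • b i.succ := fun c => rfl
  have hσ0 : ∀ c, B (b 0) (σ c) = 0 := fun c => by
    simp [hσ, map_sum, hb, (Fin.succ_ne_zero _).symm]
  have hσσ : ∀ c d, B (σ c) (σ d) = inner ℝ c d := fun c d => by
    rw [hσ, hσ]
    simp only [map_sum, sum_apply, map_smul, smul_apply, hb]
    simp [PiLp.inner_apply]
  -- Write ξ = t b₀ + σ s with s in the spacelike part. Nullity is |s|² = t², so ξ ≠ 0 forces both t
  -- and s to be nonzero.
  set t : ℝ := b.repr ξ 0 with ht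
  set s : Euc (n + 1) := WithLp.toLp 2 fun i => b.repr ξ i.succ with hs
  have hdec : ξ = t • b 0 + σ s := by
    conv_lhs => rw [← b.sum_repr ξ, Fin.sum_univ_succ]
    rfl
  have h00 : B (b 0) (b 0) = -1 := by simp [hb]
  have hnorm : inner ℝ s s = t * t := by
    have h1 := hnull
    rw [hdec] at h1
    simp only [map_add, map_smul, add_apply, smul_apply, h00, hσ0, hσσ,
      hsymm (σ s) (b 0), smul_eq_mul] at h1
    linarith
  have ht0 : t ≠ 0 := by
    intro h0
    rw [h0, mul_zero, inner_self_eq_zero] at hnorm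
    rw [h0, hnorm] at hdec
    exact hξ (by simpa using hdec)
  have hs0 : s ≠ 0 := by
    intro h0
    rw [h0, inner_zero_left] at hnorm
    exact ht0 (by simpa using hnorm.symm)
  have : Fact (Module.finrank ℝ (Euc (n + 1)) = n + 1) := ⟨by simp⟩
  -- The hyperplane orthogonal to s in ℝⁿ⁺¹ supplies n orthonormal spacelike vectors orthogonal to
  -- ξ.
  let o := OrthonormalBasis.fromOrthogonalSpanSingleton (𝕜 := ℝ) n hs0
  let y : Fin n → Euc (n + 1) := fun k => (o k : Euc (n + 1))
  have hyy : ∀ j k, inner ℝ (y j) (y k) = if j = k then (1 : ℝ) else 0 := fun j k => by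
    have := orthonormal_iff_ite.1 o.orthonormal j k
    exact this
  have hsy : ∀ k, inner ℝ s (y k) = (0 : ℝ) := fun k =>
    Submodule.mem_orthogonal_singleton_iff_inner_right.1 (o k).2
  have hξσ : ∀ k, B ξ (σ (y k)) = 0 := fun k => by
    rw [hdec]
    simp [hσ0, hσσ, hsy]
  -- Normalised so that B(ξ, W) = 1, given B(b₀, b₀) = -1. No condition on B(W, W) is imposed, since
  -- the coefficient of dz² is free.
  let W : V := (-t⁻¹) • b 0
  have hξW : B ξ W = 1 := by
    rw [hdec]
    simp only [W, map_add, map_smul, add_apply, smul_apply, h00, hsymm (σ s) (b 0), hσ0,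
      smul_eq_mul]
    field_simp
    ring
  let τ : Euc n → V := fun c => ∑ k, c k • σ (y k)
  let L₀ : Euc (n + 2) →ₗ[ℝ] V :=
    { toFun := fun v => xCoord v • ξ + τ (yCoord v) + zCoord v • W
      map_add' := fun v w => by
        obtain ⟨h1, h2, h3⟩ := coord_add v w
        rw [h1, h2, h3]
        simp only [τ, PiLp.add_apply, add_smul, Finset.sum_add_distrib]
        abel
      map_smul' := fun c v => by
        obtain ⟨h1, h2, h3⟩ := coord_smul c v
        rw [h1, h2, h3]
        simp only [τ, PiLp.smul_apply, smul_eq_mul, mul_smul, ← Finset.smul_sum, smul_add,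
          RingHom.id_apply] }
  have hL₀ : ∀ v, L₀ v = xCoord v • ξ + τ (yCoord v) + zCoord v • W := fun v => rfl
  have hξτ : ∀ c, B ξ (τ c) = 0 := fun c => by simp [τ, map_sum, hξσ]
  have hττ : ∀ c d, B (τ c) (τ d) = ∑ k, c k * d k := fun c d => by
    simp only [τ, map_sum, sum_apply, map_smul, smul_apply, hσσ, hyy]
    simp [mul_comm]
  have hξL : ∀ w, B ξ (L₀ w) = zCoord w := fun w => by
    simp [hL₀, hnull, hξτ, hξW]
  -- Pairing with ξ detects z, pairing with the spacelike vectors then detects y, and ξ ≠ 0 detects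
  -- x.
  have hinj : Function.Injective L₀ := by
    rw [← LinearMap.ker_eq_bot, LinearMap.ker_eq_bot']
    intro v hv
    have hz : zCoord v = 0 := by rw [← hξL, hv, map_zero]
    have hy : yCoord v = 0 := by
      ext k
      have h1 : B (τ (stdVec k)) (L₀ v) = 0 := by rw [hv, map_zero]
      rw [hL₀, map_add, map_add, map_smul, hsymm _ ξ, hξτ, hττ, hz] at h1
      simpa [stdVec] using h1
    have hx : xCoord v = 0 := by
      have h1 : L₀ v = xCoord v • ξ := by simp [hL₀, hy, hz, τ]
      rw [hv] at h1
      exact (smul_eq_zero.1 h1.symm).resolve_right hξ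
    refine eq_of_coords (hx.trans ?_) (hy.trans ?_) (hz.trans ?_)
    exacts [rfl, (map_zero (yProj n)).symm, rfl]
  have : FiniteDimensional ℝ V := b.finiteDimensional_of_finite
  have hdim : Module.finrank ℝ (Euc (n + 2)) = Module.finrank ℝ V := by
    rw [Module.finrank_eq_card_basis b]
    simp
  have hLτ : ∀ c, L₀ (yIncl n c) = τ c := fun c => by simp [hL₀]
  refine ⟨(LinearEquiv.ofInjectiveOfFinrankEq L₀ hinj hdim).toContinuousLinearEquiv, ?_, hξL, ?_⟩
  · change L₀ (stdVec 0) = ξ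
    simp [hL₀, τ]
  · intro c d
    change B (L₀ (yIncl n c)) (L₀ (yIncl n d)) = _
    rw [hLτ, hLτ, hττ]

end LorentzAlgebra

/-! ### Composition of charts with local diffeomorphisms -/

section ChangeOfCharts

variable {n : ℕ} {M : Type*} [TopologicalSpace M] [ChartedSpace (Euc (n + 2)) M]
  {e : OpenPartialHomeomorph M (Euc (n + 2))}
  {Ψ : OpenPartialHomeomorph (Euc (n + 2)) (Euc (n + 2))} {q : Euc (n + 2)}

lemma mem_contDiffGroupoid_of_contDiffOn (h1 : ContDiffOn ℝ ∞ Ψ Ψ.source)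
    (h2 : ContDiffOn ℝ ∞ Ψ.symm Ψ.target) : Ψ ∈ contDiffGroupoid ∞ (𝓡 (n + 2)) := by
  rw [contDiffGroupoid, mem_groupoid_of_pregroupoid]
  refine ⟨?_, ?_⟩
  · change ContDiffOn ℝ ∞ _ _
    simpa using h1
  · change ContDiffOn ℝ ∞ _ _
    simpa using h2

variable [IsManifold (𝓡 (n + 2)) ∞ M]

lemma trans_mem_maximalAtlas (he : e ∈ IsManifold.maximalAtlas (𝓡 (n + 2)) ∞ M)
    (h1 : ContDiffOn ℝ ∞ Ψ Ψ.source) (h2 : ContDiffOn ℝ ∞ Ψ.symm Ψ.target) :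
    e.trans Ψ ∈ IsManifold.maximalAtlas (𝓡 (n + 2)) ∞ M := by
  have hΨ := mem_contDiffGroupoid_of_contDiffOn h1 h2
  rw [IsManifold.mem_maximalAtlas_iff, mem_maximalAtlas_iff]
  intro e' he'
  have he'' := IsManifold.subset_maximalAtlas (I := 𝓡 (n + 2)) (n := ∞) he'
  constructor
  · rw [OpenPartialHomeomorph.trans_symm_eq_symm_trans_symm, OpenPartialHomeomorph.trans_assoc]
    exact (contDiffGroupoid ∞ (𝓡 (n + 2))).trans
      ((contDiffGroupoid ∞ (𝓡 (n + 2))).symm hΨ) (IsManifold.compatible_of_mem_maximalAtlas he he'')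
  · rw [← OpenPartialHomeomorph.trans_assoc]
    exact (contDiffGroupoid ∞ (𝓡 (n + 2))).trans
      (IsManifold.compatible_of_mem_maximalAtlas he'' he) hΨ

/-- The components of the metric and of a vector field in a new chart `Ψ ∘ e`. -/
lemma trans_chart (h : LorentzianMetric n M) (X : ∀ p : M, TangentSpace (𝓡 (n + 2)) p)
    (he : e ∈ IsManifold.maximalAtlas (𝓡 (n + 2)) ∞ M)
    (h1 : ContDiffOn ℝ ∞ Ψ Ψ.source) (h2 : ContDiffOn ℝ ∞ Ψ.symm Ψ.target)
    (hq : q ∈ e.target) (hqΨ : q ∈ Ψ.source) :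
    (fderiv ℝ Ψ q).IsInvertible ∧
    (∀ u v, metricInChart h e q u v =
      metricInChart h (e.trans Ψ) (Ψ q) (fderiv ℝ Ψ q u) (fderiv ℝ Ψ q v)) ∧
    fieldInChart X (e.trans Ψ) (Ψ q) = fderiv ℝ Ψ q (fieldInChart X e q) := by
  have he' := trans_mem_maximalAtlas he h1 h2
  obtain ⟨h3, h4⟩ := isLocalIsometry_transition h he' he
  have hqs : q ∈ (e.symm.trans (e.trans Ψ)).source := by
    simp only [OpenPartialHomeomorph.trans_source]
    refine ⟨hq, ?_⟩
    simp [e.right_inv hq, e.map_target hq, hqΨ]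
  have hev : ⇑(e.symm.trans (e.trans Ψ)) =ᶠ[𝓝 q] Ψ := by
    filter_upwards [e.open_target.mem_nhds hq] with x hx
    simp [e.right_inv hx]
  have hd : fderiv ℝ (e.symm.trans (e.trans Ψ)) q = fderiv ℝ Ψ q := hev.fderiv_eq
  have hval : (e.symm.trans (e.trans Ψ)) q = Ψ q := hev.self_of_nhds
  refine ⟨hd ▸ h3.isInvertible q hqs, fun u v => ?_, ?_⟩
  · rw [h3.apply_eq q hqs, hd, hval]
  · rw [← hd, h4 q hqs, mfderiv_symm_fieldInChart X he hq]
    have h5 : (e.trans Ψ).symm (Ψ q) = e.symm q := by simp [Ψ.left_inv hqΨ]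
    rw [fieldInChart, h5]

/-- New coordinates, restricted to a ball. -/
lemma exists_chart_on_ball (h : LorentzianMetric n M) (X : ∀ p : M, TangentSpace (𝓡 (n + 2)) p)
    (he : e ∈ IsManifold.maximalAtlas (𝓡 (n + 2)) ∞ M)
    (h1 : ContDiffOn ℝ ∞ Ψ Ψ.source) (h2 : ContDiffOn ℝ ∞ Ψ.symm Ψ.target)
    (hq : q ∈ e.target) (hqΨ : q ∈ Ψ.source) :
    ∃ e' ∈ IsManifold.maximalAtlas (𝓡 (n + 2)) ∞ M, ∃ r > 0, e'.target = Metric.ball (Ψ q) r ∧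
      e.symm q ∈ e'.source ∧ e' (e.symm q) = Ψ q ∧
      ∀ q' ∈ e'.target, ∃ x ∈ e.target ∩ Ψ.source, Ψ x = q' ∧ (fderiv ℝ Ψ x).IsInvertible ∧
        (∀ u v, metricInChart h e x u v =
          metricInChart h e' q' (fderiv ℝ Ψ x u) (fderiv ℝ Ψ x v)) ∧
        fieldInChart X e' q' = fderiv ℝ Ψ x (fieldInChart X e x) := by
  have he1 := trans_mem_maximalAtlas he h1 h2
  have hmem : Ψ q ∈ (e.trans Ψ).target := by
    simp [Ψ.map_source hqΨ, Ψ.left_inv hqΨ, hq]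
  -- Balls are used for their convexity: closed forms have potentials there, and invariance of the
  -- metric under ∂/∂x integrates along segments.
  obtain ⟨r, hr, hball⟩ := Metric.isOpen_iff.1 (e.trans Ψ).open_target _ hmem
  let ρ : OpenPartialHomeomorph (Euc (n + 2)) (Euc (n + 2)) :=
    OpenPartialHomeomorph.ofSet (Metric.ball (Ψ q) r) Metric.isOpen_ball
  have hρ1 : ContDiffOn ℝ ∞ ρ ρ.source := contDiff_id.contDiffOn
  have hρ2 : ContDiffOn ℝ ∞ ρ.symm ρ.target := contDiff_id.contDiffOn
  have htarget : ((e.trans Ψ).trans ρ).target = Metric.ball (Ψ q) r := by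
    rw [OpenPartialHomeomorph.trans_target]
    exact Set.inter_eq_left.2 fun x hx => hball hx
  refine ⟨(e.trans Ψ).trans ρ, trans_mem_maximalAtlas he1 hρ1 hρ2, r, hr, htarget, ?_, ?_, ?_⟩
  · simp [e.right_inv hq, e.map_target hq, hqΨ, ρ, hr]
  · simp [e.right_inv hq, ρ]
  · intro q' hq'
    rw [htarget] at hq'
    have hq1 := hball hq'
    rw [OpenPartialHomeomorph.trans_target] at hq1
    have hx : Ψ (Ψ.symm q') = q' := Ψ.right_inv hq1.1
    obtain ⟨h3, h4, h5⟩ := trans_chart h X he h1 h2 hq1.2 (Ψ.map_target hq1.1)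
    obtain ⟨-, h6, h7⟩ := trans_chart h X he1 hρ1 hρ2 (hball hq') (Ψ := ρ) hq'
    have hρd : fderiv ℝ ρ q' = ContinuousLinearMap.id ℝ _ := fderiv_id
    have hρq : ρ q' = q' := rfl
    rw [hx] at h4 h5
    rw [hρd, hρq] at h6 h7
    refine ⟨Ψ.symm q', ⟨hq1.2, Ψ.map_target hq1.1⟩, hx, h3, fun u v => ?_, ?_⟩
    · rw [h4, h6]
      rfl
    · rw [h7, h5]
      rfl

/-- A Lorentzian basis in a chart. -/
lemma exists_lorentzian_basis (h : LorentzianMetric n M)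
    (he : e ∈ IsManifold.maximalAtlas (𝓡 (n + 2)) ∞ M) (hq : q ∈ e.target) :
    ∃ b : Module.Basis (Fin (n + 2)) ℝ (Euc (n + 2)), ∀ i j, metricInChart h e q (b i) (b j) =
      if i = j then (if i = 0 then -1 else 1) else 0 := by
  obtain ⟨b, hb⟩ := h.signature (e.symm q)
  let A := (mdifferentiable_of_mem_maximalAtlas he).symm.mfderiv hq
  refine ⟨b.map A.symm.toLinearEquiv, fun i j => ?_⟩
  rw [← hb i j]
  have h1 : ∀ i, mfderiv (𝓡 (n + 2)) (𝓡 (n + 2)) e.symm q (b.map A.symm.toLinearEquiv i) = b i :=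
    fun i => A.apply_symm_apply (b i)
  exact congrArg₂ (fun v w => h.inner (e.symm q) v w) (h1 i) (h1 j)

end ChangeOfCharts

/-! ### Charts adapted to X and Walker coordinates -/

section AdaptedCharts

variable {n : ℕ} {M : Type*} [TopologicalSpace M] [ChartedSpace (Euc (n + 2)) M]
  [IsManifold (𝓡 (n + 2)) ∞ M] {h : LorentzianMetric n M}
  {X : ∀ p : M, TangentSpace (𝓡 (n + 2)) p}
  {e : OpenPartialHomeomorph M (Euc (n + 2))} {q : Euc (n + 2)}

/-- A chart adapted to a nowhere vanishing vector field. -/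
lemma exists_isAdaptedChart (h : LorentzianMetric n M)
    (hX : ContMDiff (𝓡 (n + 2)) (𝓡 (n + 2)).tangent ∞
      (fun p => (⟨p, X p⟩ : TangentBundle (𝓡 (n + 2)) M)))
    (hne : ∀ p, X p ≠ 0) (p : M) :
    ∃ e ∈ IsManifold.maximalAtlas (𝓡 (n + 2)) ∞ M, ∃ r > 0, e.target = Metric.ball 0 r ∧
      p ∈ e.source ∧ e p = 0 ∧ IsAdaptedChart X e := by
  let e₁ := chartAt (Euc (n + 2)) p
  have he₁ : e₁ ∈ IsManifold.maximalAtlas (𝓡 (n + 2)) ∞ M := IsManifold.chart_mem_maximalAtlas p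
  have hp : p ∈ e₁.source := mem_chart_source _ p
  have hq := e₁.map_source hp
  have hne' : fieldInChart X e₁ (e₁ p) ≠ 0 := by
    intro h0
    have h1 := mfderiv_symm_fieldInChart X he₁ hq
    rw [h0] at h1
    exact hne _ (h1.symm.trans (map_zero _))
  have hne₀ : (stdVec 0 : Euc (n + 2)) ≠ 0 := fun h0 => by
    have := xCoord_stdVec_zero (n := n)
    rw [h0] at this
    exact zero_ne_one this
  obtain ⟨L, hL⟩ := SeparatingDual.exists_continuousLinearEquiv_apply_eq (R := ℝ) hne₀ hne'
  obtain ⟨Ψ, hpΨ, hΨ0, hΨU, hΨ1, hΨ2, hΨX⟩ := exists_straightening e₁.open_target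
    (contDiffOn_fieldInChart hX he₁) hq
      (ℓ := xProj n) (e₀ := stdVec 0) (by rw [xProj_apply, xCoord_stdVec_zero]) L hL
  obtain ⟨e, he, r, hr, htarget, hsource, hep, hchart⟩ :=
    exists_chart_on_ball h X he₁ hΨ1 hΨ2 hq hpΨ
  rw [e₁.left_inv hp] at hsource hep
  refine ⟨e, he, r, hr, by rw [htarget, hΨ0], hsource, by rw [hep, hΨ0], fun q' hq' => ?_⟩
  obtain ⟨x, hx, -, -, -, hf⟩ := hchart q' hq'
  rw [hf, hΨX x hx.2]

/-- In an adapted chart X is a constant field, so ∇X = 0 leaves only the term with Γ. -/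
lemma IsParallel.christoffel_stdVec_zero (hpar : IsParallel h X)
    (he : e ∈ IsManifold.maximalAtlas (𝓡 (n + 2)) ∞ M) (hX : IsAdaptedChart X e)
    (hq : q ∈ e.target) (u : Euc (n + 2)) : christoffel (metricInChart h e) q u (stdVec 0) = 0 := by
  have h1 := hpar e he q hq u
  have h2 : fieldInChart X e =ᶠ[𝓝 q] fun _ => stdVec 0 := by
    filter_upwards [e.open_target.mem_nhds hq] with x hx using hX x hx
  rw [covDeriv, h2.fderiv_eq, hX q hq] at h1
  simpa using h1

/-- A parallel field is Killing: by metric compatibility the derivative along ∂/∂x is a sum of terms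
Γ(∂/∂x, ·) = 0. -/
lemma IsParallel.fderiv_stdVec_zero (hpar : IsParallel h X)
    (he : e ∈ IsManifold.maximalAtlas (𝓡 (n + 2)) ∞ M) (hX : IsAdaptedChart X e)
    (hq : q ∈ e.target) (u v : Euc (n + 2)) :
    fderiv ℝ (metricInChart h e) q (stdVec 0) u v = 0 := by
  have hm := isMetricOn_metricInChart h he
  rw [hm.fderiv_eq hq, hm.christoffel_symm hq (stdVec 0) u, hm.christoffel_symm hq (stdVec 0) v,
    hpar.christoffel_stdVec_zero he hX hq, hpar.christoffel_stdVec_zero he hX hq]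
  simp

/-- The one-form dual to a parallel field is closed. -/
lemma IsParallel.fderiv_apply_stdVec_zero_symm (hpar : IsParallel h X)
    (he : e ∈ IsManifold.maximalAtlas (𝓡 (n + 2)) ∞ M) (hX : IsAdaptedChart X e)
    (hq : q ∈ e.target) (u v : Euc (n + 2)) :
    fderiv ℝ (metricInChart h e) q u (stdVec 0) v =
      fderiv ℝ (metricInChart h e) q v (stdVec 0) u := by
  have hm := isMetricOn_metricInChart h he
  rw [hm.fderiv_eq hq, hm.fderiv_eq hq, hpar.christoffel_stdVec_zero he hX hq,
    hpar.christoffel_stdVec_zero he hX hq, hm.christoffel_symm hq u v]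
  simp

lemma IsBrinkmannWave.apply_fieldInChart_fieldInChart (hX : IsBrinkmannWave h X)
    (he : e ∈ IsManifold.maximalAtlas (𝓡 (n + 2)) ∞ M) (hq : q ∈ e.target) :
    metricInChart h e q (fieldInChart X e q) (fieldInChart X e q) = 0 := by
  have h1 := mfderiv_symm_fieldInChart X he hq
  exact (congrArg₂ (fun v w => h.inner (e.symm q) v w) h1 h1).trans (hX.null _)

/-- Walker coordinates for a parallel null vector field. -/
lemma exists_isWalkerMetric (hX : IsBrinkmannWave h X) (p : M) :
    ∃ e ∈ IsManifold.maximalAtlas (𝓡 (n + 2)) ∞ M, ∃ r > 0, e.target = Metric.ball 0 r ∧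
      p ∈ e.source ∧ e p = 0 ∧ IsAdaptedChart X e ∧
      IsWalkerMetric (metricInChart h e) e.target ∧
      ∀ c d, metricInChart h e 0 (yIncl n c) (yIncl n d) = ∑ k, c k * d k := by
  obtain ⟨e₁, he₁, r₁, hr₁, htarget₁, hp, hep, hX₁⟩ := exists_isAdaptedChart h hX.smooth hX.ne_zero p
  set g := metricInChart h e₁ with hgdef
  have hg : IsMetricOn g e₁.target := isMetricOn_metricInChart h he₁
  have h0 : (0 : Euc (n + 2)) ∈ e₁.target := hep ▸ e₁.map_source hp
  have hnull : ∀ q ∈ e₁.target, g q (stdVec 0) (stdVec 0) = 0 := fun q hq => by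
    have := hX.apply_fieldInChart_fieldInChart he₁ hq
    rwa [hX₁ q hq] at this
  have hne₀ : (stdVec 0 : Euc (n + 2)) ≠ 0 := fun h0 => by
    have := xCoord_stdVec_zero (n := n)
    rw [h0] at this
    exact zero_ne_one this
  obtain ⟨b, hb⟩ := exists_lorentzian_basis h he₁ h0
  obtain ⟨L, hL0, hLz, hLy⟩ := exists_adapted_basis (hg.symm 0 h0) b hb hne₀ (hnull 0 h0)
  have hα : ContDiffOn ℝ ∞ (fun q => g q (stdVec 0)) (Metric.ball 0 r₁) := by
    rw [← htarget₁]
    exact hg.contDiffOn.clm_apply contDiffOn_const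
  have hαd : ∀ q ∈ e₁.target, ∀ u v, fderiv ℝ (fun q => g q (stdVec 0)) q u v =
      fderiv ℝ g q u (stdVec 0) v := fun q hq u v => by
    have h1 := (hg.hasFDerivAt hq).clm_apply (hasFDerivAt_const (stdVec 0) q)
    rw [h1.fderiv]
    simp
  obtain ⟨z, hz0, hzs, hzd⟩ := exists_potential hα fun q hq u v => by
    rw [← htarget₁] at hq
    rw [hαd q hq, hαd q hq]
    exact hX.parallel.fderiv_apply_stdVec_zero_symm he₁ hX₁ hq u v
  rw [← htarget₁] at hzs hzd
  -- In the linear coordinates L⁻¹ the z-coordinate is the functional g₀(∂/∂x, ·); ψ replaces it by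
  -- the potential z and keeps x and y. The correction has zero derivative at the origin, so Dψ(0) =
  -- L⁻¹.
  let ψ : Euc (n + 2) → Euc (n + 2) := fun q => L.symm q + (z q - g 0 (stdVec 0) q) • zVec n
  have hψs : ContDiffOn ℝ ∞ ψ e₁.target :=
    L.symm.contDiff.contDiffOn.add
      ((hzs.sub (g 0 (stdVec 0)).contDiff.contDiffOn).smul contDiffOn_const)
  have hψd : ∀ q ∈ e₁.target, HasFDerivAt ψ ((L.symm : Euc (n + 2) →L[ℝ] Euc (n + 2)) +
      (g q (stdVec 0) - g 0 (stdVec 0)).smulRight (zVec n)) q := fun q hq =>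
    L.symm.hasFDerivAt.add
      (((hzd q hq).sub (g 0 (stdVec 0)).hasFDerivAt).smul_const (zVec n))
  have hψ0 : HasFDerivAt ψ (L.symm : Euc (n + 2) →L[ℝ] Euc (n + 2)) 0 := by
    have := hψd 0 h0
    rwa [sub_self, ContinuousLinearMap.zero_smulRight, add_zero] at this
  have hψd' : ∀ q ∈ e₁.target, ∀ v, fderiv ℝ ψ q v =
      L.symm v + (g q (stdVec 0) v - g 0 (stdVec 0) v) • zVec n := fun q hq v => by
    rw [(hψd q hq).fderiv]
    rfl
  have hψz : ∀ q ∈ e₁.target, ∀ v, zCoord (fderiv ℝ ψ q v) = g q (stdVec 0) v := fun q hq v => by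
    rw [hψd' q hq, (coord_add _ _).2.2, (coord_smul _ _).2.2, zCoord_zVec, ← hLz,
      L.apply_symm_apply]
    ring
  -- The direction ∂/∂x survives the change because ∂/∂x is null everywhere, so z does not vary
  -- along it.
  have hψe : ∀ q ∈ e₁.target, fderiv ℝ ψ q (stdVec 0) = stdVec 0 := fun q hq => by
    have h1 : L.symm (stdVec 0) = stdVec 0 := by rw [L.symm_apply_eq, hL0]
    rw [hψd' q hq, h1, hnull q hq, hnull 0 h0, sub_self, zero_smul, add_zero]
  obtain ⟨Ψ, hΨ, h0Ψ, hΨU, hΨs, hΨi⟩ :=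
    exists_openPartialHomeomorph_of_contDiffOn e₁.open_target hψs h0 hψ0
  have hψ00 : Ψ 0 = 0 := by
    rw [hΨ]
    simp [ψ, hz0]
  obtain ⟨e, he, r, hr, htarget, hsource, hep', hchart⟩ :=
    exists_chart_on_ball h X he₁ (hΨ ▸ hψs.mono hΨU) hΨs h0 h0Ψ
  have hp0 : e₁.symm 0 = p := by rw [← hep, e₁.left_inv hp]
  rw [hp0] at hsource hep'
  rw [hψ00] at htarget hep'
  rw [hΨ] at hchart
  have hXe : IsAdaptedChart X e := fun q' hq' => by
    obtain ⟨x, hx, -, -, -, hf⟩ := hchart q' hq'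
    rw [hf, hX₁ x hx.1, hψe x hx.1]
  refine ⟨e, he, r, hr, htarget, hsource, hep', hXe,
    ⟨isMetricOn_metricInChart h he, fun q hq u v => hX.parallel.fderiv_stdVec_zero he hXe hq u v,
      fun q' hq' v => ?_⟩, fun c d => ?_⟩
  · obtain ⟨x, hx, -, hinv, hm, -⟩ := hchart q' hq'
    have h1 := hm (stdVec 0) ((fderiv ℝ ψ x).inverse v)
    rw [hinv.self_apply_inverse, hψe x hx.1] at h1
    rw [← h1, ← hψz x hx.1, hinv.self_apply_inverse]
  · have h0e : (0 : Euc (n + 2)) ∈ e.target := hep' ▸ e.map_source hsource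
    obtain ⟨x, hx, hx0, -, hm, -⟩ := hchart 0 h0e
    have hx00 : x = 0 := Ψ.injOn hx.2 h0Ψ (by rw [hψ00, hΨ, hx0])
    subst hx00
    have h1 := hm (L (yIncl n c)) (L (yIncl n d))
    rw [hψ0.fderiv] at h1
    simp only [ContinuousLinearEquiv.coe_coe, ContinuousLinearEquiv.symm_apply_apply] at h1
    rw [← h1]
    exact hLy c d

end AdaptedCharts

/-! ### Flat coordinates on the leaves of Ξ^⊥ -/

section Slice

variable {n : ℕ} {g : Euc (n + 2) → Euc (n + 2) →L[ℝ] Euc (n + 2) →L[ℝ] ℝ}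
  {O : Set (Euc (n + 2))}

/-- The inclusion `(y, z) ↦ (0, y, z)`. -/
def slice (n : ℕ) : Euc n × ℝ →L[ℝ] Euc (n + 2) :=
  (yIncl n).coprod (ContinuousLinearMap.toSpanSingleton ℝ (zVec n))

lemma slice_apply (w : Euc n × ℝ) : slice n w = yIncl n w.1 + w.2 • zVec n := by
  simp [slice]

@[simp] lemma slice_fst_zero (a : Euc n) : slice n (a, 0) = yIncl n a := by
  simp [slice_apply]

lemma slice_add_smul (q : Euc (n + 2)) :
    slice n (yCoord q, zCoord q) + xCoord q • stdVec 0 = q := by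
  conv_rhs => rw [coord_decomp q]
  rw [slice_apply]
  abel

/-- Balls about the origin are stable under setting x = 0, so every point of such a domain can be
moved along ∂/∂x to the slice. -/
lemma norm_slice_le (q : Euc (n + 2)) : ‖slice n (yCoord q, zCoord q)‖ ≤ ‖q‖ := by
  rw [EuclideanSpace.norm_eq, EuclideanSpace.norm_eq]
  refine Real.sqrt_le_sqrt (Finset.sum_le_sum fun i _ => ?_)
  have h1 : slice n (yCoord q, zCoord q) = q - xCoord q • stdVec 0 :=
    eq_sub_of_add_eq (slice_add_smul q)
  rw [h1]
  by_cases hi : i = 0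
  · subst hi
    simpa [xCoord, stdVec] using sq_nonneg (q 0)
  · simp [stdVec, hi]

namespace IsWalkerMetric

/-- Flat coordinates on the leaves of `∂/∂x^⊥`, when the induced connections are flat. -/
lemma exists_flat_leaf_coordinates (hg : IsWalkerMetric g O) (h0 : (0 : Euc (n + 2)) ∈ O)
    (hcurv : ∀ q ∈ O, ∀ a b c,
      yCoord (curvature g q (yIncl n a) (yIncl n b) (yIncl n c)) = 0)
    (hbase : ∀ c d, g 0 (yIncl n c) (yIncl n d) = ∑ k, c k * d k) :
    ∃ W : Set (Euc n × ℝ), IsOpen W ∧ (0, 0) ∈ W ∧ (∀ w ∈ W, slice n w ∈ O) ∧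
      ∃ F : Euc n × ℝ → Euc n, ContDiffOn ℝ ∞ F W ∧ F (0, 0) = 0 ∧
        (∀ a, fderiv ℝ F (0, 0) (a, 0) = a) ∧
        ∀ w ∈ W, ∀ a b, ∑ k, fderiv ℝ F w (a, 0) k * fderiv ℝ F w (b, 0) k =
          g (slice n w) (yIncl n a) (yIncl n b) := by
  have hOs : IsOpen (slice n ⁻¹' O) := hg.isOpen.preimage (slice n).continuous
  have hmaps : Set.MapsTo (slice n) (slice n ⁻¹' O) O := fun _ hw => hw
  have h0s : ((0, 0) : Euc n × ℝ) ∈ slice n ⁻¹' O := by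
    have : slice n (0, 0) = 0 := map_zero (slice n)
    rw [Set.mem_preimage, this]
    exact h0
  have hgs : ContDiffOn ℝ ∞ (fun w => g (slice n w)) (slice n ⁻¹' O) :=
    hg.contDiffOn.comp (slice n).contDiff.contDiffOn hmaps
  have hΓs : ContDiffOn ℝ ∞ (fun w => christoffelCLM g (slice n w)) (slice n ⁻¹' O) :=
    hg.contDiffOn_christoffelCLM.comp (slice n).contDiff.contDiffOn hmaps
  let H : Euc n × ℝ → Euc n →L[ℝ] Euc n →L[ℝ] ℝ := fun w =>
    (g (slice n w)).bilinearComp (yIncl n) (yIncl n)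
  have hHa : ∀ w a b, H w a b = g (slice n w) (yIncl n a) (yIncl n b) := fun w a b => rfl
  -- The y-part of Γ is the connection induced on Ξ^⊥/Ξ along the slice x = 0. It includes the
  -- direction ∂/∂z, needed to carry a frame from leaf to leaf.
  let γ : Euc n × ℝ → (Euc n × ℝ) →L[ℝ] Euc n →L[ℝ] Euc n := fun w =>
    (ContinuousLinearMap.compL ℝ (Euc n) (Euc (n + 2)) (Euc n) (yProj n)).comp
      ((christoffelCLM g (slice n w)).bilinearComp (slice n) (yIncl n))
  have hγa : ∀ w u b, γ w u b = yCoord (christoffel g (slice n w) (slice n u) (yIncl n b)) :=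
    fun w u b => rfl
  have hH : ContDiffOn ℝ ∞ H (slice n ⁻¹' O) := by
    refine contDiffOn_clm_apply.2 fun a => contDiffOn_clm_apply.2 fun b => ?_
    exact (hgs.clm_apply contDiffOn_const).clm_apply contDiffOn_const
  have hγ : ContDiffOn ℝ ∞ γ (slice n ⁻¹' O) := by
    refine contDiffOn_clm_apply.2 fun u => contDiffOn_clm_apply.2 fun b => ?_
    exact (yProj n).contDiff.comp_contDiffOn
      ((hΓs.clm_apply contDiffOn_const).clm_apply contDiffOn_const)
  -- Dropping the ∂/∂x-part of an argument is harmless because Γ(·, ∂/∂x) = 0; hence composing γ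
  -- with itself gives the y-part of ΓΓ, and the y-part of R is the curvature of γ.
  have hsplit : ∀ q ∈ O, ∀ u v : Euc (n + 2), zCoord v = 0 →
      christoffel g q u v = christoffel g q u (yIncl n (yCoord v)) := by
    intro q hq u v hv
    conv_lhs => rw [coord_decomp v, hv, zero_smul, add_zero, ← christoffelCLM_apply, map_add,
      map_smul, christoffelCLM_apply, christoffelCLM_apply, hg.christoffel_stdVec_zero hq]
    simp
  have hHd : ∀ w ∈ slice n ⁻¹' O, ∀ u b c, fderiv ℝ H w u b c =
      fderiv ℝ g (slice n w) (slice n u) (yIncl n b) (yIncl n c) := by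
    intro w hw u b c
    have h1 : HasFDerivAt (fun w => H w b c) _ w :=
      ((((hH.contDiffAt (hOs.mem_nhds hw)).differentiableAt (by simp)).hasFDerivAt).clm_apply
        (hasFDerivAt_const b w)).clm_apply (hasFDerivAt_const c w)
    have h2 : HasFDerivAt (fun w => g (slice n w) (yIncl n b) (yIncl n c)) _ w :=
      ((((hg.hasFDerivAt hw).clm_apply (hasFDerivAt_const (yIncl n b) _)).clm_apply
        (hasFDerivAt_const (yIncl n c) _)).comp w (slice n).hasFDerivAt)
    have h4 := DFunLike.congr_fun (h1.unique h2) u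
    simpa using h4
  have hγd : ∀ w ∈ slice n ⁻¹' O, ∀ u v b, fderiv ℝ γ w u v b =
      yCoord (fderiv ℝ (christoffelCLM g) (slice n w) (slice n u) (slice n v) (yIncl n b)) := by
    intro w hw u v b
    have h1 : HasFDerivAt (fun w => γ w v b) _ w :=
      ((((hγ.contDiffAt (hOs.mem_nhds hw)).differentiableAt (by simp)).hasFDerivAt).clm_apply
        (hasFDerivAt_const v w)).clm_apply (hasFDerivAt_const b w)
    have h2 : HasFDerivAt (fun w => yProj n (christoffelCLM g (slice n w) (slice n v) (yIncl n b)))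
        _ w :=
      (yProj n).hasFDerivAt.comp w ((((hg.hasFDerivAt_christoffelCLM hw).clm_apply
        (hasFDerivAt_const (slice n v) _)).clm_apply
        (hasFDerivAt_const (yIncl n b) _)).comp w (slice n).hasFDerivAt)
    have h4 := DFunLike.congr_fun (h1.unique h2) u
    simpa [yProj_apply] using h4
  obtain ⟨W, hW, h0W, hWO, F, hF, hF0, hFd, hFH⟩ := exists_flat_coordinates hOs h0s hH hγ
    (fun w hw a b => by
      rw [hγa, hγa, slice_fst_zero, slice_fst_zero, hg.christoffel_symm hw])
    (fun w hw a b c => by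
      have hR := hcurv _ hw a b c
      rw [hg.curvature_eq hw, ← yProj_apply, map_sub, map_add, map_add, sub_eq_zero] at hR
      rw [hγd w hw, hγd w hw, hγa, hγa, hγa, hγa]
      simp only [slice_fst_zero]
      rw [← hsplit _ hw _ _ (hg.zCoord_christoffel hw _ _),
        ← hsplit _ hw _ _ (hg.zCoord_christoffel hw _ _)]
      exact hR)
    (fun w hw u b c => by
      rw [hHd w hw, hHa, hHa, hγa, hγa, hg.fderiv_eq hw,
        hg.apply_of_zCoord_eq_zero hw (hg.zCoord_christoffel hw _ _) (zCoord_yIncl _),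
        hg.apply_of_zCoord_eq_zero hw (zCoord_yIncl _) (hg.zCoord_christoffel hw _ _),
        yCoord_yIncl, yCoord_yIncl])
  refine ⟨W, hW, h0W, fun w hw => hWO hw, F, hF, hF0, hFd, fun w hw a b => ?_⟩
  rw [← hHa, ← hFH w hw, hHa]
  have : slice n (0, 0) = 0 := map_zero (slice n)
  rw [this, hbase]

end IsWalkerMetric

end Slice

/-! ### Existence of adapted flat Brinkmann charts -/

section FlatCharts

variable {n : ℕ} {M : Type*} [TopologicalSpace M] [ChartedSpace (Euc (n + 2)) M]
  [IsManifold (𝓡 (n + 2)) ∞ M] {h : LorentzianMetric n M}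
  {X : ∀ p : M, TangentSpace (𝓡 (n + 2)) p}
  {e : OpenPartialHomeomorph M (Euc (n + 2))} {q : Euc (n + 2)}

/-- Coordinates in which the induced metrics on the leaves of `X^⊥` are standard. -/
lemma exists_isFlatBrinkmannMetric (hX : IsBrinkmannWave h X)
    (hR : HasLightlikeHypersurfaceCurvature h X) (p : M) :
    ∃ e ∈ IsManifold.maximalAtlas (𝓡 (n + 2)) ∞ M, ∃ r > 0, e.target = Metric.ball 0 r ∧
      p ∈ e.source ∧ IsAdaptedChart X e ∧
      IsFlatBrinkmannMetric (metricInChart h e) e.target := by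
  obtain ⟨e₁, he₁, r₁, hr₁, htarget₁, hp, hep, hX₁, hg, hbase⟩ := exists_isWalkerMetric hX p
  set g := metricInChart h e₁ with hgdef
  have h0 : (0 : Euc (n + 2)) ∈ e₁.target := hep ▸ e₁.map_source hp
  have hy0 : ∀ q ∈ e₁.target, ∀ a : Euc n, g q (yIncl n a) (fieldInChart X e₁ q) = 0 :=
    fun q hq a => by
      rw [hX₁ q hq, hg.symm q hq, hg.stdVec_zero_left q hq, zCoord_yIncl]
  obtain ⟨W, hW, h0W, hWO, F, hF, hF0, hFd0, hFg⟩ := hg.exists_flat_leaf_coordinates h0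
    -- The vectors ∂/∂yₖ lie in Ξ^⊥, so by hypothesis the curvature on them is a multiple of ∂/∂x
    -- and has no y-part.
    (fun q hq a b c => by
      obtain ⟨r, hr⟩ := hR e₁ he₁ q hq (yIncl n a) (yIncl n b) (yIncl n c) (hy0 q hq a)
        (hy0 q hq b) (hy0 q hq c)
      rw [hr, hX₁ q hq, (coord_smul _ _).2.1, yCoord_stdVec_zero, smul_zero]) hbase
  let π : Euc (n + 2) →L[ℝ] Euc n × ℝ := (yProj n).prod (zProj n)
  have hπ : ∀ q, π q = (yCoord q, zCoord q) := fun q => rfl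
  have hU : IsOpen (e₁.target ∩ π ⁻¹' W) := e₁.open_target.inter (hW.preimage π.continuous)
  have hπ0 : π 0 = (0, 0) := map_zero π
  have h0U : (0 : Euc (n + 2)) ∈ e₁.target ∩ π ⁻¹' W :=
    ⟨h0, by rw [Set.mem_preimage, hπ0]; exact h0W⟩
  -- The change (x, y, z) ↦ (x, F(y, z), z) fixes ∂/∂x and dz. The dependence of F on z affects only
  -- the terms of the metric that contain dz.
  let ψ : Euc (n + 2) → Euc (n + 2) := fun q =>
    xCoord q • stdVec 0 + yIncl n (F (π q)) + zCoord q • zVec n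
  have hψs : ContDiffOn ℝ ∞ ψ (e₁.target ∩ π ⁻¹' W) :=
    ((((xProj n).contDiff.smul contDiff_const).contDiffOn).add
      ((yIncl n).contDiff.comp_contDiffOn
        (hF.comp π.contDiff.contDiffOn fun q hq => hq.2))).add
      (((zProj n).contDiff.smul contDiff_const).contDiffOn)
  have hψd : ∀ q, π q ∈ W → HasFDerivAt ψ ((xProj n).smulRight (stdVec 0) +
      (yIncl n).comp ((fderiv ℝ F (π q)).comp π) + (zProj n).smulRight (zVec n)) q := by
    intro q hq
    have hFq : HasFDerivAt F (fderiv ℝ F (π q)) (π q) :=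
      ((hF.contDiffAt (hW.mem_nhds hq)).differentiableAt (by simp)).hasFDerivAt
    exact (((xProj n).hasFDerivAt.smul_const (stdVec 0)).add
      ((yIncl n).hasFDerivAt.comp q (hFq.comp q π.hasFDerivAt))).add
      ((zProj n).hasFDerivAt.smul_const (zVec n))
  have hψa : ∀ q, π q ∈ W → ∀ v, fderiv ℝ ψ q v =
      xCoord v • stdVec 0 + yIncl n (fderiv ℝ F (π q) (yCoord v, zCoord v)) + zCoord v • zVec n :=
    fun q hq v => by
      rw [(hψd q hq).fderiv]
      rfl
  have hψx : ∀ q, π q ∈ W → ∀ v, xCoord (fderiv ℝ ψ q v) = xCoord v := fun q hq v => by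
    rw [hψa q hq]
    simp [coord_add, coord_smul]
  have hψy : ∀ q, π q ∈ W → ∀ v, yCoord (fderiv ℝ ψ q v) =
      fderiv ℝ F (π q) (yCoord v, zCoord v) := fun q hq v => by
    rw [hψa q hq]
    simp [coord_add, coord_smul]
  have hψz : ∀ q, π q ∈ W → ∀ v, zCoord (fderiv ℝ ψ q v) = zCoord v := fun q hq v => by
    rw [hψa q hq]
    simp [coord_add, coord_smul]
  have hψe : ∀ q, π q ∈ W → fderiv ℝ ψ q (stdVec 0) = stdVec 0 := fun q hq => by
    have h1 : ((0 : Euc n), (0 : ℝ)) = 0 := rfl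
    rw [hψa q hq]
    simp [h1]
  have hinj : Function.Injective (fderiv ℝ ψ 0).toLinearMap := by
    rw [← LinearMap.ker_eq_bot, LinearMap.ker_eq_bot']
    intro v hv
    have hv' : fderiv ℝ ψ 0 v = 0 := hv
    have hx := hψx 0 h0U.2 v
    have hy := hψy 0 h0U.2 v
    have hz := hψz 0 h0U.2 v
    rw [hv'] at hx hy hz
    have hz' : zCoord v = 0 := hz.symm
    rw [hz', hπ0, hFd0] at hy
    exact eq_of_coords hx.symm hy.symm hz.symm
  have hψ0 : HasFDerivAt ψ ((LinearEquiv.ofInjectiveEndo _ hinj).toContinuousLinearEquiv :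
      Euc (n + 2) →L[ℝ] Euc (n + 2)) 0 := by
    have h1 : ((LinearEquiv.ofInjectiveEndo _ hinj).toContinuousLinearEquiv :
        Euc (n + 2) →L[ℝ] Euc (n + 2)) = fderiv ℝ ψ 0 := by
      ext v
      rfl
    rw [h1]
    exact (hψd 0 h0U.2).differentiableAt.hasFDerivAt
  obtain ⟨Ψ, hΨ, h0Ψ, hΨU, hΨs, hΨi⟩ :=
    exists_openPartialHomeomorph_of_contDiffOn hU hψs h0U hψ0
  have hψ00 : ψ 0 = 0 := by
    have hx : xCoord (0 : Euc (n + 2)) = 0 := rfl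
    have hz : zCoord (0 : Euc (n + 2)) = 0 := rfl
    simp [ψ, hπ0, hF0, hx, hz]
  obtain ⟨e, he, r, hr, htarget, hsource, hep', hchart⟩ :=
    exists_chart_on_ball h X he₁ (hΨ ▸ hψs.mono hΨU) hΨs h0 h0Ψ
  have hp0 : e₁.symm 0 = p := by rw [← hep, e₁.left_inv hp]
  rw [hp0] at hsource
  rw [hΨ, hψ00] at htarget
  rw [hΨ] at hchart
  have hXe : IsAdaptedChart X e := fun q' hq' => by
    obtain ⟨x, hx, -, -, -, hf⟩ := hchart q' hq'
    rw [hf, hX₁ x hx.1, hψe x (hΨU hx.2).2]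
  refine ⟨e, he, r, hr, htarget, hsource, hXe,
    ⟨isMetricOn_metricInChart h he, fun q hq u v => hX.parallel.fderiv_stdVec_zero he hXe hq u v,
      fun q' hq' v => ?_⟩, fun q' hq' c d => ?_⟩
  · obtain ⟨x, hx, -, hinv, hm, -⟩ := hchart q' hq'
    have hxW := (hΨU hx.2).2
    have h1 := hm (stdVec 0) ((fderiv ℝ ψ x).inverse v)
    rw [hinv.self_apply_inverse, hψe x hxW, hg.stdVec_zero_left x hx.1, ← hψz x hxW,
      hinv.self_apply_inverse] at h1
    exact h1.symm
  · obtain ⟨x, hx, -, hinv, hm, -⟩ := hchart q' hq'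
    have hxW := (hΨU hx.2).2
    -- F was built from the metric on the slice x = 0; independence of x transfers its isometry
    -- property to all other points.
    have hconst : g x = g (slice n (π x)) := by
      have h1 := apply_add_smul_eq (g := g) (t := xCoord x) (x := slice n (π x)) e₁.open_target
        (by rw [htarget₁]; exact convex_ball 0 r₁) hg.contDiffOn
        (fun q hq => hg.fderiv_stdVec_zero q hq) (hWO _ hxW)
        (by rw [hπ, slice_add_smul]; exact hx.1)
      rwa [hπ, slice_add_smul] at h1
    -- Preimages of y-vectors have no z-part, and their x-parts do not matter, since g restricted to
    -- dz = 0 sees only y.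
    have hpre : ∀ c : Euc n, ∃ v, fderiv ℝ ψ x v = yIncl n c ∧ zCoord v = 0 ∧
        fderiv ℝ F (π x) (yCoord v, 0) = c := by
      intro c
      have h1 := hinv.self_apply_inverse (yIncl n c)
      have hz := hψz x hxW ((fderiv ℝ ψ x).inverse (yIncl n c))
      have hy := hψy x hxW ((fderiv ℝ ψ x).inverse (yIncl n c))
      rw [h1] at hz hy
      rw [zCoord_yIncl] at hz
      rw [← hz, yCoord_yIncl] at hy
      exact ⟨_, h1, hz.symm, hy.symm⟩
    obtain ⟨v, hv, hvz, hvy⟩ := hpre c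
    obtain ⟨w, hw, hwz, hwy⟩ := hpre d
    have h1 := hm v w
    rw [hv, hw, hg.apply_of_zCoord_eq_zero hx.1 hvz hwz, hconst, ← hFg _ hxW, hvy, hwy] at h1
    exact h1.symm

/-- A flat Brinkmann metric on a ball is of the form
`2 dx dz + f dz² + (∑ₖ uₖ dyₖ) dz + ∑ₖ dyₖ²`. -/
lemma IsFlatBrinkmannMetric.exists_isFlatBrinkmannChart
    (he : e ∈ IsManifold.maximalAtlas (𝓡 (n + 2)) ∞ M) {r : ℝ}
    (htarget : e.target = Metric.ball 0 r)
    (hg : IsFlatBrinkmannMetric (metricInChart h e) e.target) :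
    ∃ (a : Fin n → Euc n → ℝ → ℝ) (f : Euc n → ℝ → ℝ), IsFlatBrinkmannChart h e a f := by
  set g := metricInChart h e with hgdef
  have hslice : ∀ q ∈ e.target, slice n (yCoord q, zCoord q) ∈ e.target := fun q hq => by
    rw [htarget, mem_ball_zero_iff] at hq ⊢
    exact (norm_slice_le q).trans_lt hq
  have hconst : ∀ q ∈ e.target, g q = g (slice n (yCoord q, zCoord q)) := fun q hq => by
    have h1 := apply_add_smul_eq (g := g) (t := xCoord q) (x := slice n (yCoord q, zCoord q))
      e.open_target (by rw [htarget]; exact convex_ball 0 r) hg.contDiffOn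
      (fun q hq => hg.fderiv_stdVec_zero q hq) (hslice q hq) (by rw [slice_add_smul]; exact hq)
    rwa [slice_add_smul] at h1
  have hs : ContDiffOn ℝ ∞ (fun w => g (slice n w)) (yzDomain e) :=
    hg.contDiffOn.comp (slice n).contDiff.contDiffOn fun w hw => by
      obtain ⟨q, hq, rfl⟩ := hw
      exact hslice q hq
  have hs' : ∀ u v, ContDiffOn ℝ ∞ (fun w => g (slice n w) u v) (yzDomain e) := fun u v =>
    (hs.clm_apply contDiffOn_const).clm_apply contDiffOn_const
  -- The coefficients are read off on the slice x = 0. The factor 2 appears because the cross term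
  -- (∑ uₖ dyₖ) dz occurs once in the quadratic form, while g counts each mixed pair twice.
  refine ⟨fun k y z => 2 * g (slice n (y, z)) (zVec n) (yIncl n (stdVec k)),
    fun y z => g (slice n (y, z)) (zVec n) (zVec n),
    he, fun k => contDiffOn_const.mul (hs' _ _), hs' _ _, fun q hq v => ?_⟩
  rw [← hconst q hq]
  change g q v v = _
  have hsum : ∑ k, 2 * g q (zVec n) (yIncl n (stdVec k)) * yCoord v k =
      2 * g q (zVec n) (yIncl n (yCoord v)) := by
    conv_rhs => rw [← sum_smul_stdVec (yCoord v)]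
    rw [map_sum, map_sum, Finset.mul_sum]
    refine Finset.sum_congr rfl fun k _ => ?_
    rw [map_smul, map_smul, smul_eq_mul]
    ring
  rw [hsum]
  conv_lhs => rw [coord_decomp v]
  simp only [map_add, map_smul, add_apply, smul_apply, smul_eq_mul, hg.stdVec_zero_left q hq,
    hg.yIncl_yIncl q hq, hg.symm q hq (yIncl n (yCoord v)) (stdVec 0),
    hg.symm q hq (zVec n) (stdVec 0), hg.symm q hq (yIncl n (yCoord v)) (zVec n),
    zCoord_stdVec_zero, zCoord_yIncl, zCoord_zVec]
  have hsq : ∑ k, yCoord v k * yCoord v k = ∑ k, yCoord v k ^ 2 :=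
    Finset.sum_congr rfl fun k _ => (sq _).symm
  rw [hsq]
  ring

/-- Adapted flat Brinkmann charts with `d^*d φ = 0` around each point. -/
theorem exists_coclosed_chart (hX : IsBrinkmannWave h X)
    (hR : HasLightlikeHypersurfaceCurvature h X) (hric : IsRicciIsotropic h) (p : M) :
    ∃ e : OpenPartialHomeomorph M (Euc (n + 2)), p ∈ e.source ∧
      ∃ (a : Fin n → Euc n → ℝ → ℝ) (f : Euc n → ℝ → ℝ), IsFlatBrinkmannChart h e a f ∧
        IsAdaptedChart X e ∧ CoclosedDifferential e a := by
  obtain ⟨e, he, r, -, htarget, hp, hXe, hg⟩ := exists_isFlatBrinkmannMetric hX hR p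
  obtain ⟨a, f, hc⟩ := hg.exists_isFlatBrinkmannChart he htarget
  exact ⟨e, hp, a, f, hc, hXe, hc.coclosedDifferential_iff.2 fun q hq => hric e he q hq⟩

end FlatCharts

end BrinkmannWave

end

/-! ### The two equivalences -/

theorem proposition11 {n : ℕ} (hn : 0 < n) {M : Type*} [TopologicalSpace M]
    [ChartedSpace (EuclideanSpace ℝ (Fin (n + 2))) M] [IsManifold (𝓡 (n + 2)) ∞ M]
    (h : BrinkmannWave.LorentzianMetric n M) (X : ∀ p : M, TangentSpace (𝓡 (n + 2)) p)
    (hX : BrinkmannWave.IsBrinkmannWave h X)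
    (hR : BrinkmannWave.HasLightlikeHypersurfaceCurvature h X) :
    (BrinkmannWave.IsRicciIsotropic h ↔
      ∀ p : M, ∃ e : OpenPartialHomeomorph M (EuclideanSpace ℝ (Fin (n + 2))), p ∈ e.source ∧
        ∃ (u : Fin n → EuclideanSpace ℝ (Fin n) → ℝ → ℝ) (f : EuclideanSpace ℝ (Fin n) → ℝ → ℝ),
          BrinkmannWave.IsFlatBrinkmannChart h e u f ∧
          BrinkmannWave.CoclosedDifferential e u) ∧
    (BrinkmannWave.IsRicciIsotropic h ↔
      ∀ p : M, ∃ e : OpenPartialHomeomorph M (EuclideanSpace ℝ (Fin (n + 2))), p ∈ e.source ∧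
        ∃ (u : Fin n → EuclideanSpace ℝ (Fin n) → ℝ → ℝ) (f : EuclideanSpace ℝ (Fin n) → ℝ → ℝ),
          BrinkmannWave.IsFlatBrinkmannChart h e u f ∧
          BrinkmannWave.IsAdaptedChart X e ∧
          BrinkmannWave.CoclosedDifferential e u) := by
  -- The charts constructed from Ricci-isotropy are adapted to X, while the converse uses no
  -- adaptedness; the two implications together therefore yield both equivalences.
  have hflat := fun hric p => BrinkmannWave.exists_coclosed_chart (h := h) hX hR hric p
  refine ⟨⟨fun hric p => ?_, BrinkmannWave.isRicciIsotropic_of_charts⟩,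
    ⟨hflat, fun H => BrinkmannWave.isRicciIsotropic_of_charts fun p => ?_⟩⟩
  · obtain ⟨e, hp, u, f, hc, -, hco⟩ := hflat hric p
    exact ⟨e, hp, u, f, hc, hco⟩
  · obtain ⟨e, hp, u, f, hc, -, hco⟩ := H p
    exact ⟨e, hp, u, f, hc, hco⟩
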